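/- Let $\Sigma$ be a finite alphabet, let $\Gamma = \Sigma \cup \{¢, \$\}$, where $¢, \$ \notin \Sigma$ are end-markers, and for $k \in \mathbb{Z}$ let $\mathrm{sign}(k) = 0$ if $k = 0$ and $\mathrm{sign}(k) = 1$ otherwise. An input $x \in \Sigma^*$ of length $n$ is written as $w_x = ¢ x \$$ on a circular tape with squares $0, \dots, n+1$, and a configuration is a triple $(q, a, b)$ of a state, a counter value $a \in \mathbb{Z}$ and a head position $b \in \mathbb{Z}/(n+2)$; the initial configuration is $(q_0, 0, 0)$. A two-way deterministic one-counter automaton (2D1CA) consists of a finite state set $Q$, an initial state $q_0$, disjoint sets $Q_{acc}, Q_{rej} \subseteq Q$, and a function $\delta : Q \times \Gamma \times \{0,1\} \to Q \times \{-1,0,+1\} \times \{\leftarrow, \downarrow, \rightarrow\}$. In a configuration $(q,a,b)$ with $\delta(q, w_x(b), \mathrm{sign}(a)) = (q', c, d)$ it moves to $(q', a + c, b + \mu(d))$, where $\mu(\leftarrow), \mu(\downarrow), \mu(\rightarrow) = -1, 0, +1$. It accepts (rejects) $x$ if the first state of $Q_{acc} \cup Q_{rej}$ in its computation on $x$ exists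 and lies in $Q_{acc}$ (in $Q_{rej}$). It recognizes $L \subseteq \Sigma^*$ if it accepts every $x \in L$ and rejects every $x \in \Sigma^* \setminus L$. A two-way quantum one-counter automaton (2Q1CA) has instead amplitudes $\delta(q, \sigma, s, q', c, d) \in \mathbb{C}$ that define, for each input $x$, the operator $U_x |q,a,b\rangle = \sum_{q',c,d} \delta(q, w_x(b), \mathrm{sign}(a), q', c, d)\, |q', a+c, b+\mu(d)\rangle$ on $\ell^2$ of the set of configurations. It is required to be well-formed. That is, first, $\sum_{q',c,d} \overline{\delta(q_1,\sigma,s,q',c,d)}\,\delta(q_2,\sigma,s,q',c,d) = [q_1 = q_2]$ for all $q_1, q_2, \sigma, s$. Secondly, for each $(\Delta_c, \Delta_d) \in \{0,1,2\} \times \{-2,\dots,2\}$ with $\Delta_d > 0$ if $\Delta_c = 0$, $\sum \overline{\delta(q_1,\sigma_1,s_1,q',c_1,d_1)}\,\delta(q_2,\sigma_2,s_2,q',c_2,d_2) = 0$, summed over all $q'$ and all $c_1, c_2, d_1, d_2$ with $c_2 - c_1 = \Delta_c$ and $\mu(d_2) - \mu(d_1) = \Delta_d$, for all $q_1, q_2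 \in Q$, $\sigma_1, \sigma_2 \in \Gamma$ and $s_1, s_2 \in \{0,1\}$ such that $s_1 = s_2$ if $\Delta_c = 0$ and $\sigma_1 = \sigma_2$ if $\Delta_d = 0$. Moreover every $U_x$ is required to be unitary. A computation starts in the basis state $|q_0, 0, 0\rangle$; after every application of $U_x$ one observes whether the state is in $Q_{acc}$ (accept), in $Q_{rej}$ (reject) or in neither (continue with the projected superposition). The 2Q1CA is simple if there are linear operators $V_{\sigma,s}$ on $\ell^2(Q)$ and functions $C : Q \times \Gamma \to \{-1,0,+1\}$ and $D : Q \to \{\leftarrow,\downarrow,\rightarrow\}$ such that $\delta(q,\sigma,s,q',c,d) = \langle q' | V_{\sigma,s} | q \rangle$ if $C(q',\sigma) = c$ and $D(q') = d$, and $\delta(q,\sigma,s,q',c,d) = 0$ otherwise. A two-way reversible one-counter automaton (2R1CA) is a 2Q1CA all of whose amplitudes are $0$ or $1$. **Theorem.** For every language $L \subseteq \Sigma^*$ that is recognized by a 2D1CA, there is a simple 2R1CA that recognizes $L$ with no error: it accepts every $x \in L$ with probability $1$ and rejects every $x \in \Sigma^* \setminus L$ with probability $1$. In particular, every language recognized by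 a 2D1CA is recognized by a simple 2Q1CA with no error. -/

import Mathlib

/-- The tape alphabet `Γ = Σ ∪ {¢, $}`: the input letters and the two end-markers. -/
inductive TapeSymbol (α : Type*) where
  | leftEnd : TapeSymbol α
  | letter (a : α) : TapeSymbol α
  | rightEnd : TapeSymbol α

/-- The symbol `w_x(b)` in square `b` of the tape `w_x = ¢ x $`, for `0 ≤ b ≤ |x| + 1`. -/
def tapeSymbol {α : Type*} (x : List α) : ℕ → TapeSymbol α
  | 0 => TapeSymbol.leftEnd
  | i + 1 => match x[i]? with
    | some a => TapeSymbol.letter a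
    | none => TapeSymbol.rightEnd

/-- Configurations on an input of length `n`: the state, the value of the counter (an arbitrary
integer), and the head position. The tape `¢ x $` is circular and has `n + 2` squares, so the
positions are the residues modulo `n + 2`. -/
abbrev CounterConfig (Q : Type*) (n : ℕ) : Type _ := Q × ℤ × ZMod (n + 2)

/-- `sign k` is `0` (that is, `false`) if `k = 0`, and `1` (that is, `true`) otherwise. -/
def counterSign (k : ℤ) : Bool := decide (k ≠ 0)

/-- The configuration reached from counter value `a` and head position `b` when the machine enters
the state `q`, changes the counter by `c ∈ {-1, 0, +1}` and moves the head by `d`, where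
`d = -1, 0, +1` stands for `←, ↓, →`. -/
def moveTo {Q : Type*} {n : ℕ} (q : Q) (a : ℤ) (b : ZMod (n + 2)) (c d : SignType) :
    CounterConfig Q n :=
  (q, a + (c : ℤ), b + ((d : ℤ) : ZMod (n + 2)))

/-- Two-way deterministic one-counter automata (2D1CA) with input alphabet `α` and state set `Q`
(both are taken finite wherever the notion is used). The two `SignType`s in a value of `δ` are the
change `-1, 0, +1` of the counter and the head move `←, ↓, →`, written as `-1, 0, +1`. -/
structure TwoWayDet1CA (α Q : Type*) where
  δ : Q → TapeSymbol α → Bool → Q × SignType × SignType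
  start : Q
  acc : Set Q
  rej : Set Q
  disjoint : Disjoint acc rej

namespace TwoWayDet1CA

variable {α Q : Type*}

/-- One step of the automaton on the input `x`. -/
def step (M : TwoWayDet1CA α Q) (x : List α) (κ : CounterConfig Q x.length) :
    CounterConfig Q x.length :=
  let r := M.δ κ.1 (tapeSymbol x κ.2.2.val) (counterSign κ.2.1)
  moveTo r.1 κ.2.1 κ.2.2 r.2.1 r.2.2

/-- The configuration after `t` steps, from the start state with counter `0` and the head on `¢`. -/
def run (M : TwoWayDet1CA α Q) (x : List α) (t : ℕ) : CounterConfig Q x.length :=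
  (M.step x)^[t] (M.start, 0, 0)

/-- The first halting state entered on the input `x` is an accepting one. -/
def Accepts (M : TwoWayDet1CA α Q) (x : List α) : Prop :=
  ∃ t, (M.run x t).1 ∈ M.acc ∧ ∀ i < t, (M.run x i).1 ∉ M.acc ∪ M.rej

/-- The first halting state entered on the input `x` is a rejecting one. -/
def Rejects (M : TwoWayDet1CA α Q) (x : List α) : Prop :=
  ∃ t, (M.run x t).1 ∈ M.rej ∧ ∀ i < t, (M.run x i).1 ∉ M.acc ∪ M.rej

/-- The automaton accepts every word of `L` and rejects every other word. -/
def Recognizes (M : TwoWayDet1CA α Q) (L : Language α) : Prop :=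
  (∀ x ∈ L, M.Accepts x) ∧ ∀ x ∉ L, M.Rejects x

end TwoWayDet1CA

/-- The data of a two-way quantum one-counter automaton with input alphabet `α` and state set `Q`:
`δ q σ s q' c d` is the amplitude of the transition that reads `σ` in the state `q` while the
counter has sign `s`, enters `q'`, changes the counter by `c`, and moves the head by `d`
(`-1, 0, +1` for `←, ↓, →`). -/
structure TwoWayQuantum1CA (α Q : Type*) where
  δ : Q → TapeSymbol α → Bool → Q → SignType → SignType → ℂ
  start : Q
  acc : Set Q
  rej : Set Q
  disjoint : Disjoint acc rej

namespace TwoWayQuantum1CA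

variable {α Q : Type*}

open scoped ComplexConjugate in
open scoped Classical in
/-- The thirteen well-formedness conditions on the transition amplitudes. -/
structure WellFormed [Fintype Q] (M : TwoWayQuantum1CA α Q) : Prop where
  cond1 : ∀ q₁ q₂ σ s,
    ∑ q', ∑ c, ∑ d, conj (M.δ q₁ σ s q' c d) * M.δ q₂ σ s q' c d = if q₁ = q₂ then 1 else 0
  cond2 : ∀ q₁ q₂ σ₁ σ₂ s,
    ∑ q', ∑ c, (conj (M.δ q₁ σ₁ s q' c (-1)) * M.δ q₂ σ₂ s q' c 0
      + conj (M.δ q₁ σ₁ s q' c 0) * M.δ q₂ σ₂ s q' c 1) = 0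
  cond3 : ∀ q₁ q₂ σ₁ σ₂ s,
    ∑ q', ∑ c, conj (M.δ q₁ σ₁ s q' c (-1)) * M.δ q₂ σ₂ s q' c 1 = 0
  cond4 : ∀ q₁ q₂ σ s₁ s₂,
    ∑ q', ∑ d, (conj (M.δ q₁ σ s₁ q' (-1) d) * M.δ q₂ σ s₂ q' 0 d
      + conj (M.δ q₁ σ s₁ q' 0 d) * M.δ q₂ σ s₂ q' 1 d) = 0
  cond5 : ∀ q₁ q₂ σ₁ σ₂ s₁ s₂,
    ∑ q', (conj (M.δ q₁ σ₁ s₁ q' (-1) (-1)) * M.δ q₂ σ₂ s₂ q' 0 0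
      + conj (M.δ q₁ σ₁ s₁ q' (-1) 0) * M.δ q₂ σ₂ s₂ q' 0 1
      + conj (M.δ q₁ σ₁ s₁ q' 0 (-1)) * M.δ q₂ σ₂ s₂ q' 1 0
      + conj (M.δ q₁ σ₁ s₁ q' 0 0) * M.δ q₂ σ₂ s₂ q' 1 1) = 0
  cond6 : ∀ q₁ q₂ σ₁ σ₂ s₁ s₂,
    ∑ q', (conj (M.δ q₁ σ₁ s₁ q' (-1) 1) * M.δ q₂ σ₂ s₂ q' 0 0
      + conj (M.δ q₁ σ₁ s₁ q' (-1) 0) * M.δ q₂ σ₂ s₂ q' 0 (-1)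
      + conj (M.δ q₁ σ₁ s₁ q' 0 1) * M.δ q₂ σ₂ s₂ q' 1 0
      + conj (M.δ q₁ σ₁ s₁ q' 0 0) * M.δ q₂ σ₂ s₂ q' 1 (-1)) = 0
  cond7 : ∀ q₁ q₂ σ₁ σ₂ s₁ s₂,
    ∑ q', (conj (M.δ q₁ σ₁ s₁ q' (-1) (-1)) * M.δ q₂ σ₂ s₂ q' 0 1
      + conj (M.δ q₁ σ₁ s₁ q' 0 (-1)) * M.δ q₂ σ₂ s₂ q' 1 1) = 0
  cond8 : ∀ q₁ q₂ σ₁ σ₂ s₁ s₂,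
    ∑ q', (conj (M.δ q₁ σ₁ s₁ q' (-1) 1) * M.δ q₂ σ₂ s₂ q' 0 (-1)
      + conj (M.δ q₁ σ₁ s₁ q' 0 1) * M.δ q₂ σ₂ s₂ q' 1 (-1)) = 0
  cond9 : ∀ q₁ q₂ σ s₁ s₂,
    ∑ q', ∑ d, conj (M.δ q₁ σ s₁ q' (-1) d) * M.δ q₂ σ s₂ q' 1 d = 0
  cond10 : ∀ q₁ q₂ σ₁ σ₂ s₁ s₂,
    ∑ q', (conj (M.δ q₁ σ₁ s₁ q' (-1) (-1)) * M.δ q₂ σ₂ s₂ q' 1 0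
      + conj (M.δ q₁ σ₁ s₁ q' (-1) 0) * M.δ q₂ σ₂ s₂ q' 1 1) = 0
  cond11 : ∀ q₁ q₂ σ₁ σ₂ s₁ s₂,
    ∑ q', (conj (M.δ q₁ σ₁ s₁ q' (-1) 1) * M.δ q₂ σ₂ s₂ q' 1 0
      + conj (M.δ q₁ σ₁ s₁ q' (-1) 0) * M.δ q₂ σ₂ s₂ q' 1 (-1)) = 0
  cond12 : ∀ q₁ q₂ σ₁ σ₂ s₁ s₂,
    ∑ q', conj (M.δ q₁ σ₁ s₁ q' (-1) (-1)) * M.δ q₂ σ₂ s₂ q' 1 1 = 0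
  cond13 : ∀ q₁ q₂ σ₁ σ₂ s₁ s₂,
    ∑ q', conj (M.δ q₁ σ₁ s₁ q' (-1) 1) * M.δ q₂ σ₂ s₂ q' 1 (-1) = 0

/-- The time evolution `U_x` on the input `x`, given on basis vectors by
`U_x |q, a, b⟩ = ∑ δ(q, w_x(b), sign a, q', c, d) |q', a + c, b + d⟩`. Superpositions that arise in
a computation have finite support, so it is given here on finitely supported vectors. -/
noncomputable def evolve [Fintype Q] (M : TwoWayQuantum1CA α Q) (x : List α) :
    (CounterConfig Q x.length →₀ ℂ) →ₗ[ℂ] (CounterConfig Q x.length →₀ ℂ) :=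
  Finsupp.linearCombination ℂ fun κ : CounterConfig Q x.length =>
    ∑ q', ∑ c, ∑ d, Finsupp.single (moveTo q' κ.2.1 κ.2.2 c d)
      (M.δ κ.1 (tapeSymbol x κ.2.2.val) (counterSign κ.2.1) q' c d)

open scoped Classical in
/-- For every input `x`, the time evolution `U_x` is (extends to) a unitary operator on the Hilbert
space `ℓ²` over the set of configurations. -/
def HasUnitaryEvolution [Fintype Q] (M : TwoWayQuantum1CA α Q) : Prop :=
  ∀ x : List α,
    ∃ U ∈ unitary (lp (fun _ : CounterConfig Q x.length => ℂ) 2 →L[ℂ]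
        lp (fun _ : CounterConfig Q x.length => ℂ) 2),
      ∀ κ κ', U (lp.single 2 κ (1 : ℂ)) κ' = M.evolve x (Finsupp.single κ 1) κ'

/-- A 2R1CA: a well-formed two-way quantum one-counter automaton (with unitary evolution) whose
transition amplitudes only take the values `0` and `1`. -/
def IsReversible [Fintype Q] (M : TwoWayQuantum1CA α Q) : Prop :=
  M.WellFormed ∧ M.HasUnitaryEvolution ∧
    ∀ q σ s q' c d, M.δ q σ s q' c d = 0 ∨ M.δ q σ s q' c d = 1

open scoped Classical in
/-- `M` is simple: there are linear operators `V σ s` on the space spanned by the states, a counter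
function `C` and a head function `D` that determine the amplitudes. -/
def IsSimple (M : TwoWayQuantum1CA α Q) : Prop :=
  ∃ (V : TapeSymbol α → Bool → (Q → ℂ) →ₗ[ℂ] (Q → ℂ)) (C : Q → TapeSymbol α → SignType)
    (D : Q → SignType), ∀ q σ s q' c d,
      M.δ q σ s q' c d = if C q' σ = c ∧ D q' = d then V σ s (Pi.single q 1) q' else 0

open scoped Classical in
/-- The (unnormalized) non-halting part of the superposition after `t` steps: it starts as the
basis vector of the initial configuration, and after every application of `U_x` the state is
observed and only the non-halting component is continued. -/
noncomputable def nonhalting [Fintype Q] (M : TwoWayQuantum1CA α Q) (x : List α) :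
    ℕ → (CounterConfig Q x.length →₀ ℂ)
  | 0 => Finsupp.single (M.start, 0, 0) 1
  | t + 1 => (M.evolve x (M.nonhalting x t)).filter fun κ => κ.1 ∉ M.acc ∪ M.rej

open scoped Classical in
/-- The probability that the observation after step `t + 1` is the first halting one and finds a
state in `F`. -/
noncomputable def haltProbAt [Fintype Q] (M : TwoWayQuantum1CA α Q) (F : Set Q) (x : List α)
    (t : ℕ) : ℝ :=
  ((M.evolve x (M.nonhalting x t)).filter fun κ => κ.1 ∈ F).sum fun _ z => ‖z‖ ^ 2

/-- The probability that `M` accepts the input `x`. -/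
noncomputable def acceptProb [Fintype Q] (M : TwoWayQuantum1CA α Q) (x : List α) : ℝ :=
  ∑' t, M.haltProbAt M.acc x t

/-- The probability that `M` rejects the input `x`. -/
noncomputable def rejectProb [Fintype Q] (M : TwoWayQuantum1CA α Q) (x : List α) : ℝ :=
  ∑' t, M.haltProbAt M.rej x t

/-- `M` recognizes `L` with probability `p > 1/2`: it accepts every word of `L`, and rejects every
other word, with probability at least `p`. For `p = 1`, this is recognition with no error. -/
def RecognizesWithProb [Fintype Q] (M : TwoWayQuantum1CA α Q) (L : Language α) (p : ℝ) : Prop :=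
  1 / 2 < p ∧ (∀ x ∈ L, p ≤ M.acceptProb x) ∧ ∀ x ∉ L, p ≤ M.rejectProb x

end TwoWayQuantum1CA

/-! A deterministic machine is irreversible because a configuration can have several predecessors.
It has at most one successor, though, so the configurations that lead to a halting one form a tree
with that root, and a depth-first walk around a tree can be run backwards. If the entered state
determines the counter change and the head move, then all predecessors of a configuration have the
same counter value and head position, so a step of the walk is local (`turn`). Reversing the
direction and the order of siblings inverts it (`turn_neg_swap`). Hence it permutes the states for
each symbol and sign, which gives simplicity, well-formedness and unitarity of `toQuantum`. The walk
reaches the root if the branches that it enters are finite.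

The counter is unbounded, so branches can be infinite. An infinite branch is a backward chain
without repetition; eventually its counter is nonzero, and its nodes (state, head position) form a
backward chain of a map on a finite set, so they are periodic (`acc_pred_of_periodic`). It therefore
suffices to simulate the given machine by one whose action on nodes terminates when every counter
test is answered by "nonzero".

That machine is `lapMachine`. Between two zeros of the counter it walks around the configuration
graph in which counter value `0` is terminal. Infinite branches there lie over periodic nodes, where
the node map is injective, so they cannot leave the path to the end on both sides
(`false_of_branches`); one of two opposite orders of siblings succeeds (`visits_or_visits_neg`). The
machine tries one order, and if the walk runs into a cycle of nodes, undoes it and takes the other.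
A cycle is recognised with memory independent of the input by recording the states at peaks, from
which the walk never again goes further right: all peaks of a cycle lie on its rightmost square, so
a repeated state is a repeated node (`Walker.eq_of_peak`). Since the records only allow finitely
many peaks, nonzero answers always lead to a stop.

Whether a square is a peak depends on the possible excursions to its left, a table that a finite
automaton computes from the squares left of the head (`Walker.peak_iff`). To keep the state of this
automaton available, `LookbehindMachine.compile` recomputes it after left moves by the method of
Hopcroft and Ullman. Spurious configurations with a wrong automaton state could still loop, so at
counter value `0` the state is verified before every transition, with the counter as a measure of
distance (`notMem_periodicPts_of_reachesWith`). -/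

/-- A partial deterministic one-counter automaton in which the entered state determines the change
of the counter and the move of the head. -/
structure PartialMachine (α P : Type*) where
  next : TapeSymbol α → Bool → P → Option P
  counter : P → SignType
  head : P → SignType

/-! ### Reversible depth-first traversal of the configuration graph -/

namespace PartialMachine

variable {α P : Type*}

/-- One step of a partial machine. -/
def step (K : PartialMachine α P) (x : List α) (v : CounterConfig P x.length) :
    Option (CounterConfig P x.length) :=
  (K.next (tapeSymbol x v.2.2.val) (counterSign v.2.1) v.1).map fun p =>
    moveTo p v.2.1 v.2.2 (K.counter p) (K.head p)

/-- The configuration `v` is reachable from `u`. -/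
def Reaches (K : PartialMachine α P) (x : List α) :
    CounterConfig P x.length → CounterConfig P x.length → Prop :=
  Relation.ReflTransGen fun u v => K.step x u = some v

open scoped Classical in
/-- An element of `A` on which `e` is minimal. -/
noncomputable def leastOn [Finite P] (e : P → ℤ) (A : Set P) : Option P :=
  if h : A.Nonempty then some (Set.exists_min_image A e A.toFinite h).choose else none

theorem leastOn_eq_none [Finite P] {e : P → ℤ} {A : Set P} : leastOn e A = none ↔ A = ∅ := by
  unfold leastOn
  split_ifs with h
  · simp [h.ne_empty]
  · simp [Set.not_nonempty_iff_eq_empty.1 h]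

theorem leastOn_eq_some [Finite P] {e : P → ℤ} (he : e.Injective) {A : Set P} {p : P} :
    leastOn e A = some p ↔ p ∈ A ∧ ∀ r ∈ A, e p ≤ e r := by
  unfold leastOn
  split_ifs with h
  · obtain ⟨h1, h2⟩ := (Set.exists_min_image A e A.toFinite h).choose_spec
    constructor
    · intro hp
      obtain rfl := Option.some.inj hp
      exact ⟨h1, h2⟩
    · rintro ⟨h3, h4⟩
      exact congrArg some (he (le_antisymm (h2 p h3) (h4 _ h1)))
  · simp only [false_iff]
    exact fun hp => h ⟨p, hp.1⟩

/-- The transition of the depth-first traversal of the configuration graph. The state `(q, false)`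
is about to explore the predecessors of `q`, the state `(q, true)` has explored them; siblings are
visited in increasing order of `e`. -/
noncomputable def turn [Finite P] (K : PartialMachine α P) (e : P → ℤ) (σ : TapeSymbol α) (s : Bool) :
    P × Bool → P × Bool
  | (q, false) =>
    match leastOn e {p | K.next σ s p = some q} with
    | some p => (p, false)
    | none => (q, true)
  | (q, true) =>
    match K.next σ s q with
    | none => (q, false)
    | some u =>
      match leastOn e {p | K.next σ s p = some u ∧ e q < e p} with
      | some p => (p, false)
      | none => (u, true)

/-- The reversal of the direction of the traversal. -/
def swap (w : P × Bool) : P × Bool := (w.1, !w.2)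

@[simp] theorem swap_swap (w : P × Bool) : swap (swap w) = w := by simp [swap]

theorem swap_injective : Function.Injective (swap : P × Bool → P × Bool) :=
  Function.LeftInverse.injective swap_swap

/-- Walking around a tree with the siblings in the opposite order is the same walk run backwards:
descending to the first child becomes ascending from the last one, and the next sibling becomes the
previous one. At a missing successor `(q, true)` turns into `(q, false)`, which closes the walk and
keeps the map invertible. -/
theorem turn_neg_swap [Finite P] (K : PartialMachine α P) {e : P → ℤ} (he : e.Injective)
    (σ : TapeSymbol α) (s : Bool) (w : P × Bool) :
    K.turn (fun q => -e q) σ s (swap (K.turn e σ s w)) = swap w := by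
  have he' : Function.Injective fun q => -e q := fun a b h => he (neg_injective h)
  obtain ⟨q, _ | _⟩ := w
  · rcases h : leastOn e {p | K.next σ s p = some q} with _ | p
    · have h1 : leastOn (fun q => -e q) {p | K.next σ s p = some q} = none :=
        leastOn_eq_none.2 (leastOn_eq_none.1 h)
      simp [turn, h, h1, swap]
    · obtain ⟨h1, h2⟩ := (leastOn_eq_some he).1 h
      have h1 : K.next σ s p = some q := h1
      have h3 : leastOn (fun q => -e q) {r | K.next σ s r = some q ∧ -e p < -e r} = none := by
        refine leastOn_eq_none.2 (Set.eq_empty_of_forall_notMem ?_)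
        rintro r ⟨hr, hr'⟩
        have := h2 r hr
        omega
      simp [turn, h, swap, h1]
      simp at h3
      simp [h3]
  · rcases hq : K.next σ s q with _ | u
    · simp [turn, hq, swap]
    · rcases h : leastOn e {p | K.next σ s p = some u ∧ e q < e p} with _ | p
      · have h1 : leastOn (fun q => -e q) {p | K.next σ s p = some u} = some q := by
          refine (leastOn_eq_some he').2 ⟨hq, fun r hr => ?_⟩
          by_contra hlt
          have : r ∈ {p | K.next σ s p = some u ∧ e q < e p} := ⟨hr, by simp at hlt; exact hlt⟩
          rw [leastOn_eq_none.1 h] at this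
          exact this
        simp [turn, hq, h, swap, h1]
      · obtain ⟨⟨h1, h1'⟩, h2⟩ := (leastOn_eq_some he).1 h
        have h3 : leastOn (fun q => -e q) {r | K.next σ s r = some u ∧ -e p < -e r} = some q := by
          refine (leastOn_eq_some he').2 ⟨⟨hq, by omega⟩, ?_⟩
          rintro r ⟨hr, hr'⟩
          by_contra hlt
          have := h2 r ⟨hr, by omega⟩
          omega
        simp [turn, hq, h, swap, h1]
        simp at h3
        simp [h3]

theorem turn_injective [Finite P] (K : PartialMachine α P) {e : P → ℤ} (he : e.Injective)
    (σ : TapeSymbol α) (s : Bool) : Function.Injective (K.turn e σ s) := by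
  intro w w' h
  apply swap_injective
  rw [← K.turn_neg_swap he σ s w, h, K.turn_neg_swap he σ s w']

/-- The change of the counter on entering a state of the traversal. -/
def dartCounter (K : PartialMachine α P) (w : P × Bool) : SignType :=
  if w.2 then K.counter w.1 else -K.counter w.1

/-- The move of the head on entering a state of the traversal. -/
def dartHead (K : PartialMachine α P) (w : P × Bool) : SignType :=
  if w.2 then K.head w.1 else -K.head w.1

@[simp] theorem dartCounter_swap (K : PartialMachine α P) (w : P × Bool) :
    K.dartCounter (swap w) = -K.dartCounter w := by
  rcases w with ⟨q, _ | _⟩ <;> simp [dartCounter, swap]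

@[simp] theorem dartHead_swap (K : PartialMachine α P) (w : P × Bool) :
    K.dartHead (swap w) = -K.dartHead w := by
  rcases w with ⟨q, _ | _⟩ <;> simp [dartHead, swap]

/-- One step of the traversal. -/
noncomputable def tour [Finite P] (K : PartialMachine α P) (e : P → ℤ) (x : List α)
    (κ : CounterConfig (P × Bool) x.length) : CounterConfig (P × Bool) x.length :=
  let w := K.turn e (tapeSymbol x κ.2.2.val) (counterSign κ.2.1) κ.1
  moveTo w κ.2.1 κ.2.2 (K.dartCounter w) (K.dartHead w)

/-- The configuration of the reversed traversal. -/
def rev {n : ℕ} (K : PartialMachine α P) (κ : CounterConfig (P × Bool) n) :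
    CounterConfig (P × Bool) n :=
  (swap κ.1, κ.2.1 - (K.dartCounter κ.1 : ℤ), κ.2.2 - ((K.dartHead κ.1 : ℤ) : ZMod (n + 2)))

@[simp] theorem rev_rev {n : ℕ} (K : PartialMachine α P) (κ : CounterConfig (P × Bool) n) :
    K.rev (K.rev κ) = κ := by
  simp [rev]

/-- `rev` takes back the last move of counter and head, so the reversed walk reads the same symbol
and sign as the step that it undoes. -/
theorem tour_neg_rev [Finite P] (K : PartialMachine α P) {e : P → ℤ} (he : e.Injective) (x : List α)
    (κ : CounterConfig (P × Bool) x.length) :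
    K.tour (fun q => -e q) x (K.rev (K.tour e x κ)) = K.rev κ := by
  obtain ⟨w, a, b⟩ := κ
  simp only [tour, rev, moveTo, add_sub_cancel_right, turn_neg_swap K he, dartCounter_swap,
    dartHead_swap, SignType.coe_neg, Int.cast_neg, ← sub_eq_add_neg]

theorem tour_injective [Finite P] (K : PartialMachine α P) {e : P → ℤ} (he : e.Injective)
    (x : List α) : Function.Injective (K.tour e x) := by
  intro w w' h
  rw [← K.rev_rev w, ← K.tour_neg_rev he x w, h, K.tour_neg_rev he x w', rev_rev]

variable {n : ℕ}

/-- The configuration of the traversal that has explored the predecessors of `v`. -/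
def up (v : CounterConfig P n) : CounterConfig (P × Bool) n := ((v.1, true), v.2)

/-- The configuration of the traversal that is about to explore the predecessors of `v`. -/
def down (K : PartialMachine α P) (v : CounterConfig P n) : CounterConfig (P × Bool) n :=
  ((v.1, false), v.2.1 - (K.counter v.1 : ℤ), v.2.2 - ((K.head v.1 : ℤ) : ZMod (n + 2)))

theorem down_injective (K : PartialMachine α P) :
    Function.Injective (K.down : CounterConfig P n → _) := by
  rintro ⟨p, a, b⟩ ⟨p', a', b'⟩ h
  simp only [down, Prod.mk.injEq] at h
  obtain ⟨⟨rfl, -⟩, h1, h2⟩ := h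
  simpa [-SignType.intCast_cast] using And.intro h1 h2

theorem rev_up (K : PartialMachine α P) (v : CounterConfig P n) : K.rev (up v) = K.down v := by
  simp [rev, up, down, swap, dartCounter, dartHead]

/-- The position of a predecessor of `v`. -/
theorem eq_of_step {K : PartialMachine α P} {x : List α} {u v : CounterConfig P x.length}
    (h : K.step x u = some v) :
    u = (u.1, v.2.1 - (K.counter v.1 : ℤ), v.2.2 - ((K.head v.1 : ℤ) : ZMod (x.length + 2))) ∧
      K.next (tapeSymbol x (v.2.2 - ((K.head v.1 : ℤ) : ZMod (x.length + 2))).val)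
        (counterSign (v.2.1 - (K.counter v.1 : ℤ))) u.1 = some v.1 := by
  obtain ⟨p, a, b⟩ := u
  simp only [step, Option.map_eq_some_iff] at h
  obtain ⟨q, h1, rfl⟩ := h
  simp [moveTo, h1]

theorem step_eq_some {K : PartialMachine α P} {x : List α} {p : P} {v : CounterConfig P x.length}
    (h : K.next (tapeSymbol x (v.2.2 - ((K.head v.1 : ℤ) : ZMod (x.length + 2))).val)
        (counterSign (v.2.1 - (K.counter v.1 : ℤ))) p = some v.1) :
    K.step x (p, v.2.1 - (K.counter v.1 : ℤ), v.2.2 - ((K.head v.1 : ℤ) : ZMod (x.length + 2)))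
      = some v := by
  simp [-SignType.intCast_cast, step, h, moveTo]

theorem eq_of_step_of_fst_eq {K : PartialMachine α P} {x : List α}
    {u u' v : CounterConfig P x.length} (h : K.step x u = some v) (h' : K.step x u' = some v)
    (hu : u.1 = u'.1) : u = u' := by
  rw [(eq_of_step h).1, (eq_of_step h').1, hu]

/-! ### Following a path with the traversal -/

section Tour

variable [Finite P] {K : PartialMachine α P} {e : P → ℤ} {x : List α}
  {u v : CounterConfig P x.length}

/-- In `K.down v` the counter and the head are where every predecessor of `v` must be
(`eq_of_step`), so the set inspected by `turn` consists of the states of the predecessors of `v`. -/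
theorem tour_down_leaf (h : ∀ u, K.step x u ≠ some v) : K.tour e x (K.down v) = up v := by
  have : leastOn e {p | K.next (tapeSymbol x (v.2.2 - ((K.head v.1 : ℤ) : ZMod (x.length + 2))).val)
        (counterSign (v.2.1 - (K.counter v.1 : ℤ))) p = some v.1} = none :=
    leastOn_eq_none.2 (Set.eq_empty_of_forall_notMem fun p hp => h _ (step_eq_some hp))
  simp [-SignType.intCast_cast, tour, down, turn, this, up, moveTo, dartCounter, dartHead]

theorem tour_down (he : e.Injective) (hu : K.step x u = some v)
    (h : ∀ u', K.step x u' = some v → e u.1 ≤ e u'.1) : K.tour e x (K.down v) = K.down u := by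
  obtain ⟨h1, h2⟩ := eq_of_step hu
  have : leastOn e {p | K.next (tapeSymbol x (v.2.2 - ((K.head v.1 : ℤ) : ZMod (x.length + 2))).val)
        (counterSign (v.2.1 - (K.counter v.1 : ℤ))) p = some v.1} = some u.1 :=
    (leastOn_eq_some he).2 ⟨h2, fun r hr => h _ (step_eq_some hr)⟩
  rw [h1]
  simp [-SignType.intCast_cast, tour, down, turn, this, moveTo, dartCounter, dartHead, SignType.coe_neg, ← sub_eq_add_neg]

theorem tour_up_root (h : K.step x v = none) : K.tour e x (up v) = K.down v := by
  simp only [step, Option.map_eq_none_iff] at h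
  simp [tour, up, turn, h, moveTo, down, dartCounter, dartHead, sub_eq_add_neg]

theorem tour_up_next (he : e.Injective) (hv : K.step x v = some u) {v' : CounterConfig P x.length}
    (hv' : K.step x v' = some u) (hlt : e v.1 < e v'.1)
    (h : ∀ v'', K.step x v'' = some u → e v.1 < e v''.1 → e v'.1 ≤ e v''.1) :
    K.tour e x (up v) = K.down v' := by
  obtain ⟨h1, h2⟩ := eq_of_step hv
  obtain ⟨h1', h2'⟩ := eq_of_step hv'
  have : leastOn e {p | K.next (tapeSymbol x (u.2.2 - ((K.head u.1 : ℤ) : ZMod (x.length + 2))).val)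
        (counterSign (u.2.1 - (K.counter u.1 : ℤ))) p = some u.1 ∧ e v.1 < e p} = some v'.1 :=
    (leastOn_eq_some he).2 ⟨⟨h2', hlt⟩, fun r hr => h _ (step_eq_some hr.1) hr.2⟩
  rw [h1, h1']
  simp [-SignType.intCast_cast, tour, down, up, turn, h2, this, moveTo, dartCounter, dartHead, SignType.coe_neg, ← sub_eq_add_neg]

theorem tour_up_last (hv : K.step x v = some u)
    (h : ∀ v', K.step x v' = some u → e v'.1 ≤ e v.1) : K.tour e x (up v) = up u := by
  obtain ⟨h1, h2⟩ := eq_of_step hv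
  have : leastOn e {p | K.next (tapeSymbol x (u.2.2 - ((K.head u.1 : ℤ) : ZMod (x.length + 2))).val)
        (counterSign (u.2.1 - (K.counter u.1 : ℤ))) p = some u.1 ∧ e v.1 < e p} = none :=
    leastOn_eq_none.2 (Set.eq_empty_of_forall_notMem fun p hp =>
      absurd (h _ (step_eq_some hp.1)) (not_le.2 hp.2))
  rw [h1]
  simp [-SignType.intCast_cast, tour, up, turn, h2, this, moveTo, dartCounter, dartHead]

/-- The predecessor relation. -/
def Pred (K : PartialMachine α P) (x : List α) (u v : CounterConfig P x.length) : Prop :=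
  K.step x u = some v

/-- A configuration of the traversal that stands for a configuration with a successor. -/
def Interior (K : PartialMachine α P) (x : List α) (κ : CounterConfig (P × Bool) x.length) : Prop :=
  ∃ v : CounterConfig P x.length, (K.step x v).isSome ∧ (κ = up v ∨ κ = K.down v)

/-- The traversal leads from `κ` to `κ'` through configurations that have successors. -/
def Visits (K : PartialMachine α P) (e : P → ℤ) (x : List α) :
    CounterConfig (P × Bool) x.length → CounterConfig (P × Bool) x.length → Prop :=
  Relation.ReflTransGen fun κ κ' => K.Interior x κ ∧ K.tour e x κ = κ'

theorem visits_up (h : (K.step x v).isSome) : K.Visits e x (up v) (K.tour e x (up v)) :=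
  .single ⟨⟨v, h, .inl rfl⟩, rfl⟩

theorem visits_down (h : (K.step x v).isSome) : K.Visits e x (K.down v) (K.tour e x (K.down v)) :=
  .single ⟨⟨v, h, .inr rfl⟩, rfl⟩

theorem wellFounded_rank_gt (e : P → ℤ) : WellFounded fun p q : P => e q < e p :=
  haveI : IsTrans P fun p q => e q < e p := ⟨fun _ _ _ h h' => lt_trans h' h⟩
  haveI : Std.Irrefl fun p q : P => e q < e p := ⟨fun _ => lt_irrefl _⟩
  Finite.wellFounded_of_trans_of_irrefl _

/-- The least predecessor of `u` above a bound. -/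
theorem exists_least_pred (B : P → Prop) (h : ∃ v, K.step x v = some u ∧ B v.1) :
    ∃ v, K.step x v = some u ∧ B v.1 ∧
      ∀ v', K.step x v' = some u → B v'.1 → e v.1 ≤ e v'.1 := by
  obtain ⟨v, hv, hB⟩ := h
  obtain ⟨p, ⟨v, ⟨hv, hB⟩, rfl⟩, hp⟩ :=
    Set.exists_min_image (Prod.fst '' {v | K.step x v = some u ∧ B v.1}) e (Set.toFinite _)
      ⟨v.1, v, ⟨hv, hB⟩, rfl⟩
  exact ⟨v, hv, hB, fun v' h1 h2 => hp _ ⟨v', ⟨h1, h2⟩, rfl⟩⟩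

/-- Induction on the later siblings of `v`: each is explored completely and hands over to the next,
and the last one to `u`. -/
theorem visits_up_up (he : e.Injective) (hv : K.step x v = some u)
    (h : ∀ v', K.step x v' = some u → e v.1 < e v'.1 → K.Visits e x (K.down v') (up v')) :
    K.Visits e x (up v) (up u) := by
  generalize hp : v.1 = p
  induction p using (wellFounded_rank_gt e).induction generalizing v with
  | _ p ih =>
  subst hp
  refine (visits_up (by simp [hv])).trans ?_
  by_cases hex : ∃ v', K.step x v' = some u ∧ e v.1 < e v'.1
  · obtain ⟨v', h1, h2, h3⟩ := exists_least_pred (e := e) (fun p => e v.1 < e p) hex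
    rw [tour_up_next he hv h1 h2 h3]
    exact (h v' h1 h2).trans
      (ih v'.1 h2 h1 (fun v'' h4 h5 => h v'' h4 (h2.trans h5)) rfl)
  · push Not at hex
    rw [tour_up_last hv hex]

theorem visits_up_down (he : e.Injective) (hv : K.step x v = some u)
    {v₀ : CounterConfig P x.length} (hv₀ : K.step x v₀ = some u) (hlt : e v.1 < e v₀.1)
    (h : ∀ v', K.step x v' = some u → e v.1 < e v'.1 → e v'.1 < e v₀.1 →
      K.Visits e x (K.down v') (up v')) :
    K.Visits e x (up v) (K.down v₀) := by
  generalize hp : v.1 = p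
  induction p using (wellFounded_rank_gt e).induction generalizing v with
  | _ p ih =>
  subst hp
  refine (visits_up (by simp [hv])).trans ?_
  obtain ⟨v', h1, h2, h3⟩ := exists_least_pred (e := e) (fun p => e v.1 < e p) ⟨v₀, hv₀, hlt⟩
  rw [tour_up_next he hv h1 h2 h3]
  rcases (h3 v₀ hv₀ hlt).eq_or_lt with h4 | h4
  · rw [eq_of_step_of_fst_eq h1 hv₀ (he h4)]
  · exact (h v' h1 h2 h4).trans
      (ih v'.1 h2 h1 h4 (fun v'' h4 h5 => h v'' h4 (h2.trans h5)) rfl)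

theorem visits_down_up_of_pred (he : e.Injective) (hu : (K.step x u).isSome)
    (h : ∀ v, K.step x v = some u → K.Visits e x (K.down v) (up v)) :
    K.Visits e x (K.down u) (up u) := by
  refine (visits_down hu).trans ?_
  by_cases hex : ∃ v, K.step x v = some u
  · obtain ⟨v, h1, -, h3⟩ := exists_least_pred (e := e) (fun _ => True) (by simpa using hex)
    rw [tour_down he h1 (by simpa using h3)]
    exact (h v h1).trans (visits_up_up he h1 fun v' h4 _ => h v' h4)
  · push Not at hex
    rw [tour_down_leaf hex]

theorem visits_down_down (he : e.Injective)
    (hv : K.step x v = some u)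
    (h : ∀ v', K.step x v' = some u → e v'.1 < e v.1 → K.Visits e x (K.down v') (up v')) :
    K.Visits e x (K.tour e x (K.down u)) (K.down v) := by
  obtain ⟨v', h1, -, h3⟩ := exists_least_pred (e := e) (K := K) (x := x) (u := u) (fun _ => True)
    ⟨v, hv, trivial⟩
  rw [tour_down he h1 (by simpa using h3)]
  rcases (h3 v hv trivial).eq_or_lt with h4 | h4
  · rw [eq_of_step_of_fst_eq h1 hv (he h4)]
    exact .refl
  · exact (h v' h1 h4).trans (visits_up_down he h1 hv h4 fun v'' h5 _ h6 => h v'' h5 h6)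

/-- Accessibility excludes infinite branches below `v`, so the walk comes back by induction on the
subtree. -/
theorem visits_down_up (he : e.Injective) (hv : Acc (K.Pred x) v) (h : (K.step x v).isSome) :
    K.Visits e x (K.down v) (up v) := by
  induction hv with
  | intro v _ ih =>
  exact visits_down_up_of_pred he h fun u hu => ih u hu (by simp [show K.step x u = some v from hu])

/-- If all branches off the path are well-founded, then the traversal follows the path. -/
theorem visits_of_reaches (he : e.Injective) (h : K.Reaches x v u)
    (hacc : ∀ w w' s, K.Reaches x v w → K.step x w = some w' → K.step x s = some w' →
      e w.1 < e s.1 → Acc (K.Pred x) s) : K.Visits e x (up v) (up u) := by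
  induction h with
  | refl => exact .refl
  | @tail w w' hw hstep ih =>
    refine ih.trans (visits_up_up he hstep fun s hs hlt => ?_)
    exact visits_down_up he (hacc w w' s hw hstep hs hlt) (by simp [hs])

/-- Either the traversal follows the path, or it enters a branch that is not well-founded. -/
theorem visits_or_branch (he : e.Injective) (h : K.Reaches x v u) :
    K.Visits e x (up v) (up u) ∨ ∃ w w' s, K.Reaches x v w ∧ K.step x w = some w' ∧
      K.Reaches x w' u ∧ K.step x s = some w' ∧ e w.1 < e s.1 ∧ ¬Acc (K.Pred x) s ∧
      K.Visits e x (up v) (K.down s) := by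
  induction h with
  | refl => exact .inl .refl
  | @tail w w' hw hstep ih =>
    rcases ih with ih | ⟨z, z', s, h1, h2, h3, h4, h5, h6, h7⟩
    · by_cases hex : ∃ s, K.step x s = some w' ∧ e w.1 < e s.1 ∧ ¬Acc (K.Pred x) s
      -- The least sibling with an infinite branch is entered, because those before it are explored
      -- completely. Among siblings the state determines the configuration, so a predicate on states
      -- suffices.
      · obtain ⟨s, hs, ⟨hlt, hacc⟩, hmin⟩ := exists_least_pred (K := K) (x := x) (e := e) (u := w')
          (fun p => e w.1 < e p ∧ ∃ s, K.step x s = some w' ∧ s.1 = p ∧ ¬Acc (K.Pred x) s)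
          (by obtain ⟨s, h1, h2, h3⟩ := hex; exact ⟨s, h1, h2, s, h1, rfl, h3⟩)
        obtain ⟨s', hs', hss, hacc⟩ := hacc
        obtain rfl := eq_of_step_of_fst_eq hs' hs hss
        refine .inr ⟨w, w', s', hw, hstep, .refl, hs, hlt, hacc,
          ih.trans (visits_up_down he hstep hs hlt fun v' h1 h2 h3 => ?_)⟩
        refine visits_down_up he ?_ (by simp [h1])
        by_contra hv'
        exact absurd (hmin v' h1 ⟨h2, v', h1, rfl, hv'⟩) (not_le.2 h3)
      · push Not at hex
        exact .inl (ih.trans (visits_up_up he hstep fun s hs hlt =>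
          visits_down_up he (hex s hs hlt) (by simp [hs])))
    · exact .inr ⟨z, z', s, h1, h2, h3.tail hstep, h4, h5, h6, h7⟩

/-- From a branch that is not well-founded, the traversal enters a further one. -/
theorem exists_visits_down (he : e.Injective) (hacc : ¬Acc (K.Pred x) u) :
    ∃ v, K.step x v = some u ∧ ¬Acc (K.Pred x) v ∧
      K.Visits e x (K.tour e x (K.down u)) (K.down v) := by
  obtain ⟨s, hs⟩ := exists_not_acc_lt_of_not_acc hacc
  obtain ⟨v, hv, ⟨v', hv', hvv, hacc'⟩, hmin⟩ := exists_least_pred (K := K) (x := x) (e := e) (u := u)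
      (fun p => ∃ s, K.step x s = some u ∧ s.1 = p ∧ ¬Acc (K.Pred x) s)
      ⟨s, hs.2, s, hs.2, rfl, hs.1⟩
  obtain rfl := eq_of_step_of_fst_eq hv' hv hvv
  refine ⟨v', hv, hacc', visits_down_down he hv fun w h1 h2 => ?_⟩
  refine visits_down_up he ?_ (by simp [h1])
  by_contra hw
  exact absurd (hmin w h1 ⟨w, h1, rfl, hw⟩) (not_le.2 h2)

end Tour

end PartialMachine

/-! ### The reversible quantum automaton of a traversal -/

/-- A permutation of the standard basis of `ℓ²` extends to a unitary operator. -/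
theorem exists_unitary_single {ι : Type*} (π : ι → ι) (hπ : Function.Bijective π) :
    ∃ U ∈ unitary (lp (fun _ : ι => ℂ) 2 →L[ℂ] lp (fun _ : ι => ℂ) 2),
      ∀ (_ : DecidableEq ι) (i : ι), U (lp.single 2 i (1 : ℂ)) = lp.single 2 (π i) (1 : ℂ) := by
  classical
  let b : HilbertBasis ι ℂ (lp (fun _ : ι => ℂ) 2) :=
    HilbertBasis.ofRepr (LinearIsometryEquiv.refl ℂ _)
  have hb : ∀ i, b i = lp.single 2 i (1 : ℂ) := fun i => by
    rw [← b.repr_symm_single]; rfl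
  have hv : Orthonormal ℂ (b ∘ π) := b.orthonormal.comp π hπ.1
  have hspan : ⊤ ≤ (Submodule.span ℂ (Set.range (b ∘ π))).topologicalClosure := by
    rw [hπ.2.range_comp, b.dense_span]
  let b' := HilbertBasis.mk hv hspan
  -- The inverse coordinate map of the permuted basis sends the `i`-th unit vector to `b (π i)`.
  refine ⟨(Unitary.linearIsometryEquiv.symm b'.repr.symm).1,
    (Unitary.linearIsometryEquiv.symm b'.repr.symm).2, fun inst i => ?_⟩
  obtain rfl := Subsingleton.elim inst fun a b => Classical.propDecidable (a = b)
  have h1 : (Unitary.linearIsometryEquiv.symm b'.repr.symm).1 (lp.single 2 i (1 : ℂ)) =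
      b'.repr.symm (lp.single 2 i (1 : ℂ)) := rfl
  rw [h1, b'.repr_symm_single, HilbertBasis.coe_mk, Function.comp_apply, hb]

namespace PartialMachine

variable {α P : Type*}

theorem tour_bijective [Finite P] (K : PartialMachine α P) {e : P → ℤ} (he : e.Injective)
    (x : List α) : Function.Bijective (K.tour e x) := by
  refine ⟨K.tour_injective he x, fun κ => ⟨K.rev (K.tour (fun q => -e q) x (K.rev κ)), ?_⟩⟩
  have := K.tour_neg_rev (e := fun q => -e q) (fun a b h => he (neg_injective h)) x (K.rev κ)
  simpa only [neg_neg, rev_rev] using this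

theorem Visits.exists_iterate [Finite P] {K : PartialMachine α P} {e : P → ℤ} {x : List α}
    {κ κ' : CounterConfig (P × Bool) x.length} (h : K.Visits e x κ κ') :
    ∃ n, (K.tour e x)^[n] κ = κ' ∧ ∀ i < n, K.Interior x ((K.tour e x)^[i] κ) := by
  induction h with
  | refl => exact ⟨0, rfl, by simp⟩
  | tail _ h ih =>
    obtain ⟨n, rfl, hn⟩ := ih
    refine ⟨n + 1, by rw [Function.iterate_succ_apply', h.2], fun i hi => ?_⟩
    rcases Nat.lt_succ_iff_lt_or_eq.1 hi with h' | rfl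
    · exact hn i h'
    · exact h.1

open scoped Classical in
/-- The reversible automaton that traverses the configuration graph. -/
noncomputable def toQuantum [Finite P] (K : PartialMachine α P) (e : P → ℤ) (start : P)
    (acc rej : Set P) (h : Disjoint acc rej) : TwoWayQuantum1CA α (P × Bool) where
  δ w σ s w' c d :=
    if K.turn e σ s w = w' then if K.dartCounter w' = c then if K.dartHead w' = d then 1 else 0
      else 0 else 0
  start := (start, true)
  acc := Prod.fst ⁻¹' acc
  rej := Prod.fst ⁻¹' rej
  disjoint := h.preimage _

section Quantum

variable [Finite P] {K : PartialMachine α P} {e : P → ℤ} {start : P} {acc rej : Set P}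
  {h : Disjoint acc rej}

-- The entered state determines both moves, so every well-formedness condition except the first
-- vanishes term by term.
open scoped ComplexConjugate in
theorem toQuantum_conj_mul_eq_zero (w₁ w₂ : P × Bool) (σ₁ σ₂ : TapeSymbol α) (s₁ s₂ : Bool)
    (w' : P × Bool) {c₁ d₁ c₂ d₂ : SignType} (hcd : c₁ ≠ c₂ ∨ d₁ ≠ d₂) :
    conj ((K.toQuantum e start acc rej h).δ w₁ σ₁ s₁ w' c₁ d₁) *
      (K.toQuantum e start acc rej h).δ w₂ σ₂ s₂ w' c₂ d₂ = 0 := by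
  simp only [toQuantum]
  split_ifs <;> simp_all

theorem toQuantum_wellFormed [Fintype (P × Bool)] (he : e.Injective) :
    (K.toQuantum e start acc rej h).WellFormed := by
  constructor
  · intro w₁ w₂ σ s
    split_ifs with hw
    · subst hw
      rw [Finset.sum_eq_single (K.turn e σ s w₁), Finset.sum_eq_single
        (K.dartCounter (K.turn e σ s w₁)), Finset.sum_eq_single (K.dartHead (K.turn e σ s w₁))]
      · simp [toQuantum]
      · intro d _ hd
        simp [toQuantum, hd.symm]
      · simp
      · intro c _ hc
        simp [toQuantum, hc.symm]
      · simp
      · intro w _ hw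
        simp [toQuantum, hw.symm]
      · simp
    · refine Finset.sum_eq_zero fun w' _ => Finset.sum_eq_zero fun c _ =>
        Finset.sum_eq_zero fun d _ => ?_
      simp only [toQuantum]
      split_ifs with h1 _ _ h2 <;> simp
      exact hw (K.turn_injective he σ s (h1.trans h2.symm))
  all_goals
    intros
    simp [toQuantum_conj_mul_eq_zero]

theorem toQuantum_evolve [Fintype (P × Bool)] (x : List α)
    (κ : CounterConfig (P × Bool) x.length) (z : ℂ) :
    (K.toQuantum e start acc rej h).evolve x (Finsupp.single κ z) =
      Finsupp.single (K.tour e x κ) z := by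
  classical
  rw [TwoWayQuantum1CA.evolve, Finsupp.linearCombination_single]
  rw [Finset.sum_eq_single (K.turn e (tapeSymbol x κ.2.2.val) (counterSign κ.2.1) κ.1)]
  · rw [Finset.sum_eq_single (K.dartCounter
      (K.turn e (tapeSymbol x κ.2.2.val) (counterSign κ.2.1) κ.1))]
    · rw [Finset.sum_eq_single (K.dartHead
        (K.turn e (tapeSymbol x κ.2.2.val) (counterSign κ.2.1) κ.1))]
      · simp [toQuantum, tour]
      · intro d _ hd
        simp [toQuantum, hd.symm]
      · simp
    · intro c _ hc
      simp [toQuantum, hc.symm]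
    · simp
  · intro w _ hw
    simp [toQuantum, hw.symm]
  · simp

theorem toQuantum_hasUnitaryEvolution [Fintype (P × Bool)] (he : e.Injective) :
    (K.toQuantum e start acc rej h).HasUnitaryEvolution := by
  intro x
  obtain ⟨U, hU, hU'⟩ := exists_unitary_single (K.tour e x) (K.tour_bijective he x)
  refine ⟨U, hU, fun κ κ' => ?_⟩
  rw [toQuantum_evolve]
  refine (congrArg (fun f : lp (fun _ : CounterConfig (P × Bool) x.length => ℂ) 2 => f κ')
    (hU' _ κ)).trans ?_
  classical
  refine Eq.trans ?_ Finsupp.single_apply.symm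
  simp [lp.single_apply, Pi.single_apply, eq_comm]

theorem toQuantum_isReversible [Fintype (P × Bool)] (he : e.Injective) :
    (K.toQuantum e start acc rej h).IsReversible := by
  refine ⟨toQuantum_wellFormed he, toQuantum_hasUnitaryEvolution he, fun q σ s q' c d => ?_⟩
  simp only [toQuantum]
  split_ifs <;> simp

/-- `V σ s` is the permutation matrix of `K.turn e σ s`, written as composition with the inverse
permutation. -/
theorem toQuantum_isSimple (he : e.Injective) : (K.toQuantum e start acc rej h).IsSimple := by
  classical
  let π : TapeSymbol α → Bool → P × Bool ≃ P × Bool := fun σ s =>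
    Equiv.ofBijective (K.turn e σ s) (Finite.injective_iff_bijective.1 (K.turn_injective he σ s))
  refine ⟨fun σ s => LinearMap.funLeft ℂ ℂ (π σ s).symm, fun w _ => K.dartCounter w, K.dartHead,
    fun q σ s q' c d => ?_⟩
  have h1 : (π σ s).symm q' = q ↔ K.turn e σ s q = q' := by
    rw [Equiv.symm_apply_eq, eq_comm]; rfl
  simp only [toQuantum, LinearMap.funLeft_apply, Pi.single_apply, h1, ite_and]
  split_ifs <;> rfl

/-- The superposition stays a single basis vector. The initial state is not observed, hence the
condition `0 < i`. -/
theorem toQuantum_nonhalting [Fintype (P × Bool)] (x : List α) {n t : ℕ} (ht : t ≤ n)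
    (hn : ∀ i, 0 < i → i ≤ n → ((K.tour e x)^[i] ((start, true), 0, 0)).1.1 ∉ acc ∪ rej) :
    (K.toQuantum e start acc rej h).nonhalting x t =
      Finsupp.single ((K.tour e x)^[t] ((start, true), 0, 0)) 1 := by
  classical
  induction t with
  | zero => rfl
  | succ t ih =>
    rw [TwoWayQuantum1CA.nonhalting, ih (by omega), toQuantum_evolve, Function.iterate_succ_apply']
    refine Finsupp.filter_single_of_pos _ ?_
    have := hn (t + 1) (by omega) ht
    rw [Function.iterate_succ_apply'] at this
    exact this

theorem toQuantum_nonhalting_eq_zero [Fintype (P × Bool)] (x : List α) {n t : ℕ} (ht : n < t)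
    (hn : ∀ i, 0 < i → i ≤ n → ((K.tour e x)^[i] ((start, true), 0, 0)).1.1 ∉ acc ∪ rej)
    (hn' : ((K.tour e x)^[n + 1] ((start, true), 0, 0)).1.1 ∈ acc ∪ rej) :
    (K.toQuantum e start acc rej h).nonhalting x t = 0 := by
  classical
  induction t, ht using Nat.le_induction with
  | base =>
    rw [TwoWayQuantum1CA.nonhalting, toQuantum_nonhalting x le_rfl hn, toQuantum_evolve,
      ← Function.iterate_succ_apply' (K.tour e x)]
    refine Finsupp.filter_single_of_neg _ ?_
    exact not_not.2 hn'
  | succ t _ ih =>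
    rw [TwoWayQuantum1CA.nonhalting, ih, map_zero]
    exact Finsupp.filter_zero _

theorem toQuantum_tsum_haltProbAt [Fintype (P × Bool)] (x : List α) {n : ℕ} {F : Set P}
    (hF : F ⊆ acc ∪ rej)
    (hn : ∀ i, 0 < i → i ≤ n → ((K.tour e x)^[i] ((start, true), 0, 0)).1.1 ∉ acc ∪ rej)
    (hn' : ((K.tour e x)^[n + 1] ((start, true), 0, 0)).1.1 ∈ F) :
    ∑' t, (K.toQuantum e start acc rej h).haltProbAt (Prod.fst ⁻¹' F) x t = 1 := by
  classical
  rw [tsum_eq_single n]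
  · rw [TwoWayQuantum1CA.haltProbAt, toQuantum_nonhalting x le_rfl hn, toQuantum_evolve,
      ← Function.iterate_succ_apply' (K.tour e x), Finsupp.filter_single_of_pos]
    · simp
    · exact hn'
  · intro t ht
    rw [TwoWayQuantum1CA.haltProbAt]
    rcases lt_or_gt_of_ne ht with ht | ht
    · rw [toQuantum_nonhalting x ht.le hn, toQuantum_evolve, ← Function.iterate_succ_apply' (K.tour e x),
        Finsupp.filter_single_of_neg]
      · simp
      · exact fun h' => hn (t + 1) (by omega) ht (hF h')
    · rw [toQuantum_nonhalting_eq_zero x ht hn (hF hn'), map_zero, Finsupp.filter_zero]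
      simp

end Quantum

/-- If the configurations from which a halting one is reachable have well-founded sets of
predecessors, then the traversal is a reversible automaton for the same language. -/
theorem exists_reversible {P : Type} [Finite P] (K : PartialMachine α P) (start : P)
    (acc rej : Set P) (hdis : Disjoint acc rej)
    (hhalt : ∀ p ∈ acc ∪ rej, ∀ σ s, K.next σ s p = none) (L : Language α)
    (hL : ∀ x ∈ L, ∃ v, v.1 ∈ acc ∧ K.Reaches x (start, 0, 0) v)
    (hL' : ∀ x ∉ L, ∃ v, v.1 ∈ rej ∧ K.Reaches x (start, 0, 0) v)
    (hwf : ∀ x v w, K.Reaches x v w → w.1 ∈ acc ∪ rej → Acc (K.Pred x) v) :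
    ∃ (Q' : Type) (_ : Fintype Q') (M' : TwoWayQuantum1CA α Q'),
      M'.IsReversible ∧ M'.IsSimple ∧ M'.RecognizesWithProb L 1 := by
  have := Fintype.ofFinite P
  obtain ⟨e, he⟩ : ∃ e : P → ℤ, e.Injective :=
    ⟨fun p => (Fintype.equivFin P p : ℕ), fun p q h => (Fintype.equivFin P).injective
      (Fin.ext (Int.ofNat_inj.1 h))⟩
  have key : ∀ x v, v.1 ∈ acc ∪ rej → K.Reaches x (start, 0, 0) v → ∃ n,
      (∀ i, 0 < i → i ≤ n → ((K.tour e x)^[i] ((start, true), 0, 0)).1.1 ∉ acc ∪ rej) ∧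
      ((K.tour e x)^[n + 1] ((start, true), 0, 0)).1.1 = v.1 := by
    intro x v hv hreach
    have hvis : K.Visits e x (up (start, 0, 0)) (up v) := by
      -- A sibling `s` of a vertex of the path also leads to the halting configuration `v`, so `hwf`
      -- applies to it.
      refine visits_of_reaches he hreach fun w w' s hw hstep hs _ => ?_
      have h1 : K.Reaches x w v := by
        refine (Relation.ReflTransGen.total_of_right_unique ?_ hw hreach).resolve_right fun h2 => ?_
        · intro a b c h1 h2
          exact Option.some.inj (h1.symm.trans h2)
        · rcases Relation.ReflTransGen.cases_head h2 with rfl | ⟨c, h3, -⟩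
          · simp [step, hhalt _ hv] at hstep
          · simp [step, hhalt _ hv] at h3
      rcases Relation.ReflTransGen.cases_head h1 with rfl | ⟨c, h2, h3⟩
      · simp [step, hhalt _ hv] at hstep
      · obtain rfl := Option.some.inj (h2.symm.trans hstep)
        exact hwf x s v (.head hs h3) hv
    obtain ⟨n, hn, hn'⟩ := hvis.exists_iterate
    have hint : ∀ κ, K.Interior x κ → κ.1.1 ∉ acc ∪ rej := by
      rintro κ ⟨u, hu, h1⟩ h2
      have h3 : u.1 ∈ acc ∪ rej := by rcases h1 with rfl | rfl <;> exact h2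
      simp [step, hhalt _ h3] at hu
    -- If the start state is itself halting, then the first step turns `up v` into `K.down v`, which
    -- has the same halting state and is the first to be observed.
    rcases n with _ | n
    · refine ⟨0, fun i h1 h2 => by omega, ?_⟩
      rw [Function.iterate_zero_apply] at hn
      have h1 : ((start, true), 0, 0) = (up v : CounterConfig (P × Bool) x.length) := hn
      rw [h1, zero_add, Function.iterate_one, tour_up_root (by simp [step, hhalt _ hv])]
      rfl
    · refine ⟨n, fun i _ h2 => hint _ (hn' i (by omega)), ?_⟩
      exact congrArg (fun κ => κ.1.1) hn
  refine ⟨P × Bool, inferInstance, K.toQuantum e start acc rej hdis, toQuantum_isReversible he,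
    toQuantum_isSimple he, by norm_num, fun x hx => ?_, fun x hx => ?_⟩
  · obtain ⟨v, hv, hr⟩ := hL x hx
    obtain ⟨n, hn, hn'⟩ := key x v (.inl hv) hr
    exact (toQuantum_tsum_haltProbAt x Set.subset_union_left hn (hn' ▸ hv)).ge
  · obtain ⟨v, hv, hr⟩ := hL' x hx
    obtain ⟨n, hn, hn'⟩ := key x v (.inr hv) hr
    exact (toQuantum_tsum_haltProbAt x Set.subset_union_right hn (hn' ▸ hv)).ge

end PartialMachine

/-! ### Infinite backward chains and periodic nodes -/

/-- A point at the end of an infinite chain of preimages in a finite set is periodic. -/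
theorem some_mem_periodicPts_of_chain {N : Type*} [Finite N] (f : Option N → Option N) (y : ℕ → N)
    (h : ∀ i, f (some (y (i + 1))) = some (y i)) : some (y 0) ∈ Function.periodicPts f := by
  have hiter : ∀ k i, f^[k] (some (y (i + k))) = some (y i) := by
    intro k
    induction k with
    | zero => simp
    | succ k ih =>
      intro i
      rw [Function.iterate_succ_apply, ← add_assoc, h, ih]
  -- By pigeonhole some element of the chain lies on a cycle, and `f` maps cycles to themselves.
  obtain ⟨i, j, hij, hy⟩ := Finite.exists_ne_map_eq_of_infinite y
  wlog hlt : i < j generalizing i j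
  · exact this j i hij.symm hy.symm (by omega)
  have h1 : some (y i) ∈ Function.periodicPts f := by
    refine ⟨j - i, by omega, ?_⟩
    have := hiter (j - i) i
    rw [show i + (j - i) = j by omega, ← hy] at this
    exact this
  have h2 := (Function.bijOn_periodicPts f).mapsTo.iterate i h1
  have h3 := hiter i 0
  rw [zero_add] at h3
  rwa [h3] at h2

/-- The iteration of a partial function. -/
theorem iterate_bind_none {V : Type*} (f : V → Option V) (k : ℕ) :
    (fun o : Option V => o.bind f)^[k] none = none := by
  induction k with
  | zero => rfl
  | succ k ih => rwa [Function.iterate_succ_apply]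

theorem reflTransGen_iff_exists_iterate {V : Type*} (f : V → Option V) {u v : V} :
    Relation.ReflTransGen (fun u v => f u = some v) u v ↔
      ∃ k, (fun o : Option V => o.bind f)^[k] (some u) = some v := by
  constructor
  · intro h
    induction h with
    | refl => exact ⟨0, rfl⟩
    | tail _ h ih =>
      obtain ⟨k, hk⟩ := ih
      exact ⟨k + 1, by rw [Function.iterate_succ_apply', hk]; exact h⟩
  · rintro ⟨k, hk⟩
    induction k generalizing u with
    | zero => obtain rfl := Option.some.inj hk; exact .refl
    | succ k ih =>
      rw [Function.iterate_succ_apply] at hk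
      rcases h : f u with _ | w
      · simp [h, iterate_bind_none] at hk
      · exact .head h (ih (by simpa [h] using hk))

/-- Once undefined, the iteration remains undefined and cannot return to `u`. -/
theorem some_notMem_periodicPts {V : Type*} (f : V → Option V) {u : V} {k : ℕ}
    (hk : (fun o : Option V => o.bind f)^[k] (some u) = none) :
    some u ∉ Function.periodicPts fun o : Option V => o.bind f := by
  rintro ⟨m, hm, hp⟩
  have h1 := hp.mul_const k
  have h2 : k ≤ m * k := Nat.le_mul_of_pos_left k hm
  rw [Function.IsPeriodicPt, Function.IsFixedPt, ← Nat.sub_add_cancel h2,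
    Function.iterate_add_apply, hk, iterate_bind_none] at h1
  exact absurd h1 (by simp)

theorem reaches_total {V : Type*} {f : V → Option V} {u v w : V}
    (h : Relation.ReflTransGen (fun u v => f u = some v) u v)
    (h' : Relation.ReflTransGen (fun u v => f u = some v) u w) :
    Relation.ReflTransGen (fun u v => f u = some v) v w ∨
      Relation.ReflTransGen (fun u v => f u = some v) w v :=
  Relation.ReflTransGen.total_of_right_unique
    (fun _ _ _ h1 h2 => Option.some.inj (h1.symm.trans h2)) h h'

theorem eq_of_reaches_of_none {V : Type*} {f : V → Option V} {u v : V}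
    (h : Relation.ReflTransGen (fun u v => f u = some v) u v) (hu : f u = none) : u = v := by
  rcases Relation.ReflTransGen.cases_head h with rfl | ⟨w, h1, -⟩
  · rfl
  · simp [hu] at h1

theorem reaches_of_none {V : Type*} {f : V → Option V} {u v w : V}
    (h : Relation.ReflTransGen (fun u v => f u = some v) u v)
    (h' : Relation.ReflTransGen (fun u v => f u = some v) u w) (hw : f w = none) :
    Relation.ReflTransGen (fun u v => f u = some v) v w := by
  rcases reaches_total h h' with h1 | h1
  · exact h1
  · rw [eq_of_reaches_of_none h1 hw]

/-- An infinite chain of predecessors of a configuration from which the computation ends has no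
repetitions. -/
theorem injective_of_chain {V : Type*} {f : V → Option V} {κ : ℕ → V} {w : V}
    (hκ : ∀ i, f (κ (i + 1)) = some (κ i))
    (h : Relation.ReflTransGen (fun u v => f u = some v) (κ 0) w) (hw : f w = none) :
    Function.Injective κ := by
  obtain ⟨m, hm⟩ := (reflTransGen_iff_exists_iterate f).1 h
  -- The element `κ i` is `m + i` steps away from `w`, where the computation ends, so equal elements
  -- would have equal indices.
  have hiter : ∀ i, (fun o : Option V => o.bind f)^[m + i] (some (κ i)) = some w := by
    intro i
    induction i with
    | zero => exact hm
    | succ i ih =>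
      rw [← add_assoc, Function.iterate_succ_apply]
      simpa [hκ] using ih
  have hne : ∀ i j, i < j → κ i ≠ κ j := by
    intro i j hij heq
    have h1 := hiter j
    rw [← heq, show m + j = (j - i - 1) + (1 + (m + i)) by omega, Function.iterate_add_apply,
      Function.iterate_add_apply _ 1, hiter i, Function.iterate_one] at h1
    simp [hw, iterate_bind_none] at h1
  intro i j hij
  rcases lt_trichotomy i j with h | h | h
  · exact absurd hij (hne i j h)
  · exact h
  · exact absurd hij.symm (hne j i h)

namespace PartialMachine

variable {α P : Type*}

/-- The action of a partial machine with nonzero counter on states and head positions. -/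
def nodeMap (K : PartialMachine α P) (x : List α) (y : P × ZMod (x.length + 2)) :
    Option (P × ZMod (x.length + 2)) :=
  (K.next (tapeSymbol x y.2.val) true y.1).map fun p => (p, y.2 + ((K.head p : ℤ) : ZMod _))

theorem nodeMap_of_step {K : PartialMachine α P} {x : List α} {u v : CounterConfig P x.length}
    (h : K.step x u = some v) (hu : u.2.1 ≠ 0) : K.nodeMap x (u.1, u.2.2) = some (v.1, v.2.2) := by
  simp only [step, counterSign, hu, ne_eq, not_false_eq_true, decide_true,
    Option.map_eq_some_iff] at h
  obtain ⟨p, h1, rfl⟩ := h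
  simp [nodeMap, h1, moveTo]

/-- If no halting configuration is reachable from a nonzero configuration over a periodic node, then
the configurations from which a halting one is reachable have well-founded sets of predecessors. -/
theorem acc_pred_of_periodic [Finite P] (K : PartialMachine α P) (x : List α) (halt : Set P)
    (hhalt : ∀ p ∈ halt, ∀ σ s, K.next σ s p = none)
    (hper : ∀ v w : CounterConfig P x.length, v.2.1 ≠ 0 →
      some (v.1, v.2.2) ∈ Function.periodicPts (fun o => o.bind (K.nodeMap x)) →
      K.Reaches x v w → w.1 ∉ halt)
    {v w : CounterConfig P x.length} (h : K.Reaches x v w) (hw : w.1 ∈ halt) :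
    Acc (K.Pred x) v := by
  by_contra hacc
  obtain ⟨κ, h0, hκ⟩ := not_acc_iff_exists_descending_chain.1 hacc
  have hκ' : ∀ i, K.step x (κ (i + 1)) = some (κ i) := hκ
  have hr : ∀ i, K.Reaches x (κ i) w := by
    intro i
    induction i with
    | zero => rwa [h0]
    | succ i ih => exact .head (hκ' i) ih
  have hwn : K.step x w = none := by simp [step, hhalt _ hw]
  have hinj : Function.Injective κ := injective_of_chain hκ' (hr 0) hwn
  -- Only finitely many configurations have counter value `0`, so a tail of the chain avoids them
  -- and projects to a backward chain of `nodeMap`.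
  have hfin : {i | (κ i).2.1 = 0}.Finite := by
    have : {v : CounterConfig P x.length | v.2.1 = 0}.Finite := by
      refine (Set.finite_range fun y : P × ZMod (x.length + 2) =>
        ((y.1, 0, y.2) : CounterConfig P x.length)).subset ?_
      rintro ⟨p, a, b⟩ rfl
      exact ⟨(p, b), rfl⟩
    exact this.preimage hinj.injOn
  obtain ⟨N, hN⟩ := hfin.bddAbove
  have hnz : ∀ i, (κ (N + 1 + i)).2.1 ≠ 0 := fun i hi => by
    have : N + 1 + i ≤ N := hN hi
    omega
  refine hper (κ (N + 1)) w (hnz 0) ?_ (hr _) hw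
  exact some_mem_periodicPts_of_chain _ (fun i => ((κ (N + 1 + i)).1, (κ (N + 1 + i)).2.2))
    fun i => nodeMap_of_step (hκ' _) (hnz _)

end PartialMachine

/-! ### Symbols and positions on the circular tape -/

section Tape

variable {α : Type*} (x : List α)

theorem tapeSymbol_eq_leftEnd {x : List α} {i : ℕ} :
    tapeSymbol x i = TapeSymbol.leftEnd ↔ i = 0 := by
  rcases i with _ | i
  · simp [tapeSymbol]
  · rcases h : x[i]? <;> simp [tapeSymbol, h]

theorem tapeSymbol_eq_rightEnd {x : List α} {i : ℕ} :
    tapeSymbol x i = TapeSymbol.rightEnd ↔ x.length + 1 ≤ i := by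
  rcases i with _ | i
  · simp [tapeSymbol]
  · rcases h : x[i]? with _ | a
    · simp at h
      simp [tapeSymbol, h]
    · have := (List.getElem?_eq_some_iff.1 h).1
      simp [tapeSymbol, this]

theorem val_natCast_position {n i : ℕ} (h : i ≤ n + 1) : ((i : ℕ) : ZMod (n + 2)).val = i :=
  ZMod.val_natCast_of_lt (by omega)

theorem exists_natCast_position {n : ℕ} (b : ZMod (n + 2)) : ∃ i ≤ n + 1, b = (i : ZMod (n + 2)) :=
  ⟨b.val, by have := b.val_lt; omega, by simp⟩

theorem natCast_position_last_add_one (n : ℕ) : ((n + 1 : ℕ) : ZMod (n + 2)) + 1 = 0 := by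
  have := ZMod.natCast_self (n + 2)
  push_cast at this ⊢
  rw [← this]; ring

theorem zero_sub_one_position (n : ℕ) : (0 : ZMod (n + 2)) - 1 = ((n + 1 : ℕ) : ZMod (n + 2)) := by
  rw [sub_eq_iff_eq_add, natCast_position_last_add_one]

end Tape

/-! ### Maintaining the state of a finite automaton on the squares left of the head -/

/-- A partial one-counter automaton whose transitions may depend on the state of a finite automaton
that has read the squares to the left of the head. -/
structure LookbehindMachine (α Q S : Type*) where
  update : S → TapeSymbol α → S
  init : S
  next : S → TapeSymbol α → Bool → Q → Option Q
  counter : Q → SignType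
  head : Q → SignType

/-- The states of a machine that maintains the state of the finite automaton. In `settled`, that
state is known; `wrap` recomputes it on the way to the right end of the tape; `back`, `scan` and
`resume` recompute it after a move to the left; `count` and `verify` check it. -/
inductive LookbehindState (Q S : Type*) where
  | settled (q : Q) (s : S)
  | wrap (q : Q) (s : S)
  | back (q : Q) (s : S)
  | scan (q : Q) (φ : S → Option S)
  | resume (q : Q) (r s₁ s₂ : S)
  | count (q : Q) (s : S)
  | verify (q : Q) (s u : S)

namespace LookbehindState

variable {Q S : Type*}

instance [Finite Q] [Finite S] : Finite (LookbehindState Q S) := by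
  let f : LookbehindState Q S → Fin 7 × Q × Option S × Option S × Option S × Option (S → Option S)
    | settled q s => (0, q, some s, none, none, none)
    | wrap q s => (1, q, some s, none, none, none)
    | back q s => (2, q, some s, none, none, none)
    | scan q φ => (3, q, none, none, none, some φ)
    | resume q r s₁ s₂ => (4, q, some r, some s₁, some s₂, none)
    | count q s => (5, q, some s, none, none, none)
    | verify q s u => (6, q, some s, some u, none, none)
  refine Finite.of_injective f fun a b h => ?_
  cases a <;> cases b <;> simp_all [f]

end LookbehindState

namespace LookbehindMachine

open LookbehindState

variable {α Q S : Type*} (M : LookbehindMachine α Q S)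

/-- The state of the finite automaton after reading the first `i` squares. -/
def pre (x : List α) : ℕ → S
  | 0 => M.init
  | i + 1 => M.update (pre x i) (tapeSymbol x i)

/-- One step of the machine. -/
def step (x : List α) (v : CounterConfig Q x.length) : Option (CounterConfig Q x.length) :=
  (M.next (M.pre x v.2.2.val) (tapeSymbol x v.2.2.val) (counterSign v.2.1) v.1).map fun p =>
    moveTo p v.2.1 v.2.2 (M.counter p) (M.head p)

/-- The action of the machine with nonzero counter on states and head positions. -/
def nodeMap (x : List α) (y : Q × ZMod (x.length + 2)) : Option (Q × ZMod (x.length + 2)) :=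
  (M.next (M.pre x y.2.val) (tapeSymbol x y.2.val) true y.1).map fun p =>
    (p, y.2 + ((M.head p : ℤ) : ZMod _))

/-- The configuration `v` is reachable from `u`. -/
def Reaches (x : List α) : CounterConfig Q x.length → CounterConfig Q x.length → Prop :=
  Relation.ReflTransGen fun u v => M.step x u = some v

/-- Two values of a partial function differ. -/
def Ambiguous (φ : S → Option S) : Prop :=
  ∃ p₁ p₂ r₁ r₂, φ p₁ = some r₁ ∧ φ p₂ = some r₂ ∧ r₁ ≠ r₂

open scoped Classical in
/-- The preimages of `s` under reading `σ`. -/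
noncomputable def candidates (s : S) (σ : TapeSymbol α) : S → Option S :=
  fun p => if M.update p σ = s then some p else none

open scoped Classical in
/-- Perform a transition in a settled state. -/
noncomputable def act (q : Q) (s : S) (σ : TapeSymbol α) (sg : Bool) :
    Option (LookbehindState Q S × SignType × SignType) :=
  (M.next s σ sg q).map fun p =>
    if M.head p = 0 then (settled p s, M.counter p, 0)
    else if M.head p = 1 then
      -- A move to the right from `$` arrives at `¢`, before which nothing has been read.
      (settled p (if σ = .rightEnd then M.init else M.update s σ), M.counter p, 1)
    -- A move to the left from `¢` arrives at `$`. The machine goes there by crossing the tape to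
    -- the right, reading it on the way.
    else if σ = .leftEnd then (wrap p (M.update s σ), M.counter p, 1)
    else (back p s, M.counter p, -1)

open scoped Classical in
/-- Turn to the right with two states that lead to different values of `φ`. -/
noncomputable def turnBack (q : Q) (φ : S → Option S) (s₁ : S) :
    Option (LookbehindState Q S × SignType × SignType) :=
  if h : ∃ y : S × S × S, φ s₁ = some y.1 ∧ φ y.2.1 = some y.2.2 ∧ y.1 ≠ y.2.2 then
    some (resume q h.choose.1 s₁ h.choose.2.1, 0, 1)
  else none

open scoped Classical in
/-- The transitions of the machine that maintains the state of the finite automaton. -/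
noncomputable def compileNext (halt : Set Q) (σ : TapeSymbol α) (sg : Bool) :
    LookbehindState Q S → Option (LookbehindState Q S × SignType × SignType)
  | settled q s =>
    if q ∈ halt then none else if sg = true then M.act q s σ true else some (count q s, 0, 0)
  | wrap q s =>
    if σ = .rightEnd then some (settled q s, 0, 0) else some (wrap q (M.update s σ), 0, 1)
  | back q s =>
    if σ = .leftEnd then some (settled q M.init, 0, 0)
    else if Ambiguous (M.candidates s σ) then some (scan q (M.candidates s σ), 0, -1)
    else if h : ∃ r p, M.candidates s σ p = some r then some (settled q h.choose, 0, 0) else none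
  -- If `p` is the state after the present square, then `φ p` is the state before the target square,
  -- or `none` if `p` contradicts the state known after the target square.
  | scan q φ =>
    if σ = .leftEnd then turnBack q φ (M.update M.init σ)
    else if Ambiguous fun p => φ (M.update p σ) then some (scan q fun p => φ (M.update p σ), 0, -1)
    else if h : ∃ p r, φ (M.update p σ) = some r then turnBack q φ (M.update h.choose σ)
    else none
  | resume q r s₁ s₂ =>
    if M.update s₁ σ = M.update s₂ σ then some (settled q r, 0, 0)
    else if σ = .rightEnd then none
    else some (resume q r (M.update s₁ σ) (M.update s₂ σ), 0, 1)
  -- In a simulation the counter is `0` at the start of `count`, which stores in it the distance to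
  -- `¢`; `verify` uses this to find the way back.
  | count q s => if σ = .leftEnd then some (verify q s M.init, 0, 0) else some (count q s, 1, -1)
  | verify q s u =>
    if sg = true then
      -- This stop does not occur in a simulation, but it ends `verify` when every test reports a
      -- nonzero counter.
      if σ = .rightEnd then none else some (verify q s (M.update u σ), -1, 1)
    else if u = s then M.act q s σ false else none

/-- The machine that maintains the state of the finite automaton. -/
noncomputable def compile (halt : Set Q) :
    PartialMachine α (LookbehindState Q S × SignType × SignType) where
  next σ sg z := M.compileNext halt σ sg z.1
  counter z := z.2.1
  head z := z.2.2

/-- One step of the compiled machine, with a given test of the counter. -/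
noncomputable def stepWith (halt : Set Q) (x : List α) (sg : ℤ → Bool)
    (u : CounterConfig (LookbehindState Q S) x.length) :
    Option (CounterConfig (LookbehindState Q S) x.length) :=
  (M.compileNext halt (tapeSymbol x u.2.2.val) (sg u.2.1) u.1).map fun r =>
    moveTo r.1 u.2.1 u.2.2 r.2.1 r.2.2

/-- Reachability for the compiled machine, with a given test of the counter. -/
def ReachesWith (halt : Set Q) (x : List α) (sg : ℤ → Bool) :
    CounterConfig (LookbehindState Q S) x.length →
      CounterConfig (LookbehindState Q S) x.length → Prop :=
  Relation.ReflTransGen fun u v => M.stepWith halt x sg u = some v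

/-- The state of the finite automaton after reading `m` squares from square `i` on. -/
def runFrom (x : List α) (s : S) (i : ℕ) : ℕ → S
  | 0 => s
  | m + 1 => runFrom x (M.update s (tapeSymbol x i)) (i + 1) m

theorem runFrom_pre (x : List α) (i m : ℕ) : M.runFrom x (M.pre x i) i m = M.pre x (i + m) := by
  induction m generalizing i with
  | zero => rfl
  | succ m ih =>
    rw [runFrom, show M.update (M.pre x i) (tapeSymbol x i) = M.pre x (i + 1) from rfl, ih]
    congr 1; omega

variable {M} {halt : Set Q} {x : List α} {sg : ℤ → Bool}

theorem reachesWith_of_step {z z' : LookbehindState Q S} {a : ℤ} {i : ℕ} (hi : i ≤ x.length + 1)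
    {c d : SignType} (h : M.compileNext halt (tapeSymbol x i) (sg a) z = some (z', c, d)) :
    M.ReachesWith halt x sg (z, a, (i : ZMod _))
      (z', a + (c : ℤ), ((i : ℕ) : ZMod _) + ((d : ℤ) : ZMod _)) := by
  refine .single ?_
  simp [stepWith, val_natCast_position hi, h, moveTo]

theorem reachesWith_stay {z z' : LookbehindState Q S} {a : ℤ} {i : ℕ} (hi : i ≤ x.length + 1)
    (h : M.compileNext halt (tapeSymbol x i) (sg a) z = some (z', 0, 0)) :
    M.ReachesWith halt x sg (z, a, (i : ZMod _)) (z', a, (i : ZMod _)) := by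
  simpa using reachesWith_of_step hi h

theorem reachesWith_right {z z' : LookbehindState Q S} {a : ℤ} {i : ℕ} (hi : i ≤ x.length + 1)
    (h : M.compileNext halt (tapeSymbol x i) (sg a) z = some (z', 0, 1)) :
    M.ReachesWith halt x sg (z, a, (i : ZMod _)) (z', a, ((i + 1 : ℕ) : ZMod _)) := by
  simpa using reachesWith_of_step hi h

theorem reachesWith_left {z z' : LookbehindState Q S} {a : ℤ} {i : ℕ} (hi : i + 1 ≤ x.length + 1)
    (h : M.compileNext halt (tapeSymbol x (i + 1)) (sg a) z = some (z', 0, -1)) :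
    M.ReachesWith halt x sg (z, a, ((i + 1 : ℕ) : ZMod _)) (z', a, (i : ZMod _)) := by
  simpa using reachesWith_of_step hi h

theorem reachesWith_wrap (q : Q) (a : ℤ) (m : ℕ) : ∀ i, i + m = x.length + 1 →
    M.ReachesWith halt x sg (wrap q (M.pre x i), a, (i : ZMod _))
      (settled q (M.pre x (x.length + 1)), a, ((x.length + 1 : ℕ) : ZMod _)) := by
  induction m with
  | zero =>
    rintro i hi
    obtain rfl : i = x.length + 1 := by omega
    exact reachesWith_stay le_rfl (by simp [compileNext, tapeSymbol_eq_rightEnd])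
  | succ m ih =>
    intro i hi
    have h1 : ¬tapeSymbol x i = .rightEnd := by rw [tapeSymbol_eq_rightEnd]; omega
    exact (reachesWith_right (by omega) (by simp [compileNext, h1]; rfl)).trans
      (ih (i + 1) (by omega))

theorem candidates_eq_some {s p r : S} {σ : TapeSymbol α} :
    M.candidates s σ p = some r ↔ M.update p σ = s ∧ p = r := by
  simp [candidates]

theorem candidates_pre (j : ℕ) :
    M.candidates (M.pre x (j + 1)) (tapeSymbol x j) (M.pre x j) = some (M.pre x j) :=
  candidates_eq_some.2 ⟨rfl, rfl⟩

/-- The two states lead to different values before square `j`, so they cannot merge earlier; both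
agree with the state `s` after it, so they merge on reading it. The merger thus marks square `j`. -/
theorem reachesWith_resume (q : Q) (a : ℤ) {j : ℕ} (hj : j ≤ x.length + 1) (s r r₂ : S)
    (hr : r ≠ r₂) (m : ℕ) : ∀ i s₁ s₂, i + m = j →
      M.candidates s (tapeSymbol x j) (M.runFrom x s₁ i m) = some r →
      M.candidates s (tapeSymbol x j) (M.runFrom x s₂ i m) = some r₂ →
    M.ReachesWith halt x sg (resume q r s₁ s₂, a, (i : ZMod _))
      (settled q r, a, (j : ZMod _)) := by
  induction m with
  | zero =>
    rintro i s₁ s₂ rfl h1 h2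
    rw [candidates_eq_some] at h1 h2
    have h3 : M.update s₁ (tapeSymbol x i) = M.update s₂ (tapeSymbol x i) := h1.1.trans h2.1.symm
    exact reachesWith_stay hj (by simp [compileNext, h3])
  | succ m ih =>
    intro i s₁ s₂ hi h1 h2
    have h3 : ¬tapeSymbol x i = .rightEnd := by rw [tapeSymbol_eq_rightEnd]; omega
    have h4 : M.update s₁ (tapeSymbol x i) ≠ M.update s₂ (tapeSymbol x i) := by
      intro h4
      rw [runFrom, h4] at h1
      exact hr (Option.some.inj (h1.symm.trans h2))
    exact (reachesWith_right (by omega) (by simp [compileNext, h3, h4])).trans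
      (ih (i + 1) _ _ (by omega) h1 h2)

/-- Ambiguity of `φ` supplies a partner for `s₁` with a different value, as needed to recognise
square `j` on the way back. -/
theorem reachesWith_turnBack (q : Q) (a : ℤ) {i j m : ℕ} (hj : j ≤ x.length + 1)
    (hi : i + 1 + m = j) {φ : S → Option S}
    (hφ : φ = fun p => M.candidates (M.pre x (j + 1)) (tapeSymbol x j) (M.runFrom x p (i + 1) m))
    (hamb : Ambiguous φ) {s₁ : S} (hs : φ s₁ = some (M.pre x j)) {z : LookbehindState Q S}
    (h : M.compileNext halt (tapeSymbol x i) (sg a) z = turnBack q φ s₁) :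
    M.ReachesWith halt x sg (z, a, (i : ZMod _)) (settled q (M.pre x j), a, (j : ZMod _)) := by
  have hex : ∃ y : S × S × S, φ s₁ = some y.1 ∧ φ y.2.1 = some y.2.2 ∧ y.1 ≠ y.2.2 := by
    obtain ⟨p₁, p₂, r₁, r₂, h1, h2, h3⟩ := hamb
    by_cases hr : r₁ = M.pre x j
    · exact ⟨(_, p₂, r₂), hs, h2, hr ▸ h3⟩
    · exact ⟨(_, p₁, r₁), hs, h1, Ne.symm hr⟩
  obtain ⟨h1, h2, h3⟩ := hex.choose_spec
  rw [turnBack, dif_pos hex] at h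
  refine (reachesWith_right (by omega) h).trans ?_
  have h4 : hex.choose.1 = M.pre x j := Option.some.inj (h1.symm.trans hs)
  rw [h4] at h3 ⊢
  have h2 := (congrFun hφ _).symm.trans h2
  have hs := (congrFun hφ _).symm.trans hs
  exact reachesWith_resume q a hj _ _ _ h3 m _ _ _ hi hs h2

/-- The scan moves left as long as several values before square `j` are possible. The actual state
always yields the correct value, so a value that is the only one left is correct; at `¢` it is
computed from `M.init`. In both cases the last `φ` is still ambiguous and provides the pair for the
way back. -/
theorem reachesWith_scan (q : Q) (a : ℤ) {j : ℕ} (hj : j ≤ x.length + 1) (i : ℕ) :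
    ∀ (m : ℕ) (φ : S → Option S), i + 1 + m = j →
      (φ = fun p => M.candidates (M.pre x (j + 1)) (tapeSymbol x j) (M.runFrom x p (i + 1) m)) →
      Ambiguous φ → M.ReachesWith halt x sg (scan q φ, a, (i : ZMod _))
        (settled q (M.pre x j), a, (j : ZMod _)) := by
  induction i with
  | zero =>
    intro m φ hi hφ hamb
    refine reachesWith_turnBack q a hj hi hφ hamb (s₁ := M.update M.init (tapeSymbol x 0)) ?_ ?_
    · have := M.runFrom_pre x 1 m
      rw [hφ]
      simp only [zero_add] at hi ⊢
      rw [show M.update M.init (tapeSymbol x 0) = M.pre x 1 from rfl, this, hi]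
      exact candidates_pre j
    · simp [compileNext, tapeSymbol_eq_leftEnd]
  | succ i ih =>
    intro m φ hi hφ hamb
    have h1 : ¬tapeSymbol x (i + 1) = .leftEnd := by rw [tapeSymbol_eq_leftEnd]; omega
    have h2 : (fun p => φ (M.update p (tapeSymbol x (i + 1)))) = fun p =>
        M.candidates (M.pre x (j + 1)) (tapeSymbol x j) (M.runFrom x p (i + 1) (m + 1)) := by
      rw [hφ]; rfl
    have h3 : φ (M.update (M.pre x (i + 1)) (tapeSymbol x (i + 1))) = some (M.pre x j) := by
      simp only [hφ]
      rw [show M.update (M.pre x (i + 1)) (tapeSymbol x (i + 1)) = M.pre x (i + 1 + 1) from rfl,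
        M.runFrom_pre, hi]
      exact candidates_pre j
    by_cases hamb' : Ambiguous fun p => φ (M.update p (tapeSymbol x (i + 1)))
    · refine (reachesWith_left (by omega) (z' := scan q fun p =>
        φ (M.update p (tapeSymbol x (i + 1)))) ?_).trans (ih (m + 1) _ (by omega) h2 hamb')
      simp [compileNext, h1, hamb']
    · have hex : ∃ p r, φ (M.update p (tapeSymbol x (i + 1))) = some r := ⟨_, _, h3⟩
      refine reachesWith_turnBack q a hj hi hφ hamb
        (s₁ := M.update hex.choose (tapeSymbol x (i + 1))) ?_ ?_
      · obtain ⟨r, hr⟩ := hex.choose_spec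
        rw [hr]
        by_contra hne
        exact hamb' ⟨_, _, _, _, hr, h3, fun h => hne (by rw [h])⟩
      · rw [compileNext, if_neg h1, if_neg hamb', dif_pos hex]

theorem reachesWith_back (q : Q) (a : ℤ) {j : ℕ} (hj : j ≤ x.length + 1) :
    M.ReachesWith halt x sg (back q (M.pre x (j + 1)), a, (j : ZMod _))
      (settled q (M.pre x j), a, (j : ZMod _)) := by
  by_cases h0 : j = 0
  · subst h0
    exact reachesWith_stay hj (by simp [compileNext, tapeSymbol_eq_leftEnd, pre])
  have h1 : ¬tapeSymbol x j = .leftEnd := by rwa [tapeSymbol_eq_leftEnd]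
  by_cases hamb : Ambiguous (M.candidates (M.pre x (j + 1)) (tapeSymbol x j))
  · obtain ⟨i, rfl⟩ := Nat.exists_eq_succ_of_ne_zero h0
    exact (reachesWith_left hj (z' := scan q (M.candidates (M.pre x (i + 1 + 1)) (tapeSymbol x (i + 1))))
      (by simp [compileNext, h1, hamb])).trans
      (reachesWith_scan q a hj i 0 _ rfl rfl hamb)
  · have hex : ∃ r p, M.candidates (M.pre x (j + 1)) (tapeSymbol x j) p = some r :=
      ⟨_, _, candidates_pre j⟩
    have h2 : hex.choose = M.pre x j := by
      obtain ⟨p, hp⟩ := hex.choose_spec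
      by_contra hne
      exact hamb ⟨_, _, _, _, hp, candidates_pre j, hne⟩
    refine reachesWith_stay hj ?_
    rw [compileNext, if_neg h1, if_neg hamb, dif_pos hex, h2]

/-- After a transition, the state of the finite automaton becomes known again. -/
theorem exists_reachesWith_of_next {q p : Q} {s : Bool} {i : ℕ} (hi : i ≤ x.length + 1)
    (h : M.next (M.pre x i) (tapeSymbol x i) s q = some p) :
    ∃ r, M.act q (M.pre x i) (tapeSymbol x i) s = some r ∧ ∀ a : ℤ,
      M.ReachesWith halt x sg (moveTo r.1 a (i : ZMod (x.length + 2)) r.2.1 r.2.2)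
        (settled p (M.pre x (((i : ZMod (x.length + 2)) + ((M.head p : ℤ) : ZMod _)).val)),
          a + (M.counter p : ℤ), (i : ZMod _) + ((M.head p : ℤ) : ZMod _)) := by
  have hcases : ∀ d : SignType, d = 0 ∨ d = 1 ∨ d = -1 := by decide
  rcases hcases (M.head p) with hd | hd | hd
  · refine ⟨(settled p (M.pre x i), M.counter p, 0), by simp [act, h, hd], fun a => ?_⟩
    simp only [hd, SignType.coe_zero, Int.cast_zero, add_zero, val_natCast_position hi, moveTo]
    exact .refl
  · by_cases h1 : i = x.length + 1
    · refine ⟨(settled p M.init, M.counter p, 1), ?_, fun a => ?_⟩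
      · have h2 : tapeSymbol x i = .rightEnd := by rw [tapeSymbol_eq_rightEnd]; omega
        rw [h2] at h
        simp [act, h, hd, h2]
      · have h2 : ((i : ℕ) : ZMod (x.length + 2)) + (((1 : SignType) : ℤ) : ZMod _) = 0 := by
          rw [h1, ← natCast_position_last_add_one]; simp
        simp only [moveTo, hd]
        rw [h2, ZMod.val_zero]
        exact .refl
    · refine ⟨(settled p (M.pre x (i + 1)), M.counter p, 1), ?_, fun a => ?_⟩
      · have h2 : ¬tapeSymbol x i = .rightEnd := by rw [tapeSymbol_eq_rightEnd]; omega
        simp [act, h, hd, h2, pre]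
      · have h2 : ((i : ℕ) : ZMod (x.length + 2)) + (((1 : SignType) : ℤ) : ZMod _) =
            ((i + 1 : ℕ) : ZMod (x.length + 2)) := by
          simp
        simp only [moveTo, hd]
        rw [h2, val_natCast_position (by omega)]
        exact .refl
  · by_cases h0 : i = 0
    · subst h0
      refine ⟨(wrap p (M.pre x 1), M.counter p, 1), ?_, fun a => ?_⟩
      · have h2 : tapeSymbol x 0 = .leftEnd := rfl
        simp only [pre, h2] at h
        simp [act, h, hd, pre, h2]
      · have h1 : ((0 : ℕ) : ZMod (x.length + 2)) + (((-1 : SignType) : ℤ) : ZMod _) =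
            ((x.length + 1 : ℕ) : ZMod (x.length + 2)) := by
          rw [← zero_sub_one_position]; simp [sub_eq_add_neg]
        rw [hd, h1, val_natCast_position le_rfl]
        have := reachesWith_wrap (M := M) (halt := halt) (sg := sg) (x := x) p
          (a + (M.counter p : ℤ)) x.length 1 (by omega)
        simpa [moveTo] using this
    · obtain ⟨j, rfl⟩ := Nat.exists_eq_succ_of_ne_zero h0
      have h1 : ¬tapeSymbol x (j + 1) = .leftEnd := by rwa [tapeSymbol_eq_leftEnd]
      refine ⟨(back p (M.pre x (j + 1)), M.counter p, -1), ?_, fun a => ?_⟩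
      · simp [act, h, hd, h1]
      · have h1 : ((j + 1 : ℕ) : ZMod (x.length + 2)) + (((-1 : SignType) : ℤ) : ZMod _) =
            ((j : ℕ) : ZMod (x.length + 2)) := by
          simp
        simp only [Nat.succ_eq_add_one, moveTo, hd]
        rw [h1, val_natCast_position (by omega)]
        exact reachesWith_back p (a + (M.counter p : ℤ)) (j := j) (by omega)

theorem reachesWith_count (q : Q) (s : S) (i : ℕ) (hi : i ≤ x.length + 1) (a : ℤ) :
    M.ReachesWith halt x sg (count q s, a, (i : ZMod _)) (verify q s M.init, a + i, 0) := by
  induction i generalizing a with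
  | zero =>
    simpa using reachesWith_stay (M := M) (halt := halt) (sg := sg) (z := count q s) (a := a) hi
      (by simp [compileNext, tapeSymbol_eq_leftEnd])
  | succ i ih =>
    have h1 : ¬tapeSymbol x (i + 1) = .leftEnd := by rw [tapeSymbol_eq_leftEnd]; omega
    have h2 := reachesWith_of_step (M := M) (halt := halt) (sg := sg) (z := count q s)
      (z' := count q s) (a := a) hi (c := 1) (d := -1) (by simp [compileNext, h1])
    have h3 := ih (by omega) (a + 1)
    refine h2.trans ?_
    unfold ReachesWith at h3
    simpa [add_assoc, add_comm (1 : ℤ)] using h3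

/-- Starting from `¢` with the value left by `count`, the counter vanishes exactly on the original
square, with the true automaton state of that square in hand. -/
theorem reachesWith_verify (q : Q) (s : S) (m : ℕ) : ∀ i : ℕ, i + m ≤ x.length + 1 →
    M.ReachesWith halt x counterSign (verify q s (M.pre x i), (m : ℤ), (i : ZMod _))
      (verify q s (M.pre x (i + m)), 0, ((i + m : ℕ) : ZMod _)) := by
  induction m with
  | zero => intro i _; exact .refl
  | succ m ih =>
    intro i hi
    have h1 : ¬tapeSymbol x i = .rightEnd := by rw [tapeSymbol_eq_rightEnd]; omega
    have h2 := reachesWith_of_step (M := M) (halt := halt) (sg := counterSign) (x := x)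
      (z := verify q s (M.pre x i)) (z' := verify q s (M.pre x (i + 1))) (a := ((m + 1 : ℕ) : ℤ))
      (i := i) (by omega) (c := -1) (d := 1)
      (by simp [compileNext, h1, counterSign, pre, show (m : ℤ) + 1 ≠ 0 by omega])
    refine h2.trans ?_
    have h3 := ih (i + 1) (by omega)
    rw [show i + 1 + m = i + (m + 1) by omega] at h3
    unfold ReachesWith at h3
    simpa using h3

/-- At counter value `0`, the state of the finite automaton is recomputed. -/
theorem reachesWith_verify_of_settled {q : Q} (hq : q ∉ halt) (s : S) (b : ZMod (x.length + 2)) :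
    M.ReachesWith halt x counterSign (settled q s, 0, b) (verify q s (M.pre x b.val), 0, b) := by
  obtain ⟨i, hi, rfl⟩ := exists_natCast_position b
  refine (reachesWith_stay (z' := count q s) hi (by simp [compileNext, hq, counterSign])).trans ?_
  refine (reachesWith_count q s i hi 0).trans ?_
  have := reachesWith_verify (M := M) (halt := halt) (x := x) q s i 0 (by omega)
  unfold ReachesWith at this
  simpa [val_natCast_position hi, pre] using this

/-- The compiled machine simulates a step. -/
theorem reachesWith_of_step_eq_some {v w : CounterConfig Q x.length} (hv : v.1 ∉ halt)
    (h : M.step x v = some w) :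
    M.ReachesWith halt x counterSign (settled v.1 (M.pre x v.2.2.val), v.2)
      (settled w.1 (M.pre x w.2.2.val), w.2) := by
  obtain ⟨q, a, b⟩ := v
  obtain ⟨i, hi, rfl⟩ := exists_natCast_position b
  simp only [step, Option.map_eq_some_iff, val_natCast_position hi] at h hv ⊢
  obtain ⟨p, hp, rfl⟩ := h
  obtain ⟨r, hr, hreach⟩ := exists_reachesWith_of_next (M := M) (halt := halt)
    (sg := counterSign) hi hp
  by_cases ha : a = 0
  · subst ha
    have h1 := reachesWith_verify_of_settled (M := M) (x := x) hv (M.pre x i) (i : ZMod _)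
    rw [val_natCast_position hi] at h1
    refine h1.trans (.head ?_ (hreach 0))
    simp only [counterSign, ne_eq, not_true_eq_false, decide_false] at hr
    simp [stepWith, val_natCast_position hi, compileNext, counterSign, hr]
  · refine .head ?_ (hreach a)
    simp only [counterSign, ne_eq, ha, not_false_eq_true, decide_true] at hr
    simp [stepWith, val_natCast_position hi, compileNext, counterSign, hr, hv, ha]

/-- The compiled machine simulates a computation. -/
theorem reachesWith_of_reaches (hhalt : ∀ q ∈ halt, ∀ s σ sg, M.next s σ sg q = none)
    {v w : CounterConfig Q x.length} (h : M.Reaches x v w) :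
    M.ReachesWith halt x counterSign (settled v.1 (M.pre x v.2.2.val), v.2)
      (settled w.1 (M.pre x w.2.2.val), w.2) := by
  induction h with
  | refl => exact .refl
  | @tail u w _ h ih =>
    refine ih.trans (reachesWith_of_step_eq_some (fun hu => ?_) h)
    simp [step, hhalt _ hu] at h

/-! ### The compiled machine with nonzero counter -/

variable (M halt x) in
/-- The action of the compiled machine with nonzero counter on states and head positions. -/
noncomputable def nodeStep (y : LookbehindState Q S × ZMod (x.length + 2)) :
    Option (LookbehindState Q S × ZMod (x.length + 2)) :=
  (M.compileNext halt (tapeSymbol x y.2.val) true y.1).map fun r =>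
    (r.1, y.2 + ((r.2.2 : ℤ) : ZMod _))

theorem nodeStep_of_stepWith {u v : CounterConfig (LookbehindState Q S) x.length}
    (h : M.stepWith halt x sg u = some v)
    (hu : M.compileNext halt (tapeSymbol x u.2.2.val) (sg u.2.1) u.1 =
      M.compileNext halt (tapeSymbol x u.2.2.val) true u.1) :
    M.nodeStep halt x (u.1, u.2.2) = some (v.1, v.2.2) := by
  simp only [stepWith, Option.map_eq_some_iff] at h
  obtain ⟨r, h1, rfl⟩ := h
  simp [nodeStep, ← hu, h1, moveTo]

theorem exists_iterate_nodeStep_of_reachesWith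
    {u v : CounterConfig (LookbehindState Q S) x.length}
    (h : M.ReachesWith halt x (fun _ => true) u v) :
    ∃ k, (fun o => o.bind (M.nodeStep halt x))^[k] (some (u.1, u.2.2)) = some (v.1, v.2.2) := by
  refine (reflTransGen_iff_exists_iterate _).1 ?_
  exact h.lift (fun u : CounterConfig (LookbehindState Q S) x.length => (u.1, u.2.2))
    fun _ _ h => nodeStep_of_stepWith h rfl

/-- With the correct automaton state the simulation of `M` also works when every test is answered by
"nonzero", so termination is inherited from `M`. A wrong automaton state gives no such guarantee;
the verification at counter value `0` exists to exclude it. -/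
theorem exists_iterate_nodeStep_settled (k : ℕ) : ∀ y : Q × ZMod (x.length + 2),
      (fun o => o.bind (M.nodeMap x))^[k] (some y) = none →
      ∃ k', (fun o => o.bind (M.nodeStep halt x))^[k']
        (some (settled y.1 (M.pre x y.2.val), y.2)) = none := by
  induction k with
  | zero => intro y h; simp at h
  | succ k ih =>
    intro y h
    by_cases hy : y.1 ∈ halt
    · exact ⟨1, by simp [nodeStep, compileNext, hy]⟩
    rw [Function.iterate_succ_apply, Option.bind_some] at h
    obtain ⟨q, b⟩ := y
    obtain ⟨i, hi, rfl⟩ := exists_natCast_position b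
    simp only [val_natCast_position hi] at hy ⊢
    rcases hp : M.next (M.pre x i) (tapeSymbol x i) true q with _ | p
    · exact ⟨1, by simp [nodeStep, compileNext, hy, act, hp, val_natCast_position hi]⟩
    · rw [nodeMap] at h
      simp only [val_natCast_position hi, hp, Option.map_some] at h
      obtain ⟨k₂, h2⟩ := ih _ h
      obtain ⟨r, hr, hreach⟩ := exists_reachesWith_of_next (M := M) (halt := halt)
        (sg := fun _ => true) hi hp
      obtain ⟨k₁, h1⟩ := exists_iterate_nodeStep_of_reachesWith (hreach 0)
      refine ⟨k₂ + (k₁ + 1), ?_⟩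
      rw [Function.iterate_add_apply, Function.iterate_succ_apply, Option.bind_some]
      have h3 : M.nodeStep halt x (settled q (M.pre x i), (i : ZMod (x.length + 2))) =
          some (r.1, (i : ZMod (x.length + 2)) + ((r.2.2 : ℤ) : ZMod _)) := by
        simp [nodeStep, compileNext, hy, hr, val_natCast_position hi]
      rw [h3]
      simp only [moveTo] at h1
      rw [h1]
      exact h2

/-- With nonzero answers, `verify` only walks to the right, and it stops at `$`. -/
theorem exists_iterate_nodeStep_verify (q : Q) (s : S) (m : ℕ) : ∀ i u, i + m = x.length + 1 →
    ∃ k, (fun o => o.bind (M.nodeStep halt x))^[k]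
      (some (verify q s u, (i : ZMod (x.length + 2)))) = none := by
  induction m with
  | zero =>
    intro i u hi
    have h1 : tapeSymbol x i = .rightEnd := by rw [tapeSymbol_eq_rightEnd]; omega
    refine ⟨1, ?_⟩
    rw [Function.iterate_one, Option.bind_some, nodeStep, val_natCast_position (by omega)]
    simp [compileNext, h1]
  | succ m ih =>
    intro i u hi
    have h1 : ¬tapeSymbol x i = .rightEnd := by rw [tapeSymbol_eq_rightEnd]; omega
    obtain ⟨k, hk⟩ := ih (i + 1) (M.update u (tapeSymbol x i)) (by omega)
    refine ⟨k + 1, ?_⟩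
    rw [Function.iterate_succ_apply, Option.bind_some]
    simpa [nodeStep, compileNext, val_natCast_position (show i ≤ x.length + 1 by omega), h1]
      using hk

theorem exists_iterate_nodeStep_count (q : Q) (s : S) (i : ℕ) (hi : i ≤ x.length + 1) :
    ∃ k, (fun o => o.bind (M.nodeStep halt x))^[k]
      (some (count q s, (i : ZMod (x.length + 2)))) = none := by
  obtain ⟨k₁, h1⟩ := exists_iterate_nodeStep_of_reachesWith
    (reachesWith_count (M := M) (halt := halt) (sg := fun _ => true) q s i hi 0)
  obtain ⟨k₂, h2⟩ := exists_iterate_nodeStep_verify (M := M) (halt := halt) (x := x) q s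
    (x.length + 1) 0 M.init (by omega)
  refine ⟨k₂ + k₁, ?_⟩
  rw [Function.iterate_add_apply, h1]
  simpa using h2

/-- A configuration from which a halting state is reachable does not lie over a periodic node. -/
theorem notMem_periodicPts_of_reachesWith
    (hterm : ∀ y, ∃ k, (fun o => o.bind (M.nodeMap x))^[k] (some y) = none)
    {u w : CounterConfig (LookbehindState Q S) x.length}
    (h : M.ReachesWith halt x counterSign u w) {q : Q} {s : S} (hw : w.1 = settled q s)
    (hq : q ∈ halt) :
    some (u.1, u.2.2) ∉
      Function.periodicPts fun o : Option _ => o.bind (M.nodeStep halt x) := by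
  have hwn : M.stepWith halt x counterSign w = none := by simp [stepWith, hw, compileNext, hq]
  induction h using Relation.ReflTransGen.head_induction_on with
  | refl => exact some_notMem_periodicPts (k := 1) _ (by simp [nodeStep, hw, compileNext, hq])
  | @head u u' hu hr ih =>
    -- Where the transition is the one for a nonzero counter, periodicity would pass to the
    -- successor, against `ih`.
    have key : M.compileNext halt (tapeSymbol x u.2.2.val) (counterSign u.2.1) u.1 =
        M.compileNext halt (tapeSymbol x u.2.2.val) true u.1 →
        some (u.1, u.2.2) ∉
      Function.periodicPts fun o : Option _ => o.bind (M.nodeStep halt x) := by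
      intro h1 h2
      have h3 := (Function.bijOn_periodicPts fun o : Option _ => o.bind (M.nodeStep halt x)).mapsTo h2
      rw [Option.bind_some, nodeStep_of_stepWith hu h1] at h3
      exact ih h3
    by_cases ha : u.2.1 = 0
    swap
    · exact key (by simp [counterSign, ha])
    obtain ⟨z, a, b⟩ := u
    subst ha
    obtain ⟨i, hi, rfl⟩ := exists_natCast_position b
    cases z with
    | wrap q s => exact key rfl
    | back q s => exact key rfl
    | scan q φ => exact key rfl
    | resume q r s₁ s₂ => exact key rfl
    | count q s =>
      obtain ⟨k, hk⟩ := exists_iterate_nodeStep_count (M := M) (halt := halt) q s i hi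
      exact some_notMem_periodicPts _ hk
    | verify q s u =>
      obtain ⟨k, hk⟩ := exists_iterate_nodeStep_verify (M := M) (halt := halt) (x := x) q s
        (x.length + 1 - i) i u (by omega)
      exact some_notMem_periodicPts _ hk
    | settled p t =>
      have hp : p ∉ halt := fun hp => by simp [stepWith, compileNext, hp] at hu
      -- At counter value `0` the verification lies on the way to `w`. Since it succeeds, `t` is the
      -- correct automaton state, and `hterm` excludes periodicity.
      have h1 := reaches_of_none
        (reachesWith_verify_of_settled (M := M) (x := x) hp t (i : ZMod _)) (.head hu hr) hwn
      rcases Relation.ReflTransGen.cases_head h1 with h2 | ⟨v, h2, -⟩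
      · rw [← h2] at hw
        simp at hw
      · have h3 : M.pre x (i : ZMod (x.length + 2)).val = t := by
          by_contra h3
          rw [val_natCast_position hi] at h2 h3
          simp [-ZMod.val_natCast, stepWith, compileNext, counterSign, h3] at h2
        subst h3
        obtain ⟨k, hk⟩ := hterm (p, (i : ZMod _))
        obtain ⟨k', hk'⟩ := exists_iterate_nodeStep_settled k _ hk
        exact some_notMem_periodicPts _ hk'

theorem compile_step (v : CounterConfig (LookbehindState Q S × SignType × SignType) x.length) :
    ((M.compile halt).step x v).map (fun v => (v.1.1, v.2)) =
      M.stepWith halt x counterSign (v.1.1, v.2) := by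
  simp only [PartialMachine.step, compile, stepWith, Option.map_map]
  rfl

theorem reachesWith_of_compile_reaches
    {v w : CounterConfig (LookbehindState Q S × SignType × SignType) x.length}
    (h : (M.compile halt).Reaches x v w) :
    M.ReachesWith halt x counterSign (v.1.1, v.2) (w.1.1, w.2) :=
  h.lift (fun v : CounterConfig (LookbehindState Q S × SignType × SignType) x.length =>
    (v.1.1, v.2)) fun u v h => by
    rw [Function.onFun, ← compile_step, h]; rfl

theorem exists_compile_reaches
    {v : CounterConfig (LookbehindState Q S × SignType × SignType) x.length}
    {w : CounterConfig (LookbehindState Q S) x.length}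
    (h : M.ReachesWith halt x counterSign (v.1.1, v.2) w) :
    ∃ w', (w'.1.1, w'.2) = w ∧ (M.compile halt).Reaches x v w' := by
  induction h with
  | refl => exact ⟨v, rfl, .refl⟩
  | @tail u w _ hu ih =>
    obtain ⟨u', rfl, h1⟩ := ih
    rw [← compile_step, Option.map_eq_some_iff] at hu
    obtain ⟨w', h2, rfl⟩ := hu
    exact ⟨w', rfl, h1.tail h2⟩

theorem mem_periodicPts_of_compile
    {y : (LookbehindState Q S × SignType × SignType) × ZMod (x.length + 2)}
    (h : some y ∈ Function.periodicPts fun o : Option _ => o.bind ((M.compile halt).nodeMap x)) :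
    some (y.1.1, y.2) ∈ Function.periodicPts fun o : Option _ => o.bind (M.nodeStep halt x) := by
  have hs : Function.Semiconj
      (Option.map fun y : (LookbehindState Q S × SignType × SignType) × ZMod (x.length + 2) =>
        (y.1.1, y.2))
      (fun o => o.bind ((M.compile halt).nodeMap x)) (fun o => o.bind (M.nodeStep halt x)) := by
    rintro (_ | y)
    · rfl
    · simp only [Option.bind_some, Option.map_some, PartialMachine.nodeMap, compile, nodeStep,
        Option.map_map]
      rfl
  obtain ⟨m, hm, hp⟩ := h
  exact ⟨m, hm, hp.map hs⟩

end LookbehindMachine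

/-- A machine with lookbehind that halts on every input and always terminates when its tests of the
counter are answered by "nonzero" can be made reversible. -/
theorem LookbehindMachine.exists_reversible {α : Type*} {Q S : Type} [Finite Q] [Finite S]
    (M : LookbehindMachine α Q S) (start : Q) (acc rej : Set Q) (hdis : Disjoint acc rej)
    (hhalt : ∀ q ∈ acc ∪ rej, ∀ s σ sg, M.next s σ sg q = none) (L : Language α)
    (hL : ∀ x ∈ L, ∃ v, v.1 ∈ acc ∧ M.Reaches x (start, 0, 0) v)
    (hL' : ∀ x ∉ L, ∃ v, v.1 ∈ rej ∧ M.Reaches x (start, 0, 0) v)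
    (hterm : ∀ x y, ∃ k, (fun o => o.bind (M.nodeMap x))^[k] (some y) = none) :
    ∃ (Q' : Type) (_ : Fintype Q') (M' : TwoWayQuantum1CA α Q'),
      M'.IsReversible ∧ M'.IsSimple ∧ M'.RecognizesWithProb L 1 := by
  have hlift : ∀ (x : List α) (F : Set Q) (v : CounterConfig Q x.length), v.1 ∈ F →
      M.Reaches x (start, 0, 0) v →
      ∃ w : CounterConfig (LookbehindState Q S × SignType × SignType) x.length,
        w.1 ∈ {z | ∃ q ∈ F, ∃ s, z.1 = LookbehindState.settled q s} ∧
        (M.compile (acc ∪ rej)).Reaches x ((LookbehindState.settled start M.init, 0, 0), 0, 0) w := by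
    intro x F v hv h
    have h1 := reachesWith_of_reaches hhalt h
    simp only [ZMod.val_zero] at h1
    obtain ⟨w, h2, h3⟩ := exists_compile_reaches (M := M) (halt := acc ∪ rej)
      (v := ((LookbehindState.settled start M.init, 0, 0), 0, 0)) h1
    exact ⟨w, ⟨v.1, hv, _, congrArg Prod.fst h2⟩, h3⟩
  refine (M.compile (acc ∪ rej)).exists_reversible (LookbehindState.settled start M.init, 0, 0)
    {z | ∃ q ∈ acc, ∃ s, z.1 = LookbehindState.settled q s}
    {z | ∃ q ∈ rej, ∃ s, z.1 = LookbehindState.settled q s} ?_ ?_ L ?_ ?_ ?_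
  · rw [Set.disjoint_left]
    rintro z ⟨q, hq, s, h⟩ ⟨q', hq', s', h'⟩
    obtain ⟨rfl, -⟩ := LookbehindState.settled.inj (h.symm.trans h')
    exact Set.disjoint_left.1 hdis hq hq'
  · rintro ⟨z, c⟩ (⟨q, hq, s, rfl⟩ | ⟨q, hq, s, rfl⟩) σ sg
    · simp [compile, compileNext, hq]
    · simp [compile, compileNext, hq]
  · intro x hx
    obtain ⟨v, hv, h⟩ := hL x hx
    exact hlift x acc v hv h
  · intro x hx
    obtain ⟨v, hv, h⟩ := hL' x hx
    exact hlift x rej v hv h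
  · intro x v w h hw
    refine PartialMachine.acc_pred_of_periodic _ x
      {z | ∃ q ∈ acc ∪ rej, ∃ s, z.1 = LookbehindState.settled q s} ?_ ?_ h ?_
    · rintro ⟨z, c⟩ ⟨q, hq, s, rfl⟩ σ sg
      simp only [compile, compileNext]
      rw [if_pos hq]
    · rintro v w - h1 h2 ⟨q, hq, s, h3⟩
      exact notMem_periodicPts_of_reachesWith (hterm x) (reachesWith_of_compile_reaches h2)
        h3 hq (mem_periodicPts_of_compile h1)
    · rcases hw with ⟨q, hq, s, h⟩ | ⟨q, hq, s, h⟩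
      · exact ⟨q, .inl hq, s, h⟩
      · exact ⟨q, .inr hq, s, h⟩

/-! ### Two-way walks, peaks and tables of excursions -/

/-- A two-way deterministic automaton without halting states, in which the entered state determines
the move of the head. -/
structure Walker (α W : Type*) where
  turn : TapeSymbol α → W → W
  head : W → SignType

namespace Walker

variable {α W : Type*} (A : Walker α W)

/-- One step of the walker. -/
def move (x : List α) (y : W × ZMod (x.length + 2)) : W × ZMod (x.length + 2) :=
  let w := A.turn (tapeSymbol x y.2.val) y.1
  (w, y.2 + ((A.head w : ℤ) : ZMod (x.length + 2)))

/-- The walker never again visits a square to the right of the present one. -/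
def Peak (x : List α) (y : W × ZMod (x.length + 2)) : Prop :=
  ∀ k, ((A.move x)^[k] y).2.val ≤ y.2.val

/-- A return to the present square, without a visit to its right. The relation `ρ` describes the
excursions to the left. -/
def Detour (ρ : Set (W × Option W)) (σ : TapeSymbol α) (w w' : W) : Prop :=
  (A.head (A.turn σ w) = 0 ∧ w' = A.turn σ w) ∨
    (A.head (A.turn σ w) = -1 ∧ (A.turn σ w, some w') ∈ ρ)

/-- The excursions to the left of the next square. The value `none` stands for a departure across
the left end of the tape, and `some w` for a departure to the right that enters `w`. -/
def extend (ρ : Set (W × Option W)) (σ : TapeSymbol α) : Set (W × Option W) :=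
  {z | ∃ w', Relation.ReflTransGen (A.Detour ρ σ) z.1 w' ∧
    ((A.head (A.turn σ w') = 1 ∧ z.2 = some (A.turn σ w')) ∨
      (A.head (A.turn σ w') = -1 ∧ (A.turn σ w', none) ∈ ρ ∧ z.2 = none))}

/-- The excursions to the left of the first square. -/
def emptyTable : Set (W × Option W) := {z | z.2 = none}

/-- The excursions to the left of square `i`. -/
def table (x : List α) : ℕ → Set (W × Option W)
  | 0 => emptyTable
  | i + 1 => A.extend (table x i) (tapeSymbol x i)

variable {A} {x : List α}

/-- The walk is at a peak whenever it stands on the rightmost square of its orbit. -/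
theorem exists_peak (y : W × ZMod (x.length + 2)) : ∃ k, A.Peak x ((A.move x)^[k] y) := by
  have hb : BddAbove (Set.range fun k => ((A.move x)^[k] y).2.val) :=
    ⟨x.length + 2, by rintro _ ⟨k, rfl⟩; exact (ZMod.val_lt _).le⟩
  obtain ⟨k, hk⟩ := Nat.sSup_mem (Set.range_nonempty _) hb
  refine ⟨k, fun m => ?_⟩
  rw [← Function.iterate_add_apply]
  exact (le_csSup hb ⟨m + k, rfl⟩).trans hk.ge

/-- An injective map of a finite set moves in cycles, and a peak lies on the rightmost square of its
cycle. Peaks of one cycle therefore differ only in their state. -/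
theorem eq_of_peak [Finite W] (hA : (A.move x).Injective) {y : W × ZMod (x.length + 2)} {k : ℕ}
    (h : A.Peak x y) (h' : A.Peak x ((A.move x)^[k] y)) (hk : ((A.move x)^[k] y).1 = y.1) :
    (A.move x)^[k] y = y := by
  refine Prod.ext hk (ZMod.val_injective _ (le_antisymm (h k) ?_))
  obtain ⟨m, hm, hp⟩ := hA.mem_periodicPts y
  have h1 := hp.const_mul k
  have h2 := h' (k * m - k)
  rwa [← Function.iterate_add_apply, Nat.sub_add_cancel (Nat.le_mul_of_pos_right k hm), h1] at h2

/-- The walker leads from `y` to `y'` through squares to the left of `i`. -/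
def Within (A : Walker α W) (x : List α) (i : ℕ) (y y' : W × ZMod (x.length + 2)) : Prop :=
  ∃ k, (A.move x)^[k] y = y' ∧ ∀ j < k, ((A.move x)^[j] y).2.val < i

theorem Within.refl (i : ℕ) (y : W × ZMod (x.length + 2)) : A.Within x i y y :=
  ⟨0, rfl, fun j hj => by omega⟩

theorem Within.mono {i i' : ℕ} (hi : i ≤ i') {y y' : W × ZMod (x.length + 2)}
    (h : A.Within x i y y') : A.Within x i' y y' := by
  obtain ⟨k, h1, h2⟩ := h
  exact ⟨k, h1, fun j hj => (h2 j hj).trans_le hi⟩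

theorem Within.trans {i : ℕ} {y y' y'' : W × ZMod (x.length + 2)}
    (h : A.Within x i y y') (h' : A.Within x i y' y'') : A.Within x i y y'' := by
  obtain ⟨k, rfl, h2⟩ := h
  obtain ⟨k', rfl, h2'⟩ := h'
  refine ⟨k' + k, Function.iterate_add_apply _ _ _ _, fun j hj => ?_⟩
  rcases lt_or_ge j k with h3 | h3
  · exact h2 j h3
  · have := h2' (j - k) (by omega)
    rwa [← Function.iterate_add_apply, Nat.sub_add_cancel h3] at this

theorem Within.head {i : ℕ} {y y' : W × ZMod (x.length + 2)} (hy : y.2.val < i)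
    (h : A.Within x i (A.move x y) y') : A.Within x i y y' :=
  Within.trans ⟨1, rfl, fun j hj => by obtain rfl : j = 0 := by omega
                                       exact hy⟩ h

theorem move_natCast {i : ℕ} (hi : i ≤ x.length + 1) (w : W) :
    A.move x (w, (i : ZMod _)) = (A.turn (tapeSymbol x i) w,
      (i : ZMod _) + ((A.head (A.turn (tapeSymbol x i) w) : ℤ) : ZMod _)) := by
  simp only [move, val_natCast_position hi]

/-- Soundness of the tables: an excursion is a sequence of detours back to square `i`, followed by a
departure. In the base case the square to the left of `¢` is already `$`. -/
theorem within_of_mem_table (i : ℕ) (hi : i ≤ x.length + 1) :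
    ∀ w, (∀ w', (w, some w') ∈ A.table x i → A.Within x i (w, (i : ZMod _) - 1) (w', (i : ZMod _))) ∧
      ((w, none) ∈ A.table x i → ∃ w',
        A.Within x i (w, (i : ZMod _) - 1) (w', ((x.length + 1 : ℕ) : ZMod _))) := by
  induction i with
  | zero =>
    intro w
    refine ⟨fun w' h => by simp [table, emptyTable] at h, fun _ => ⟨w, ?_⟩⟩
    rw [Nat.cast_zero, zero_sub_one_position]
    exact .refl _ _
  | succ i ih =>
    have hi' : i ≤ x.length + 1 := by omega
    have hlt : ∀ w, ((w, (i : ZMod (x.length + 2))) : W × ZMod (x.length + 2)).2.val < i + 1 := by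
      intro w; rw [val_natCast_position hi']; omega
    have hdet : ∀ w w', A.Detour (A.table x i) (tapeSymbol x i) w w' →
        A.Within x (i + 1) (w, (i : ZMod _)) (w', (i : ZMod _)) := by
      rintro w w' (⟨h1, rfl⟩ | ⟨h1, h2⟩)
      · refine .head (hlt w) ?_
        rw [move_natCast hi', h1]
        simpa using Within.refl _ _
      · refine .head (hlt w) ?_
        rw [move_natCast hi', h1]
        simpa [sub_eq_add_neg] using ((ih hi' _).1 w' h2).mono (Nat.le_succ i)
    have hdets : ∀ w w', Relation.ReflTransGen (A.Detour (A.table x i) (tapeSymbol x i)) w w' →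
        A.Within x (i + 1) (w, (i : ZMod _)) (w', (i : ZMod _)) := by
      intro w w' h
      induction h with
      | refl => exact .refl _ _
      | tail _ h ih => exact ih.trans (hdet _ _ h)
    have hcast : ((i + 1 : ℕ) : ZMod (x.length + 2)) - 1 = (i : ZMod _) := by simp
    intro w
    rw [hcast]
    constructor
    · rintro w' ⟨u, h1, ⟨h2, h3⟩ | ⟨h2, h3, h4⟩⟩
      · obtain rfl := Option.some.inj h3
        refine (hdets _ _ h1).trans (.head (hlt u) ?_)
        rw [move_natCast hi', h2]
        simpa using Within.refl _ _
      · simp at h4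
    · rintro ⟨u, h1, ⟨h2, h3⟩ | ⟨h2, h3, h4⟩⟩
      · simp at h3
      · obtain ⟨w', h5⟩ := (ih hi' _).2 h3
        refine ⟨w', (hdets _ _ h1).trans (.head (hlt u) ?_)⟩
        rw [move_natCast hi', h2]
        simpa [sub_eq_add_neg] using h5.mono (Nat.le_succ i)

/-- Completeness of the tables, by induction on the square and, inside, on the time. -/
theorem mem_table_of_iterate (i : ℕ) (hi : i ≤ x.length + 1) :
    ∀ (k : ℕ) (w : W), i ≤ ((A.move x)^[k] (w, (i : ZMod _) - 1)).2.val →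
      (∀ j < k, ((A.move x)^[j] (w, (i : ZMod _) - 1)).2.val < i) →
      (((A.move x)^[k] (w, (i : ZMod _) - 1)).2 = (i : ZMod _) ∧
        (w, some ((A.move x)^[k] (w, (i : ZMod _) - 1)).1) ∈ A.table x i) ∨
      (w, none) ∈ A.table x i := by
  induction i with
  | zero => exact fun _ _ _ _ => .inr rfl
  | succ i ih =>
    have hi' : i ≤ x.length + 1 := by omega
    have hcast : ((i + 1 : ℕ) : ZMod (x.length + 2)) - 1 = (i : ZMod _) := by simp
    rw [hcast]
    have hsucc : ∀ w w' o, A.Detour (A.table x i) (tapeSymbol x i) w w' →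
        (w', o) ∈ A.table x (i + 1) → (w, o) ∈ A.table x (i + 1) := by
      rintro w w' o h ⟨u, h1, h2⟩
      exact ⟨u, .head h h1, h2⟩
    intro k
    induction k using Nat.strong_induction_on with
    | _ k ihk =>
    intro w h1 h2
    rcases k with _ | k
    · rw [Function.iterate_zero_apply, val_natCast_position hi'] at h1
      omega
    have hstep := move_natCast (A := A) hi' w
    rw [Function.iterate_succ_apply, hstep] at h1 ⊢
    have h2' : ∀ j < k, ((A.move x)^[j] (A.move x (w, (i : ZMod _)))).2.val < i + 1 := by
      intro j hj
      have := h2 (j + 1) (by omega)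
      rwa [Function.iterate_succ_apply] at this
    rw [hstep] at h2'
    set w₁ := A.turn (tapeSymbol x i) w with hw₁
    have hcases : ∀ d : SignType, d = 0 ∨ d = 1 ∨ d = -1 := by decide
    rcases hcases (A.head w₁) with hd | hd | hd
    · rw [hd] at h1 h2' ⊢
      simp only [SignType.coe_zero, Int.cast_zero, add_zero] at h1 h2' ⊢
      have hdet : A.Detour (A.table x i) (tapeSymbol x i) w w₁ := .inl ⟨hd, rfl⟩
      rcases ihk k (by omega) w₁ h1 h2' with ⟨h3, h4⟩ | h3
      · exact .inl ⟨h3, hsucc _ _ _ hdet h4⟩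
      · exact .inr (hsucc _ _ _ hdet h3)
    · rw [hd] at h1 h2' ⊢
      rcases k with _ | k
      · exact .inl ⟨by simp, w, .refl, .inl ⟨hd, rfl⟩⟩
      · have h3 := h2' 0 (by omega)
        have h4 : (i : ZMod (x.length + 2)) + (((1 : SignType) : ℤ) : ZMod _) = ((i + 1 : ℕ) : ZMod _) := by
          simp
        rw [Function.iterate_zero_apply, h4, val_natCast_position hi] at h3
        omega
    · rw [hd] at h1 h2' ⊢
      have hsub : (i : ZMod (x.length + 2)) + (((-1 : SignType) : ℤ) : ZMod _) = (i : ZMod _) - 1 := by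
        simp [sub_eq_add_neg]
      rw [hsub] at h1 h2' ⊢
      -- The first time at square `i` or beyond cuts off an excursion that the previous table
      -- describes.
      have hex : ∃ j, i ≤ ((A.move x)^[j] (w₁, (i : ZMod _) - 1)).2.val := ⟨k, by omega⟩
      have hj := Nat.find_spec hex
      have hj' : Nat.find hex ≤ k := Nat.find_min' hex (by omega)
      have hlt := fun j (h : j < Nat.find hex) => not_le.1 (Nat.find_min hex h)
      generalize Nat.find hex = j at hj hj' hlt
      rcases ih hi' j w₁ hj hlt with ⟨h3, h4⟩ | h3
      · have hdet : A.Detour (A.table x i) (tapeSymbol x i) w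
            ((A.move x)^[j] (w₁, (i : ZMod _) - 1)).1 := .inr ⟨hd, h4⟩
        obtain ⟨m, rfl⟩ := Nat.exists_eq_add_of_le hj'
        have h5 : (A.move x)^[j] (w₁, (i : ZMod _) - 1) =
            (((A.move x)^[j] (w₁, (i : ZMod _) - 1)).1, (i : ZMod _)) := Prod.ext rfl h3
        have h6 : ∀ m, (A.move x)^[j + m] (w₁, (i : ZMod _) - 1) =
            (A.move x)^[m] (((A.move x)^[j] (w₁, (i : ZMod _) - 1)).1, (i : ZMod _)) := by
          intro m
          rw [Nat.add_comm j m, Function.iterate_add_apply]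
          conv_lhs => rw [h5]
        rw [h6] at h1 ⊢
        rcases ihk m (by omega) _ h1 (fun l hl => by rw [← h6]; exact h2' _ (by omega)) with
          ⟨h7, h8⟩ | h7
        · exact .inl ⟨h7, hsucc _ _ _ hdet h8⟩
        · exact .inr (hsucc _ _ _ hdet h7)
      · exact .inr ⟨w, .refl, .inr ⟨hd, h3, rfl⟩⟩

/-- Whether the present square is a peak can be read off from the excursions to its left. -/
theorem peak_iff {i : ℕ} (hi : i ≤ x.length + 1) (w : W) :
    A.Peak x (w, (i : ZMod _)) ↔ tapeSymbol x i = .rightEnd ∨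
      ∀ o, (w, o) ∉ A.extend (A.table x i) (tapeSymbol x i) := by
  rcases hi.lt_or_eq with hlt | rfl
  swap
  · refine iff_of_true (fun k => ?_) (.inl (tapeSymbol_eq_rightEnd.2 le_rfl))
    rw [val_natCast_position le_rfl]
    exact Nat.lt_succ_iff.1 (ZMod.val_lt _)
  have hcast : ((i + 1 : ℕ) : ZMod (x.length + 2)) - 1 = (i : ZMod _) := by simp
  rw [tapeSymbol_eq_rightEnd, or_iff_right (by omega)]
  change _ ↔ ∀ o, (w, o) ∉ A.table x (i + 1)
  have hval := val_natCast_position hi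
  constructor
  · intro h o ho
    obtain ⟨y, hy, k, hk, -⟩ : ∃ y : W × ZMod (x.length + 2), i < y.2.val ∧
        A.Within x (i + 1) (w, (i : ZMod _)) y := by
      rw [← hcast]
      -- A departure across the left end arrives at `$`, which also lies to the right of square `i`.
      rcases o with _ | w'
      · obtain ⟨w', h1⟩ := (within_of_mem_table (i + 1) hlt w).2 ho
        exact ⟨_, by rw [val_natCast_position le_rfl]; omega, h1⟩
      · exact ⟨_, by rw [val_natCast_position hlt]; omega,
          (within_of_mem_table (i + 1) hlt w).1 w' ho⟩
    have := h k
    rw [hk, hval] at this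
    omega
  · intro h k
    by_contra hk
    rw [hval, not_le] at hk
    have hex : ∃ k, i < ((A.move x)^[k] (w, (i : ZMod _))).2.val := ⟨k, hk⟩
    have h1 := Nat.find_spec hex
    have h2 := fun j (h : j < Nat.find hex) => not_lt.1 (Nat.find_min hex h)
    have h3 := mem_table_of_iterate (A := A) (i + 1) hlt (Nat.find hex) w
    rw [hcast] at h3
    rcases h3 h1 (fun j hj => Nat.lt_succ_of_le (h2 j hj)) with ⟨-, h4⟩ | h4
    · exact h _ h4
    · exact h _ h4

end Walker

/-! ### Infinite branches on the two sides of a path -/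

namespace PartialMachine

variable {α P : Type*} {K : PartialMachine α P} {x : List α} {e : P → ℤ}

section Vertex

variable [Finite P]

theorem tour_down_cases (he : e.Injective) (v : CounterConfig P x.length) :
    K.tour e x (K.down v) = up v ∨ ∃ u, K.step x u = some v ∧ K.tour e x (K.down v) = K.down u := by
  by_cases hex : ∃ u, K.step x u = some v
  · obtain ⟨u, h1, -, h3⟩ := exists_least_pred (e := e) (fun _ => True) (by simpa using hex)
    exact .inr ⟨u, h1, tour_down he h1 (by simpa using h3)⟩
  · push Not at hex
    exact .inl (tour_down_leaf hex)

theorem tour_up_cases (he : e.Injective) (v : CounterConfig P x.length) :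
    K.tour e x (up v) = K.down v ∨ ∃ u, K.step x v = some u ∧
      (K.tour e x (up v) = up u ∨ ∃ v', K.step x v' = some u ∧ K.tour e x (up v) = K.down v') := by
  rcases hv : K.step x v with _ | u
  · exact .inl (tour_up_root hv)
  refine .inr ⟨u, rfl, ?_⟩
  by_cases hex : ∃ v', K.step x v' = some u ∧ e v.1 < e v'.1
  · obtain ⟨v', h1, h2, h3⟩ := exists_least_pred (e := e) (fun p => e v.1 < e p) hex
    exact .inr ⟨v', h1, tour_up_next he hv h1 h2 h3⟩
  · push Not at hex
    exact .inl (tour_up_last hv hex)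

/-- The traversal stays in the component of a configuration without successor. -/
theorem tour_iterate_reaches (he : e.Injective) {v r : CounterConfig P x.length}
    (h : K.Reaches x v r) (hr : K.step x r = none) (k : ℕ) : ∃ u, K.Reaches x u r ∧
      ((K.tour e x)^[k] (up v) = up u ∨ (K.tour e x)^[k] (up v) = K.down u) := by
  induction k with
  | zero => exact ⟨v, h, .inl rfl⟩
  | succ k ih =>
    obtain ⟨u, hu, h1 | h1⟩ := ih <;> simp only [Function.iterate_succ_apply', h1]
    · rcases tour_up_cases he u with h2 | ⟨u', h2, h3⟩
      · exact ⟨u, hu, .inr h2⟩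
      · have h4 : K.Reaches x u' r := reaches_of_none (.single h2) hu hr
        rcases h3 with h3 | ⟨v', h3, h5⟩
        · exact ⟨u', h4, .inl h3⟩
        · exact ⟨v', .head h3 h4, .inr h5⟩
    · rcases tour_down_cases he u with h2 | ⟨u', h2, h3⟩
      · exact ⟨u, hu, .inl h2⟩
      · exact ⟨u', .head h2 hu, .inr h3⟩

end Vertex

theorem injective_iterate_of_infinite {V : Type*} (f : V → V) (v : V)
    (h : (Set.range fun k => f^[k] v).Infinite) : Function.Injective fun k => f^[k] v := by
  have hne : ∀ i j, i < j → f^[i] v ≠ f^[j] v := by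
    intro i j hij heq
    refine h (((Set.finite_lt_nat j).image fun k => f^[k] v).subset ?_)
    rintro _ ⟨k, rfl⟩
    induction k using Nat.strong_induction_on with
    | _ k ih =>
    rcases lt_or_ge k j with h1 | h1
    · exact ⟨k, h1, rfl⟩
    · obtain ⟨l, h2, h3⟩ := ih (k - j + i) (by omega)
      refine ⟨l, h2, h3.trans ?_⟩
      change f^[k - j + i] v = f^[k] v
      rw [Function.iterate_add_apply, heq, ← Function.iterate_add_apply, Nat.sub_add_cancel h1]
  intro i j hij
  rcases lt_trichotomy i j with h | h | h
  · exact absurd hij (hne i j h)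
  · exact h
  · exact absurd hij.symm (hne j i h)

/-- If the traversal does not lead to the end of the computation, then it never repeats itself. -/
theorem tour_injective_of_not_visits [Finite P] (he : e.Injective) {v r : CounterConfig P x.length}
    (h : K.Reaches x v r) (hr : K.step x r = none) (hv : ¬K.Visits e x (up v) (up r)) :
    (∀ i, K.Interior x ((K.tour e x)^[i] (up v))) ∧
      Function.Injective fun i => (K.tour e x)^[i] (up v) := by
  -- An infinite branch is followed backwards: from each vertex of `X` the walk goes on to a
  -- predecessor in `X`. It thus visits infinitely many configurations, and every time precedes one
  -- of these visits.
  let X := {s : CounterConfig P x.length // ¬Acc (K.Pred x) s ∧ (K.step x s).isSome ∧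
    K.Reaches x s r ∧ K.Visits e x (up v) (K.down s)}
  obtain ⟨-, w', s, -, -, h3, h4, -, h6, h7⟩ := (visits_or_branch he h).resolve_left hv
  have hnext : ∀ s : X, ∃ s' : X, K.step x s'.1 = some s.1 := by
    rintro ⟨s, h1, h2, h3, h4⟩
    obtain ⟨s', h5, h6, h7⟩ := exists_visits_down he h1
    exact ⟨⟨s', h6, by simp [h5], .head h5 h3, h4.trans ((visits_down h2).trans h7)⟩, h5⟩
  choose pre hpre using hnext
  let κ : ℕ → X := fun k => pre^[k] ⟨s, h6, by simp [h4], .head h4 h3, h7⟩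
  have hκ : Function.Injective fun k => (κ k).1 := by
    refine injective_of_chain (f := K.step x) (w := r) (fun i => ?_) (κ 0).2.2.2.1 hr
    simp only [κ, Function.iterate_succ_apply', hpre]
  choose t ht ht' using fun k => (κ k).2.2.2.2.exists_iterate
  have hti : Function.Injective t := by
    intro i j hij
    refine hκ (K.down_injective ?_)
    rw [← ht, ← ht, hij]
  constructor
  · intro i
    obtain ⟨_, ⟨k, rfl⟩, hk⟩ := (Set.infinite_range_of_injective hti).exists_gt i
    exact ht' k i hk
  · refine injective_iterate_of_infinite _ _ ?_
    refine (Set.infinite_range_of_injective (K.down_injective.comp hκ)).mono ?_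
    rintro _ ⟨k, rfl⟩
    exact ⟨t k, ht k⟩

theorem ne_zero_of_step (hK : ∀ σ p, K.next σ false p = none) {u v : CounterConfig P x.length} (h : K.step x u = some v) :
    u.2.1 ≠ 0 := by
  intro h0
  simp [step, h0, counterSign, hK] at h

theorem mem_periodicPts_of_not_acc [Finite P] (hK : ∀ σ p, K.next σ false p = none)
    {v : CounterConfig P x.length} (h : ¬Acc (K.Pred x) v) :
    some (v.1, v.2.2) ∈ Function.periodicPts fun o : Option _ => o.bind (K.nodeMap x) := by
  obtain ⟨κ, rfl, hκ⟩ := not_acc_iff_exists_descending_chain.1 h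
  exact some_mem_periodicPts_of_chain _ (fun i => ((κ i).1, (κ i).2.2))
    fun i => nodeMap_of_step (hκ i) (ne_zero_of_step hK (hκ i))

theorem mem_periodicPts_of_step (hK : ∀ σ p, K.next σ false p = none)
    {u v : CounterConfig P x.length} (h : K.step x u = some v)
    (hu : some (u.1, u.2.2) ∈ Function.periodicPts fun o : Option _ => o.bind (K.nodeMap x)) :
    some (v.1, v.2.2) ∈ Function.periodicPts fun o : Option _ => o.bind (K.nodeMap x) := by
  have := (Function.bijOn_periodicPts fun o : Option _ => o.bind (K.nodeMap x)).mapsTo hu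
  rwa [Option.bind_some, nodeMap_of_step h (ne_zero_of_step hK h)] at this

theorem mem_periodicPts_of_reaches (hK : ∀ σ p, K.next σ false p = none)
    {u v : CounterConfig P x.length} (h : K.Reaches x u v)
    (hu : some (u.1, u.2.2) ∈ Function.periodicPts fun o : Option _ => o.bind (K.nodeMap x)) :
    some (v.1, v.2.2) ∈ Function.periodicPts fun o : Option _ => o.bind (K.nodeMap x) := by
  induction h with
  | refl => exact hu
  | tail _ h ih => exact mem_periodicPts_of_step hK h ih

/-- A map is injective on its periodic points, so at most one predecessor of `v` lies over a
periodic node. -/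
theorem fst_eq_of_step (hK : ∀ σ p, K.next σ false p = none)
    {u u' v : CounterConfig P x.length} (h : K.step x u = some v) (h' : K.step x u' = some v)
    (hu : some (u.1, u.2.2) ∈ Function.periodicPts fun o : Option _ => o.bind (K.nodeMap x))
    (hu' : some (u'.1, u'.2.2) ∈ Function.periodicPts fun o : Option _ => o.bind (K.nodeMap x)) :
    u.1 = u'.1 := by
  have h1 := (Function.bijOn_periodicPts fun o : Option _ => o.bind (K.nodeMap x)).injOn hu hu'
  simp only [Option.bind_some, nodeMap_of_step h (ne_zero_of_step hK h),
    nodeMap_of_step h' (ne_zero_of_step hK h'), Option.some.injEq, Prod.mk.injEq, forall_const] at h1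
  exact h1.1

/-- There is no path with infinite branches on both sides. -/
theorem false_of_branches [Finite P] (hK : ∀ σ p, K.next σ false p = none)
    {v w w' s z z' t : CounterConfig P x.length}
    (hw : K.Reaches x v w) (hw' : K.step x w = some w') (hs : K.step x s = some w')
    (hes : e w.1 < e s.1) (hsa : ¬Acc (K.Pred x) s)
    (hz : K.Reaches x v z) (hz' : K.step x z = some z') (ht : K.step x t = some z')
    (het : e t.1 < e z.1) (hta : ¬Acc (K.Pred x) t) : False := by
  have hsp := mem_periodicPts_of_not_acc hK hsa
  have htp := mem_periodicPts_of_not_acc hK hta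
  -- The branch that joins first makes the rest of the path periodic, so at the second junction the
  -- path and the branch arrive from periodic nodes, which must agree. If both join at the same
  -- vertex, `s` and `t` have the same state, which cannot lie on both sides of the path.
  rcases reaches_total hw hz with h | h
  · rcases Relation.ReflTransGen.cases_head h with rfl | ⟨c, h1, h2⟩
    · obtain rfl := Option.some.inj (hw'.symm.trans hz')
      have := fst_eq_of_step hK hs ht hsp htp
      rw [this] at hes
      exact lt_asymm hes het
    · obtain rfl := Option.some.inj (hw'.symm.trans h1)
      have hzp := mem_periodicPts_of_reaches hK h2 (mem_periodicPts_of_step hK hs hsp)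
      rw [fst_eq_of_step hK ht hz' htp hzp] at het
      exact lt_irrefl _ het
  · rcases Relation.ReflTransGen.cases_head h with rfl | ⟨c, h1, h2⟩
    · obtain rfl := Option.some.inj (hw'.symm.trans hz')
      have := fst_eq_of_step hK hs ht hsp htp
      rw [this] at hes
      exact lt_asymm hes het
    · obtain rfl := Option.some.inj (hz'.symm.trans h1)
      have hwp := mem_periodicPts_of_reaches hK h2 (mem_periodicPts_of_step hK ht htp)
      rw [fst_eq_of_step hK hs hw' hsp hwp] at hes
      exact lt_irrefl _ hes

/-- One of the two traversals with opposite orders leads to the end of the computation. -/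
theorem visits_or_visits_neg [Finite P] (hK : ∀ σ p, K.next σ false p = none) (he : e.Injective)
    {v r : CounterConfig P x.length} (h : K.Reaches x v r) :
    K.Visits e x (up v) (up r) ∨ K.Visits (fun q => -e q) x (up v) (up r) := by
  have he' : Function.Injective fun q => -e q := fun a b h => he (neg_injective h)
  rcases visits_or_branch he h with h1 | ⟨w, w', s, h1, h2, -, h3, h4, h5, -⟩
  · exact .inl h1
  rcases visits_or_branch he' h with h1' | ⟨z, z', t, h1', h2', -, h3', h4', h5', -⟩
  · exact .inr h1'
  exact (false_of_branches hK h1 h2 h3 h4 h5 h1' h2' h3' (neg_lt_neg_iff.1 h4') h5').elim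

end PartialMachine

/-! ### Detecting cycles by recording peaks -/

namespace Walker

variable {α W : Type*} {A : Walker α W} {x : List α}

open scoped Classical in
/-- Record a visit to a peak. The value `none` reports the second visit to the same peak, or the
third one if the flag is not set. -/
noncomputable def lap (τ : Set W × Bool) (w : W) : Option (Set W × Bool) :=
  if w ∈ τ.1 then if τ.2 = true then none else some ({w}, true) else some (insert w τ.1, τ.2)

open scoped Classical in
/-- Record a visit to a square which is a peak if `g` holds. -/
noncomputable def tick (g : Prop) (τ : Set W × Bool) (w : W) : Option (Set W × Bool) :=
  if g then lap τ w else some τ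

/-- The record of the first `k` steps. -/
noncomputable def tags (A : Walker α W) (x : List α) (y : W × ZMod (x.length + 2))
    (τ : Set W × Bool) : ℕ → Option (Set W × Bool)
  | 0 => some τ
  | k + 1 => (tags A x y τ k).bind fun τ =>
    tick (A.Peak x ((A.move x)^[k] y)) τ ((A.move x)^[k] y).1

variable {y : W × ZMod (x.length + 2)}

theorem tags_eq_none_of_le {τ : Set W × Bool} {k l : ℕ} (hkl : k ≤ l)
    (h : A.tags x y τ k = none) : A.tags x y τ l = none := by
  induction l, hkl using Nat.le_induction with
  | base => exact h
  | succ l _ ih => simp [tags, ih]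

theorem exists_tags_eq_some {τ : Set W × Bool} {k : ℕ} (h : A.tags x y τ k = none) :
    ∃ n < k, ∃ τ', A.tags x y τ n = some τ' ∧ A.tags x y τ (n + 1) = none := by
  induction k with
  | zero => simp [tags] at h
  | succ k ih =>
    rcases h1 : A.tags x y τ k with _ | τ'
    · obtain ⟨n, h2, h3⟩ := ih h1
      exact ⟨n, by omega, h3⟩
    · exact ⟨k, by omega, τ', h1, h⟩

theorem iterate_eq_of_peak [Finite W] (hA : (A.move x).Injective) {i k : ℕ} (hik : i ≤ k)
    (h : A.Peak x ((A.move x)^[i] y)) (h' : A.Peak x ((A.move x)^[k] y))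
    (hw : ((A.move x)^[i] y).1 = ((A.move x)^[k] y).1) :
    (A.move x)^[i] y = (A.move x)^[k] y := by
  obtain ⟨m, rfl⟩ := Nat.exists_eq_add_of_le' hik
  rw [Function.iterate_add_apply] at h' hw ⊢
  exact (eq_of_peak hA h h' hw.symm).symm

/-- The first recorded lap consists of the peaks visited so far. -/
theorem tags_first_lap {k : ℕ} {τ : Set W × Bool} (h : A.tags x y (∅, true) k = some τ) :
    τ.2 = true ∧ ∀ w, w ∈ τ.1 ↔
      ∃ i < k, A.Peak x ((A.move x)^[i] y) ∧ ((A.move x)^[i] y).1 = w := by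
  induction k generalizing τ with
  | zero =>
    obtain rfl := Option.some.inj h
    simp
  | succ k ih =>
    simp only [tags, Option.bind_eq_some_iff] at h
    obtain ⟨τ', h1, h2⟩ := h
    obtain ⟨h3, h4⟩ := ih h1
    unfold tick lap at h2
    split_ifs at h2 with hp hm
    · obtain rfl := Option.some.inj h2
      refine ⟨h3, fun w => ?_⟩
      rw [Set.mem_insert_iff, h4]
      constructor
      · rintro (rfl | ⟨i, h5, h6⟩)
        · exact ⟨k, by omega, hp, rfl⟩
        · exact ⟨i, by omega, h6⟩
      · rintro ⟨i, h5, h6, rfl⟩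
        rcases Nat.lt_succ_iff_lt_or_eq.1 h5 with h7 | rfl
        · exact .inr ⟨i, h7, h6, rfl⟩
        · exact .inl rfl
    · obtain rfl := Option.some.inj h2
      refine ⟨h3, fun w => (h4 w).trans ⟨?_, ?_⟩⟩
      · rintro ⟨i, h5, h6⟩
        exact ⟨i, by omega, h6⟩
      · rintro ⟨i, h5, h6, h7⟩
        rcases Nat.lt_succ_iff_lt_or_eq.1 h5 with h8 | rfl
        · exact ⟨i, h8, h6, h7⟩
        · exact absurd h6 hp

theorem exists_eq_of_tags_first_lap [Finite W] (hA : (A.move x).Injective) {k : ℕ}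
    {τ : Set W × Bool} (h : A.tags x y (∅, true) k = some τ)
    (h' : A.tags x y (∅, true) (k + 1) = none) :
    ∃ i < k, (A.move x)^[i] y = (A.move x)^[k] y := by
  rw [tags, h, Option.bind_some] at h'
  unfold tick lap at h'
  split_ifs at h' with hp hm
  obtain ⟨i, h1, h2, h3⟩ := ((tags_first_lap h).2 _).1 hm
  exact ⟨i, h1, iterate_eq_of_peak hA h1.le h2 hp h3⟩

/-- A peak occurs within the first period and recurs within the second. -/
theorem tags_first_lap_eq_none {T : ℕ} (hT : 0 < T)
    (h : (A.move x)^[T] y = y) : A.tags x y (∅, true) (2 * T) = none := by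
  obtain ⟨i, hi, hp⟩ : ∃ i < T, A.Peak x ((A.move x)^[i] y) := by
    obtain ⟨k, hk⟩ := A.exists_peak (x := x) y
    refine ⟨k % T, Nat.mod_lt _ hT, ?_⟩
    rwa [← Function.IsPeriodicPt.iterate_mod_apply (show Function.IsPeriodicPt (A.move x) T y from h)
      k] at hk
  have h1 : (A.move x)^[i + T] y = (A.move x)^[i] y := by rw [Function.iterate_add_apply, h]
  refine tags_eq_none_of_le (k := i + T + 1) (by omega) ?_
  rcases h2 : A.tags x y (∅, true) (i + T) with _ | τ
  · exact tags_eq_none_of_le (Nat.le_succ _) h2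
  · obtain ⟨h3, h4⟩ := tags_first_lap h2
    have h5 := (h4 _).2 ⟨i, by omega, hp, rfl⟩
    simp [tags, h2, tick, h1, hp, lap, h5, h3]

/-- Without the flag, the first repetition, at times `s` and `f`, only sets the flag and restarts
the record at time `f`. A failure thus needs two repetitions over successive stretches of time. -/
theorem tags_second_lap [Finite W] (hA : (A.move x).Injective) {k : ℕ} {τ : Set W × Bool}
    (h : A.tags x y (∅, false) k = some τ) :
    (τ.2 = false ∧ ∀ w ∈ τ.1,
      ∃ i < k, A.Peak x ((A.move x)^[i] y) ∧ ((A.move x)^[i] y).1 = w) ∨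
    (τ.2 = true ∧ ∃ s f, s < f ∧ f < k ∧ (A.move x)^[s] y = (A.move x)^[f] y ∧ ∀ w ∈ τ.1,
      ∃ i < k, f ≤ i ∧ A.Peak x ((A.move x)^[i] y) ∧ ((A.move x)^[i] y).1 = w) := by
  induction k generalizing τ with
  | zero =>
    obtain rfl := Option.some.inj h
    simp
  | succ k ih =>
    simp only [tags, Option.bind_eq_some_iff] at h
    obtain ⟨τ', h1, h2⟩ := h
    have ih := ih h1
    unfold tick lap at h2
    split_ifs at h2 with hp hm hb
    · obtain rfl := Option.some.inj h2
      obtain ⟨-, h3⟩ | ⟨h3, -⟩ := ih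
      · obtain ⟨i, h4, h5, h6⟩ := h3 _ hm
        refine .inr ⟨rfl, i, k, h4, by omega, iterate_eq_of_peak hA h4.le h5 hp h6, ?_⟩
        rintro w rfl
        exact ⟨k, by omega, le_rfl, hp, rfl⟩
      · exact absurd h3 hb
    · obtain rfl := Option.some.inj h2
      obtain ⟨h3, h4⟩ | ⟨h3, s, f, h4, hf, h5, h6⟩ := ih
      · refine .inl ⟨h3, ?_⟩
        rintro w (rfl | hw)
        · exact ⟨k, by omega, hp, rfl⟩
        · obtain ⟨i, h5, h6⟩ := h4 w hw
          exact ⟨i, by omega, h6⟩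
      · refine .inr ⟨h3, s, f, h4, by omega, h5, ?_⟩
        rintro w (rfl | hw)
        · exact ⟨k, by omega, hf.le, hp, rfl⟩
        · obtain ⟨i, h7, h8⟩ := h6 w hw
          exact ⟨i, by omega, h8⟩
    · obtain rfl := Option.some.inj h2
      obtain ⟨h3, h4⟩ | ⟨h3, s, f, h4, hf, h5, h6⟩ := ih
      · refine .inl ⟨h3, fun w hw => ?_⟩
        obtain ⟨i, h5, h6⟩ := h4 w hw
        exact ⟨i, by omega, h6⟩
      · refine .inr ⟨h3, s, f, h4, by omega, h5, fun w hw => ?_⟩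
        obtain ⟨i, h7, h8⟩ := h6 w hw
        exact ⟨i, by omega, h8⟩

theorem exists_eq_of_tags_second_lap [Finite W] (hA : (A.move x).Injective) {k : ℕ}
    {τ : Set W × Bool} (h : A.tags x y (∅, false) k = some τ)
    (h' : A.tags x y (∅, false) (k + 1) = none) :
    ∃ s f t, s < f ∧ f ≤ t ∧ t < k ∧ (A.move x)^[s] y = (A.move x)^[f] y ∧
      (A.move x)^[t] y = (A.move x)^[k] y := by
  rw [tags, h, Option.bind_some] at h'
  unfold tick lap at h'
  split_ifs at h' with hp hm hb
  obtain ⟨h1, -⟩ | ⟨-, s, f, h1, -, h2, h3⟩ := tags_second_lap hA h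
  · simp [h1] at hb
  · obtain ⟨t, h4, h5, h6, h7⟩ := h3 _ hm
    exact ⟨s, f, t, h1, h5, h4, h2, iterate_eq_of_peak hA h4.le h6 hp h7⟩

end Walker

/-! ### The machine that traverses in two orders -/

namespace PartialMachine

variable {α P : Type*}

/-- The machine that stops when the counter is zero. -/
def restrict (K : PartialMachine α P) : PartialMachine α P where
  next σ s p := if s = true then K.next σ true p else none
  counter := K.counter
  head := K.head

theorem restrict_next_false (K : PartialMachine α P) (σ : TapeSymbol α) (p : P) :
    K.restrict.next σ false p = none := rfl

theorem restrict_step_of_ne_zero (K : PartialMachine α P) {x : List α}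
    {v : CounterConfig P x.length} (hv : v.2.1 ≠ 0) : K.restrict.step x v = K.step x v := by
  simp [step, restrict, counterSign, hv]

theorem restrict_step_of_eq_zero (K : PartialMachine α P) {x : List α}
    {v : CounterConfig P x.length} (hv : v.2.1 = 0) : K.restrict.step x v = none := by
  simp [step, restrict, counterSign, hv]

/-- The order of the traversal, or the opposite order. -/
def rank (e : P → ℤ) : Bool → P → ℤ
  | true => e
  | false => fun q => -e q

theorem rank_injective {e : P → ℤ} (he : e.Injective) (d : Bool) : (rank e d).Injective := by
  cases d
  · exact fun a b h => he (neg_injective h)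
  · exact he

theorem eq_down_of_snd_eq_false {K : PartialMachine α P} {x : List α}
    {κ : CounterConfig (P × Bool) x.length} (h : κ.1.2 = false) :
    κ = K.down (κ.1.1, κ.2.1 + (K.counter κ.1.1 : ℤ),
      κ.2.2 + ((K.head κ.1.1 : ℤ) : ZMod (x.length + 2))) := by
  obtain ⟨⟨p, t⟩, a, b⟩ := κ
  simp only at h
  subst h
  simp [down]

variable [Finite P]

/-- The traversal with nonzero counter. -/
noncomputable def walker (K : PartialMachine α P) (e : P → ℤ) (d : Bool) :
    Walker α (P × Bool) where
  turn σ w := K.restrict.turn (rank e d) σ true w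
  head := K.dartHead

open scoped Classical in
/-- The traversal of the configurations between two zeros of the counter. It is done in one order,
and, if this runs into a cycle, undone and done in the opposite order. The cycles are detected by
recording the peaks. -/
noncomputable def lapMachine (K : PartialMachine α P) (halt : Set P) (e : P → ℤ) :
    LookbehindMachine α (Bool × (P × Bool) × (Set (P × Bool) × Bool))
      (Bool → Set ((P × Bool) × Option (P × Bool))) where
  update ρ σ d := (K.walker e d).extend (ρ d) σ
  init _ := Walker.emptyTable
  next ρ σ s q :=
    if q.2.1.1 ∈ halt then none
    else if s = true then
      match Walker.tick (σ = .rightEnd ∨ ∀ o, (q.2.1, o) ∉ (K.walker e q.1).extend (ρ q.1) σ)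
        q.2.2 q.2.1 with
      | some τ => some (q.1, K.restrict.turn (rank e q.1) σ true q.2.1, τ)
      -- A repeated peak in the first order reveals a cycle, and `swap` starts the walk back. The
      -- flag is unset because this walk may itself go round the cycle. A failure in the second
      -- order is final and ensures termination.
      | none => if q.1 = true then some (false, swap q.2.1, (∅, false)) else none
    -- At counter value `0` a state `(p, true)` stands for a root of the restricted graph, where `K`
    -- makes its own step. A state `(p, false)` has no predecessors to explore, so the walk turns
    -- around with an empty record.
    else if q.2.1.2 = true then
      (K.next σ false q.2.1.1).map fun p => (true, (p, true), (∅, true))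
    else some (q.1, (q.2.1.1, true), (∅, q.1))
  counter q := K.dartCounter q.2.1
  head q := K.dartHead q.2.1

/-- A configuration of the machine `lapMachine`. -/
def lapConfig {n : ℕ} (d : Bool) (κ : CounterConfig (P × Bool) n) (τ : Set (P × Bool) × Bool) :
    CounterConfig (Bool × (P × Bool) × (Set (P × Bool) × Bool)) n :=
  ((d, κ.1, τ), κ.2)

theorem walker_move_of_ne_zero (K : PartialMachine α P) (e : P → ℤ) (d : Bool) {x : List α}
    {κ : CounterConfig (P × Bool) x.length} (hκ : κ.2.1 ≠ 0) :
    (K.walker e d).move x (κ.1, κ.2.2) =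
      ((K.restrict.tour (rank e d) x κ).1, (K.restrict.tour (rank e d) x κ).2.2) := by
  simp [Walker.move, walker, tour, counterSign, hκ, moveTo, dartHead, restrict]

/-- Both nodes are lifted to counter value `1`. The entered state determines the counter change, so
equal nodes after the step come from equal configurations. -/
theorem walker_move_injective (K : PartialMachine α P) {e : P → ℤ} (he : e.Injective) (d : Bool)
    (x : List α) : ((K.walker e d).move x).Injective := by
  intro y y' h
  rw [show y = (y.1, y.2) from rfl, show y' = (y'.1, y'.2) from rfl,
    K.walker_move_of_ne_zero e d (κ := (y.1, 1, y.2)) one_ne_zero,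
    K.walker_move_of_ne_zero e d (κ := (y'.1, 1, y'.2)) one_ne_zero] at h
  obtain ⟨h1, h2⟩ := Prod.ext_iff.1 h
  have h3 : K.restrict.tour (rank e d) x (y.1, 1, y.2) =
      K.restrict.tour (rank e d) x (y'.1, 1, y'.2) := by
    refine Prod.ext h1 (Prod.ext ?_ h2)
    exact congrArg (fun w => (1 : ℤ) + (K.restrict.dartCounter w : ℤ)) h1
  have h4 := K.restrict.tour_injective (rank_injective he d) x h3
  simp only [Prod.mk.injEq, true_and] at h4
  exact Prod.ext h4.1 h4.2

section LapMachine

variable {K : PartialMachine α P} {halt : Set P} {e : P → ℤ} {x : List α}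

/-- The traversal goes on at `κ`. -/
def Goes (halt : Set P) {n : ℕ} (κ : CounterConfig (P × Bool) n) : Prop :=
  κ.2.1 ≠ 0 ∧ κ.1.1 ∉ halt

/-- The traversal has reached the end of the computation. -/
def Stops (halt : Set P) {n : ℕ} (κ : CounterConfig (P × Bool) n) : Prop :=
  κ.1.1 ∈ halt ∨ (κ.2.1 = 0 ∧ κ.1.2 = true)

theorem lapMachine_pre (i : ℕ) (d : Bool) :
    (K.lapMachine halt e).pre x i d = (K.walker e d).table x i := by
  induction i with
  | zero => rfl
  | succ i ih =>
    rw [LookbehindMachine.pre, Walker.table, ← ih]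
    rfl

theorem lapMachine_next_true (q : Bool × (P × Bool) × (Set (P × Bool) × Bool))
    (hq : q.2.1.1 ∉ halt) (b : ZMod (x.length + 2)) :
    (K.lapMachine halt e).next ((K.lapMachine halt e).pre x b.val) (tapeSymbol x b.val) true q =
      match Walker.tick ((K.walker e q.1).Peak x (q.2.1, b)) q.2.2 q.2.1 with
      | some τ => some (q.1, K.restrict.turn (rank e q.1) (tapeSymbol x b.val) true q.2.1, τ)
      | none => if q.1 = true then some (false, swap q.2.1, (∅, false)) else none := by
  obtain ⟨i, hi, rfl⟩ := exists_natCast_position b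
  rw [Walker.peak_iff hi, ← lapMachine_pre (halt := halt), val_natCast_position hi]
  simp only [lapMachine, hq, if_false, if_true]

theorem lapMachine_step_of_goes {d : Bool} {κ : CounterConfig (P × Bool) x.length}
    (hκ : Goes halt κ) {τ τ' : Set (P × Bool) × Bool}
    (h : Walker.tick ((K.walker e d).Peak x (κ.1, κ.2.2)) τ κ.1 = some τ') :
    (K.lapMachine halt e).step x (lapConfig d κ τ) =
      some (lapConfig d (K.restrict.tour (rank e d) x κ) τ') := by
  have hs : counterSign κ.2.1 = true := by simp [counterSign, hκ.1]
  simp only [LookbehindMachine.step, lapConfig]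
  rw [hs, lapMachine_next_true _ hκ.2]
  simp only [h]
  simp [tour, hs, moveTo, lapMachine, dartCounter, dartHead, restrict]

theorem lapMachine_step_of_tick_eq_none {κ : CounterConfig (P × Bool) x.length}
    (hκ : Goes halt κ) {τ : Set (P × Bool) × Bool}
    (h : Walker.tick ((K.walker e true).Peak x (κ.1, κ.2.2)) τ κ.1 = none) :
    (K.lapMachine halt e).step x (lapConfig true κ τ) =
      some (lapConfig false (K.restrict.rev κ) (∅, false)) := by
  have hs : counterSign κ.2.1 = true := by simp [counterSign, hκ.1]
  simp only [LookbehindMachine.step, lapConfig]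
  rw [hs, lapMachine_next_true _ hκ.2]
  simp only [h]
  simp [rev, moveTo, lapMachine, sub_eq_add_neg, SignType.coe_neg]
  simp [dartCounter, dartHead, restrict]

/-- At counter value `0`, the traversal turns around. -/
theorem restrict_tour_of_eq_zero {d : Bool} {κ : CounterConfig (P × Bool) x.length}
    (h : κ.1.2 = false) (h0 : κ.2.1 = 0) :
    K.restrict.tour (rank e d) x κ = up (κ.1.1, κ.2.1 + (K.counter κ.1.1 : ℤ),
      κ.2.2 + ((K.head κ.1.1 : ℤ) : ZMod (x.length + 2))) := by
  conv_lhs => rw [eq_down_of_snd_eq_false (K := K.restrict) h]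
  refine tour_down_leaf fun u hu => ?_
  have h1 := ne_zero_of_step K.restrict_next_false hu
  rw [(eq_of_step hu).1] at h1
  simp [h0] at h1

theorem lapMachine_step_of_eq_zero {d : Bool} {κ : CounterConfig (P × Bool) x.length}
    (hκ : κ.1.1 ∉ halt) (h : κ.1.2 = false) (h0 : κ.2.1 = 0) (τ : Set (P × Bool) × Bool) :
    (K.lapMachine halt e).step x (lapConfig d κ τ) =
      some (lapConfig d (K.restrict.tour (rank e d) x κ) (∅, d)) := by
  rw [restrict_tour_of_eq_zero h h0]
  simp [LookbehindMachine.step, lapConfig, lapMachine, hκ, h, h0, counterSign, moveTo, up,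
    dartCounter, dartHead]

theorem lapMachine_step_up {d : Bool} {v u : CounterConfig P x.length}
    (hv : v.1 ∉ halt) (h0 : v.2.1 = 0) (h : K.step x v = some u) (τ : Set (P × Bool) × Bool) :
    (K.lapMachine halt e).step x (lapConfig d (up v) τ) =
      some (lapConfig true (up u) (∅, true)) := by
  simp only [step, h0, Option.map_eq_some_iff] at h
  obtain ⟨p, hp, rfl⟩ := h
  have hs : counterSign 0 = false := by simp [counterSign]
  rw [hs] at hp
  simp [LookbehindMachine.step, lapConfig, lapMachine, hv, h0, hs, hp, moveTo, up,
    dartCounter, dartHead]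

end LapMachine

end PartialMachine

/-! ### The walk between zeros of the counter, and its reversal -/

namespace PartialMachine

variable {α P : Type*} [Finite P] {K : PartialMachine α P} {halt : Set P} {e : P → ℤ}
  {x : List α}

theorem walker_iterate {d : Bool} {κ : CounterConfig (P × Bool) x.length} {k : ℕ}
    (h : ∀ i < k, Goes halt ((K.restrict.tour (rank e d) x)^[i] κ)) :
    ((K.walker e d).move x)^[k] (κ.1, κ.2.2) = (((K.restrict.tour (rank e d) x)^[k] κ).1,
      ((K.restrict.tour (rank e d) x)^[k] κ).2.2) := by
  induction k with
  | zero => rfl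
  | succ k ih =>
    rw [Function.iterate_succ_apply', ih fun i hi => h i (by omega),
      walker_move_of_ne_zero K e d (h k (by omega)).1, Function.iterate_succ_apply']

theorem reaches_of_tags {d : Bool} {κ : CounterConfig (P × Bool) x.length} {k : ℕ}
    (h : ∀ i < k, Goes halt ((K.restrict.tour (rank e d) x)^[i] κ))
    {τ τ' : Set (P × Bool) × Bool} (ht : (K.walker e d).tags x (κ.1, κ.2.2) τ k = some τ') :
    (K.lapMachine halt e).Reaches x (lapConfig d κ τ)
      (lapConfig d ((K.restrict.tour (rank e d) x)^[k] κ) τ') := by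
  induction k generalizing τ' with
  | zero =>
    obtain rfl := Option.some.inj ht
    exact .refl
  | succ k ih =>
    simp only [Walker.tags, Option.bind_eq_some_iff] at ht
    obtain ⟨τ₁, h1, h2⟩ := ht
    rw [walker_iterate fun i hi => h i (by omega)] at h2
    rw [Function.iterate_succ_apply']
    exact (ih (fun i hi => h i (by omega)) h1).tail (lapMachine_step_of_goes (h k (by omega)) h2)

/-- With nonzero counter, a step of the traversal does not depend on the counter value. -/
theorem tour_add {κ : CounterConfig (P × Bool) x.length} {δ : ℤ} (h : κ.2.1 ≠ 0)
    (h' : κ.2.1 + δ ≠ 0) : K.tour e x (κ.1, κ.2.1 + δ, κ.2.2) =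
      ((K.tour e x κ).1, (K.tour e x κ).2.1 + δ, (K.tour e x κ).2.2) := by
  simp only [tour, counterSign, moveTo]
  simp [h, h', add_right_comm]

/-- If the traversal starts next to a zero of the counter and repeats a state and a head position
before the counter is zero, then it goes on forever. -/
theorem goes_of_iterate_eq (he : e.Injective) {d : Bool} {v : CounterConfig P x.length}
    (hv : v.2.1 = (K.counter v.1 : ℤ)) {i j k : ℕ}
    (h : ∀ i ≤ k, Goes halt ((K.restrict.tour (rank e d) x)^[i] (up v))) (hij : i < j) (hjk : j ≤ k)
    (heq : ((K.walker e d).move x)^[i] ((up v).1, v.2.2) =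
      ((K.walker e d).move x)^[j] ((up v).1, v.2.2)) (m : ℕ) :
    Goes halt ((K.restrict.tour (rank e d) x)^[m] (up v)) := by
  set U := K.restrict.tour (rank e d) x with hU
  set T := j - i with hT
  have hA := K.walker_move_injective he d x
  have hper : ((K.walker e d).move x)^[T] ((up v).1, v.2.2) = ((up v).1, v.2.2) := by
    refine (hA.iterate i) ?_
    rw [← Function.iterate_add_apply, show i + T = j by omega, heq]
  have hsq : ∀ c : SignType, c = 0 ∨ c = 1 ∨ c = -1 := by decide
  have hstep : ∀ m, ∃ c : SignType, (U^[m + 1] (up v)).2.1 = (U^[m] (up v)).2.1 + (c : ℤ) := by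
    intro m
    rw [Function.iterate_succ_apply']
    exact ⟨_, rfl⟩
  have hv0 : v.2.1 ≠ 0 := (h 0 (Nat.zero_le _)).1
  -- The factor `v.2.1` is a sign, and its product with the counter measures the distance from zero
  -- on the starting side.
  have hv1 : v.2.1 = 1 ∨ v.2.1 = -1 := by
    rcases hsq (K.counter v.1) with hc | hc | hc <;> rw [hc] at hv <;> simp at hv
    · exact absurd hv hv0
    · exact .inl hv
    · exact .inr hv
  have hbase : ∀ m ≤ k, 1 ≤ v.2.1 * (U^[m] (up v)).2.1 := by
    intro m hm
    induction m with
    | zero => rcases hv1 with h1 | h1 <;> simp [up, h1]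
    | succ m ih =>
      have ih := ih (by omega)
      obtain ⟨c, hc⟩ := hstep m
      have h1 := (h (m + 1) hm).1
      rw [hc] at h1 ⊢
      generalize (U^[m] (up v)).2.1 = a at *
      rcases hv1 with h2 | h2 <;> rw [h2] at ih ⊢ <;>
        rcases hsq c with h3 | h3 | h3 <;> rw [h3] at h1 ⊢ <;> simp at h1 ih ⊢ <;> omega
  -- One period of the nodes shifts the counter by `δ`. As it starts at the least possible distance
  -- from zero, the shift is not towards zero, and every later period repeats the first one at least
  -- as far out.
  obtain ⟨δ, hδ⟩ : ∃ δ, (U^[T] (up v)).2.1 = v.2.1 + δ := ⟨_, (add_sub_cancel _ _).symm⟩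
  have hδ' : 0 ≤ v.2.1 * δ := by
    have h1 := hbase T (by omega)
    rw [hδ] at h1
    rcases hv1 with h2 | h2 <;> rw [h2] at h1 ⊢ <;> omega
  have key : ∀ m, U^[T + m] (up v) =
      ((U^[m] (up v)).1, (U^[m] (up v)).2.1 + δ, (U^[m] (up v)).2.2) ∧
      1 ≤ v.2.1 * (U^[m] (up v)).2.1 ∧ Goes halt (U^[m] (up v)) := by
    intro m
    induction m using Nat.strong_induction_on with
    | _ m ih =>
    refine ⟨?_, ?_⟩
    · rcases m with _ | m
      · have h1 := walker_iterate (K := K) (e := e) (d := d) (κ := up v) (k := T) (halt := halt)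
          fun i hi => h i (by omega)
        rw [show (up v).2.2 = v.2.2 from rfl, hper] at h1
        obtain ⟨h2, h3⟩ := Prod.ext_iff.1 h1
        exact Prod.ext h2.symm (Prod.ext hδ h3.symm)
      · obtain ⟨h1, h2, h3⟩ := ih m (by omega)
        rw [← add_assoc, Function.iterate_succ_apply', h1, Function.iterate_succ_apply']
        refine tour_add h3.1 fun h4 => ?_
        have h5 : v.2.1 * (U^[m] (up v)).2.1 + v.2.1 * δ = 0 := by rw [← mul_add, h4, mul_zero]
        omega
    · by_cases hm : m ≤ k
      · exact ⟨hbase m hm, h m hm⟩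
      · obtain ⟨m, rfl⟩ := Nat.exists_eq_add_of_le (show T ≤ m by omega)
        obtain ⟨h1, h2, h3⟩ := ih m (by omega)
        have h4 : 1 ≤ v.2.1 * ((U^[m] (up v)).2.1 + δ) := by rw [mul_add]; omega
        rw [h1]
        refine ⟨h4, ?_, h3.2⟩
        intro h5
        simp only at h5
        rw [h5] at h4
        simp at h4
  exact (key m).2.2

/-- The machine follows the traversal until the counter is zero or a halting state is reached. -/
theorem lapMachine_reaches_of_goes (he : e.Injective) {d : Bool} {v : CounterConfig P x.length}
    (hv : v.2.1 ≠ 0 → v.2.1 = (K.counter v.1 : ℤ)) {j : ℕ}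
    (h : ∀ i < j, Goes halt ((K.restrict.tour (rank e d) x)^[i] (up v)))
    (hj : ¬Goes halt ((K.restrict.tour (rank e d) x)^[j] (up v))) :
    ∃ τ, (K.lapMachine halt e).Reaches x (lapConfig d (up v) (∅, d))
      (lapConfig d ((K.restrict.tour (rank e d) x)^[j] (up v)) τ) := by
  have hA := K.walker_move_injective he d x
  rcases ht : (K.walker e d).tags x ((up v).1, (up v).2.2) (∅, d) j with _ | τ
  swap
  · exact ⟨τ, reaches_of_tags h ht⟩
  exfalso
  obtain ⟨n, hn, τ, h1, h2⟩ := Walker.exists_tags_eq_some ht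
  -- A failing record means a repeated node, after which the walk would go on forever, against `hj`.
  obtain ⟨i, k, h3, h4, h5⟩ : ∃ i k, i < k ∧ k ≤ n ∧
      ((K.walker e d).move x)^[i] ((up v).1, (up v).2.2) =
        ((K.walker e d).move x)^[k] ((up v).1, (up v).2.2) := by
    cases d
    · obtain ⟨s, f, t, h3, h4, h5, h6, h7⟩ := Walker.exists_eq_of_tags_second_lap hA h1 h2
      exact ⟨t, n, h5, le_rfl, h7⟩
    · obtain ⟨i, h3, h4⟩ := Walker.exists_eq_of_tags_first_lap hA h1 h2
      exact ⟨i, n, h3, le_rfl, h4⟩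
  exact hj (goes_of_iterate_eq he (hv (h 0 (by omega)).1) (fun i hi => h i (by omega)) h3 h4 h5 j)

theorem rev_iterate (he : e.Injective) (κ : CounterConfig (P × Bool) x.length) {n k : ℕ}
    (hk : k ≤ n) :
    (K.tour (rank e false) x)^[k] (K.rev ((K.tour (rank e true) x)^[n] κ)) =
      K.rev ((K.tour (rank e true) x)^[n - k] κ) := by
  induction k with
  | zero => rfl
  | succ k ih =>
    rw [Function.iterate_succ_apply', ih (by omega), show n - k = (n - (k + 1)) + 1 by omega,
      Function.iterate_succ_apply']
    exact K.tour_neg_rev he x _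

/-- If the traversal runs into a cycle, then the machine starts it again in the opposite order. -/
theorem lapMachine_reaches_opposite (he : e.Injective) {v : CounterConfig P x.length}
    (hv : v.2.1 ≠ 0 → v.2.1 = (K.counter v.1 : ℤ))
    (h : ∀ i, Goes halt ((K.restrict.tour (rank e true) x)^[i] (up v))) :
    (K.lapMachine halt e).Reaches x (lapConfig true (up v) (∅, true))
      (lapConfig false (up v) (∅, false)) := by
  set U := K.restrict.tour (rank e true) x with hU
  set U' := K.restrict.tour (rank e false) x with hU'
  set A := K.walker e true with hA'
  have hA := K.walker_move_injective he true x
  have hA2 := K.walker_move_injective he false x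
  have hv' := hv (h 0).1
  have hnode : ∀ k, (A.move x)^[k] ((up v).1, (up v).2.2) =
      ((U^[k] (up v)).1, (U^[k] (up v)).2.2) := fun k => walker_iterate fun i _ => h i
  obtain ⟨T, hT, hper⟩ := hA.mem_periodicPts ((up v).1, (up v).2.2)
  obtain ⟨n, -, τ, h1, h2⟩ := Walker.exists_tags_eq_some (Walker.tags_first_lap_eq_none hT hper)
  -- The cycle is detected before two periods have passed.
  have hlt : ∀ T, 0 < T → (A.move x)^[T] ((up v).1, (up v).2.2) = ((up v).1, (up v).2.2) →
      n < 2 * T := by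
    intro T hT hper
    by_contra hn
    have := Walker.tags_eq_none_of_le (not_lt.1 hn) (Walker.tags_first_lap_eq_none hT hper)
    exact absurd (this.symm.trans h1) (by simp)
  have hflip : (K.lapMachine halt e).Reaches x (lapConfig true (up v) (∅, true))
      (lapConfig false (K.restrict.rev (U^[n] (up v))) (∅, false)) := by
    refine (reaches_of_tags (fun i _ => h i) h1).tail
      (lapMachine_step_of_tick_eq_none (h n) ?_)
    rw [Walker.tags, h1, Option.bind_some, hnode] at h2
    exact h2
  have hback : ∀ k ≤ n, U'^[k] (K.restrict.rev (U^[n] (up v))) =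
      K.restrict.rev (U^[n - k] (up v)) := fun k hk => rev_iterate he (up v) hk
  have hgoes : ∀ k < n, Goes halt (U'^[k] (K.restrict.rev (U^[n] (up v)))) := by
    intro k hk
    rw [hback k hk.le, show n - k = (n - k - 1) + 1 by omega, Function.iterate_succ_apply']
    refine ⟨?_, ?_⟩
    · have h3 := (h (n - k - 1)).1
      rwa [← add_sub_cancel_right (U^[n - k - 1] (up v)).2.1
        (K.restrict.dartCounter (U (U^[n - k - 1] (up v))).1 : ℤ)] at h3
    · have h3 := (h (n - k - 1 + 1)).2
      rw [Function.iterate_succ_apply'] at h3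
      exact h3
  have hnode' : ∀ k ≤ n, ((K.walker e false).move x)^[k]
      ((K.restrict.rev (U^[n] (up v))).1, (K.restrict.rev (U^[n] (up v))).2.2) =
      ((K.restrict.rev (U^[n - k] (up v))).1, (K.restrict.rev (U^[n - k] (up v))).2.2) := by
    intro k hk
    rw [walker_iterate (halt := halt) fun i hi => hgoes i (by omega), ← hback k hk]
  -- A repetition on the way back is one on the way out, so it spans more than half of the `n`
  -- steps. Two successive ones do not fit, so the walk back is never cut short.
  have hperiod : ∀ i k, i < k → k ≤ n → ((K.walker e false).move x)^[i]
      ((K.restrict.rev (U^[n] (up v))).1, (K.restrict.rev (U^[n] (up v))).2.2) =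
      ((K.walker e false).move x)^[k]
        ((K.restrict.rev (U^[n] (up v))).1, (K.restrict.rev (U^[n] (up v))).2.2) →
      n < 2 * (k - i) := by
    intro i k hik hkn heq
    rw [hnode' i (by omega), hnode' k hkn] at heq
    refine hlt (k - i) (by omega) ((hA.iterate (n - k)) ?_)
    rw [← Function.iterate_add_apply, show n - k + (k - i) = n - i by omega, hnode, hnode]
    simp only [rev, Prod.mk.injEq] at heq
    obtain ⟨h3, h4⟩ := heq
    have h3 := swap_injective h3
    rw [h3] at h4
    exact Prod.ext h3 (sub_left_injective h4)
  rcases ht : (K.walker e false).tags x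
    ((K.restrict.rev (U^[n] (up v))).1, (K.restrict.rev (U^[n] (up v))).2.2) (∅, false) n
    with _ | τ'
  · obtain ⟨m, hm, τ', h3, h4⟩ := Walker.exists_tags_eq_some ht
    obtain ⟨s, f, t, h5, h6, h7, h8, h9⟩ := Walker.exists_eq_of_tags_second_lap hA2 h3 h4
    have h10 := hperiod s f h5 (by omega) h8
    have h11 := hperiod t m h7 (by omega) h9
    omega
  · refine hflip.trans ((reaches_of_tags hgoes ht).trans ?_)
    -- The walk back ends at `K.restrict.down v`, where the counter is `0` by `hv'`. There it turns
    -- around and sets out from `up v` in the opposite order.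
    have h3 := hback n le_rfl
    rw [Nat.sub_self, Function.iterate_zero_apply, rev_up] at h3
    rw [← hU', h3]
    have h4 : (K.restrict.down v).2.1 = 0 := by
      simp [down, restrict, hv']
    refine .single ?_
    rw [lapMachine_step_of_eq_zero (κ := K.restrict.down v) (h 0).2 rfl h4, restrict_tour_of_eq_zero rfl h4]
    congr 2
    simp [up, down, restrict]

end PartialMachine

/-! ### Simulation of whole computations, and termination -/

namespace PartialMachine

section

variable {α P : Type*} {K : PartialMachine α P} {halt : Set P} {e : P → ℤ} {x : List α}

theorem Stops.not_goes {n : ℕ} {κ : CounterConfig (P × Bool) n} (h : Stops halt κ) :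
    ¬Goes halt κ := fun hg => h.elim hg.2 fun h => hg.1 h.1

theorem not_stops_of_interior (hhalt : ∀ p ∈ halt, ∀ σ s, K.next σ s p = none)
    {κ : CounterConfig (P × Bool) x.length} (h : K.restrict.Interior x κ) : ¬Stops halt κ := by
  obtain ⟨v, hv, h⟩ := h
  obtain ⟨u, hu⟩ := Option.isSome_iff_exists.1 hv
  have h0 := ne_zero_of_step K.restrict_next_false hu
  have h1 : v.1 ∉ halt := fun hp => by
    rw [restrict_step_of_ne_zero K h0] at hu
    simp [step, hhalt _ hp] at hu
  rcases h with rfl | rfl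
  · rintro (h2 | h2)
    · exact h1 h2
    · exact h0 h2.1
  · rintro (h2 | h2)
    · exact h1 h2
    · simp [down] at h2

/-- A measure of the progress of the machine at the peaks. -/
noncomputable def lapRank (d : Bool) (τ : Set (P × Bool) × Bool) : ℕ :=
  (if d = true then 2 * (Nat.card (P × Bool) + 1) else 0) +
    (if τ.2 = true then 0 else Nat.card (P × Bool) + 1) + τ.1ᶜ.ncard

/-- The weight of the first order exceeds that of an unset flag together with an empty record. -/
theorem lapRank_flip (τ : Set (P × Bool) × Bool) :
    lapRank (P := P) false (∅, false) < lapRank true τ := by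
  have h1 : (∅ : Set (P × Bool))ᶜ.ncard = Nat.card (P × Bool) := by
    rw [Set.compl_empty, Set.ncard_univ]
  simp only [lapRank, h1]
  simp
  omega

variable [Finite P]

/-- Where the traversal neither goes on nor has reached the end, it turns around. -/
theorem lapMachine_turnaround {d : Bool} {κ : CounterConfig (P × Bool) x.length}
    (hg : ¬Goes halt κ) (hs : ¬Stops halt κ) : ∃ v : CounterConfig P x.length,
      v.2.1 = (K.counter v.1 : ℤ) ∧ K.restrict.tour (rank e d) x κ = up v ∧
      ∀ τ, (K.lapMachine halt e).Reaches x (lapConfig d κ τ) (lapConfig d (up v) (∅, d)) := by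
  simp only [Stops, not_or, not_and, Bool.not_eq_true] at hs
  have h0 : κ.2.1 = 0 := by
    by_contra h0
    exact hg ⟨h0, hs.1⟩
  have h1 := restrict_tour_of_eq_zero (K := K) (e := e) (d := d) (hs.2 h0) h0
  exact ⟨_, by simp [h0], h1, fun τ => .single
    (h1 ▸ lapMachine_step_of_eq_zero hs.1 (hs.2 h0) h0 τ)⟩

/-- The machine follows the traversal until the end of the computation. -/
theorem lapMachine_reaches_of_stops (he : e.Injective) {d : Bool} (N : ℕ) :
    ∀ v : CounterConfig P x.length, (v.2.1 ≠ 0 → v.2.1 = (K.counter v.1 : ℤ)) →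
      (∀ i < N, ¬Stops halt ((K.restrict.tour (rank e d) x)^[i] (up v))) →
      Stops halt ((K.restrict.tour (rank e d) x)^[N] (up v)) →
      ∃ τ, (K.lapMachine halt e).Reaches x (lapConfig d (up v) (∅, d))
        (lapConfig d ((K.restrict.tour (rank e d) x)^[N] (up v)) τ) := by
  induction N using Nat.strong_induction_on with
  | _ N ih =>
  intro v hv hlt hN
  classical
  have hex : ∃ j, ¬Goes halt ((K.restrict.tour (rank e d) x)^[j] (up v)) := ⟨N, hN.not_goes⟩
  have h1 := Nat.find_spec hex
  have h2 := fun i (hi : i < Nat.find hex) => not_not.1 (Nat.find_min hex hi)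
  have h3 : Nat.find hex ≤ N := Nat.find_min' hex hN.not_goes
  generalize Nat.find hex = j at h1 h2 h3
  obtain ⟨τ, hτ⟩ := lapMachine_reaches_of_goes he hv h2 h1
  rcases h3.eq_or_lt with rfl | h3
  · exact ⟨τ, hτ⟩
  obtain ⟨u, hu, h4, h5⟩ := lapMachine_turnaround (e := e) (K := K) (d := d) h1 (hlt j h3)
  have h6 : ∀ i, (K.restrict.tour (rank e d) x)^[i] (up u) =
      (K.restrict.tour (rank e d) x)^[i + (j + 1)] (up v) := by
    intro i
    rw [Function.iterate_add_apply, Function.iterate_succ_apply', h4]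
  obtain ⟨τ', h7⟩ := ih (N - (j + 1)) (by omega) u (fun _ => hu)
    (fun i hi => by rw [h6]; exact hlt _ (by omega))
    (by rwa [h6, Nat.sub_add_cancel (by omega)])
  rw [h6, Nat.sub_add_cancel (by omega)] at h7
  exact ⟨τ', (hτ.trans (h5 τ)).trans h7⟩

/-- If the traversal goes on forever and visits finitely many zeros of the counter, then the machine
eventually starts it in the opposite order. -/
theorem lapMachine_reaches_of_diverges (he : e.Injective) (N : ℕ) :
    ∀ v : CounterConfig P x.length, (v.2.1 ≠ 0 → v.2.1 = (K.counter v.1 : ℤ)) →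
      (∀ i, ¬Stops halt ((K.restrict.tour (rank e true) x)^[i] (up v))) →
      (∀ i, N ≤ i → ((K.restrict.tour (rank e true) x)^[i] (up v)).2.1 ≠ 0) →
      ∃ (m : ℕ) (u : CounterConfig P x.length), (K.restrict.tour (rank e true) x)^[m] (up v) = up u ∧
        (u.2.1 ≠ 0 → u.2.1 = (K.counter u.1 : ℤ)) ∧
        (K.lapMachine halt e).Reaches x (lapConfig true (up v) (∅, true))
          (lapConfig false (up u) (∅, false)) := by
  induction N using Nat.strong_induction_on with
  | _ N ih =>
  intro v hv hs hN
  classical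
  by_cases hex : ∃ j, ¬Goes halt ((K.restrict.tour (rank e true) x)^[j] (up v))
  swap
  · push Not at hex
    exact ⟨0, v, rfl, hv, lapMachine_reaches_opposite he hv hex⟩
  have h1 := Nat.find_spec hex
  have h2 := fun i (hi : i < Nat.find hex) => not_not.1 (Nat.find_min hex hi)
  generalize Nat.find hex = j at h1 h2
  have hj : j < N := by
    by_contra hj
    exact h1 ⟨hN j (by omega), fun h => hs j (.inl h)⟩
  obtain ⟨τ, hτ⟩ := lapMachine_reaches_of_goes he hv h2 h1
  obtain ⟨u, hu, h4, h5⟩ := lapMachine_turnaround (e := e) (K := K) (d := true) h1 (hs j)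
  have h6 : ∀ i, (K.restrict.tour (rank e true) x)^[i] (up u) =
      (K.restrict.tour (rank e true) x)^[i + (j + 1)] (up v) := by
    intro i
    rw [Function.iterate_add_apply, Function.iterate_succ_apply', h4]
  obtain ⟨m, u', h7, h8, h9⟩ := ih (N - (j + 1)) (by omega) u (fun _ => hu)
    (fun i => by rw [h6]; exact hs _) (fun i hi => by rw [h6]; exact hN _ (by omega))
  exact ⟨m + (j + 1), u', by rw [← h6, h7], h8, (hτ.trans (h5 τ)).trans h9⟩

/-- The machine simulates the computation between two zeros of the counter. -/
theorem lapMachine_reaches_of_restrict (hhalt : ∀ p ∈ halt, ∀ σ s, K.next σ s p = none)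
    (he : e.Injective) {v r : CounterConfig P x.length}
    (hv : v.2.1 ≠ 0 → v.2.1 = (K.counter v.1 : ℤ)) (h : K.restrict.Reaches x v r)
    (hr : Stops halt (up r)) : ∃ d τ, (K.lapMachine halt e).Reaches x
      (lapConfig true (up v) (∅, true)) (lapConfig d (up r) τ) := by
  have hr' : K.restrict.step x r = none := by
    by_cases h0 : r.2.1 = 0
    · exact restrict_step_of_eq_zero K h0
    · rw [restrict_step_of_ne_zero K h0]
      have h1 : r.1 ∈ halt := hr.resolve_right fun h2 => h0 h2.1
      simp [step, hhalt _ h1]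
  have hvis : ∀ d (u : CounterConfig P x.length), (u.2.1 ≠ 0 → u.2.1 = (K.counter u.1 : ℤ)) →
      K.restrict.Visits (rank e d) x (up u) (up r) → ∃ τ, (K.lapMachine halt e).Reaches x
        (lapConfig d (up u) (∅, d)) (lapConfig d (up r) τ) := by
    intro d u hu h1
    obtain ⟨n, h2, h3⟩ := h1.exists_iterate
    obtain ⟨τ, h4⟩ := lapMachine_reaches_of_stops he n u hu
      (fun i hi => not_stops_of_interior hhalt (h3 i hi)) (h2 ▸ hr)
    exact ⟨τ, h2 ▸ h4⟩
  by_cases h1 : K.restrict.Visits (rank e true) x (up v) (up r)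
  · exact ⟨true, hvis true v hv h1⟩
  obtain ⟨h2, h3⟩ := tour_injective_of_not_visits he h hr' h1
  -- The walk never repeats itself, and only finitely many configurations have counter value `0`.
  obtain ⟨N, hN⟩ : ∃ N, ∀ i, N ≤ i → ((K.restrict.tour (rank e true) x)^[i] (up v)).2.1 ≠ 0 := by
    have hfin : {κ : CounterConfig (P × Bool) x.length | κ.2.1 = 0}.Finite := by
      refine (Set.finite_range fun y : (P × Bool) × ZMod (x.length + 2) =>
        ((y.1, 0, y.2) : CounterConfig (P × Bool) x.length)).subset ?_
      rintro ⟨p, a, b⟩ rfl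
      exact ⟨(p, b), rfl⟩
    obtain ⟨N, hN⟩ := (hfin.preimage h3.injOn).bddAbove
    refine ⟨N + 1, fun i hi h0 => ?_⟩
    have : i ≤ N := hN h0
    omega
  obtain ⟨m, u, h4, h5, h6⟩ := lapMachine_reaches_of_diverges (K := K) he N v hv
    (fun i => not_stops_of_interior hhalt (h2 i)) hN
  -- The opposite walk may start from a later turning point `u` instead of `v`. It belongs to the
  -- same tree, and the first order fails from there too, because it continues the walk from `v`.
  have hur : K.restrict.Reaches x u r := by
    obtain ⟨u', h7, h8 | h8⟩ := tour_iterate_reaches (K := K.restrict) (e := rank e true) he h hr' m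
    · rw [show (K.restrict.tour (rank e true) x)^[m] (up v) = up u from h4] at h8
      have : u = u' := by
        simp only [up, Prod.mk.injEq, and_true] at h8
        exact Prod.ext h8.1 h8.2
      rwa [this]
    · rw [show (K.restrict.tour (rank e true) x)^[m] (up v) = up u from h4] at h8
      simp [up, down] at h8
  have h7 : ¬K.restrict.Visits (rank e true) x (up u) (up r) := by
    intro h7
    obtain ⟨n, h8, -⟩ := h7.exists_iterate
    refine not_stops_of_interior hhalt (h2 (n + m)) ?_
    change Stops halt ((K.restrict.tour (rank e true) x)^[n + m] (up v))
    rw [Function.iterate_add_apply, h4, h8]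
    exact hr
  obtain ⟨τ, h8⟩ := hvis false u h5
    ((visits_or_visits_neg K.restrict_next_false he hur).resolve_left h7)
  exact ⟨false, τ, h6.trans h8⟩

/-- The machine simulates a computation that leads to a halting state. -/
theorem lapMachine_reaches_of_reaches (hhalt : ∀ p ∈ halt, ∀ σ s, K.next σ s p = none)
    (he : e.Injective) {v w : CounterConfig P x.length} (hv : v.2.1 = 0)
    (h : K.Reaches x v w) (hw : w.1 ∈ halt) : ∃ d τ, (K.lapMachine halt e).Reaches x
      (lapConfig true (up v) (∅, true)) (lapConfig d (up w) τ) := by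
  -- Here `v` begins the current segment between zeros of the counter, and `u` is the point reached
  -- in it.
  suffices key : ∀ u, (v.2.1 ≠ 0 → v.2.1 = (K.counter v.1 : ℤ)) → K.restrict.Reaches x v u →
      K.Reaches x u w → ∃ d τ, (K.lapMachine halt e).Reaches x
        (lapConfig true (up v) (∅, true)) (lapConfig d (up w) τ) from
    key v (fun h => absurd hv h) .refl h
  clear h hv
  intro u hv hvu h
  induction h using Relation.ReflTransGen.head_induction_on generalizing v with
  | refl => exact lapMachine_reaches_of_restrict hhalt he hv hvu (.inl hw)
  | @head u u' hu _ ih =>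
    have hup : u.1 ∉ halt := fun hp => by simp [step, hhalt _ hp] at hu
    by_cases h0 : u.2.1 = 0
    · obtain ⟨d, τ, h1⟩ := lapMachine_reaches_of_restrict (K := K) hhalt he hv hvu
        (.inr ⟨h0, rfl⟩)
      have hu' : u'.2.1 = (K.counter u'.1 : ℤ) := by
        simp only [step, Option.map_eq_some_iff] at hu
        obtain ⟨p, -, rfl⟩ := hu
        simp [moveTo, h0]
      obtain ⟨d', τ', h2⟩ := ih (fun _ => hu') .refl
      exact ⟨d', τ', (h1.tail (lapMachine_step_up hup h0 hu τ)).trans h2⟩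
    · exact ih hv (hvu.tail (by rw [restrict_step_of_ne_zero K h0]; exact hu))

/-- Either the record grows, or the flag is set, and the weight of the flag exceeds any growth of
the complement. -/
theorem lapRank_lap {d : Bool} {τ τ' : Set (P × Bool) × Bool} {w : P × Bool}
    (h : Walker.lap τ w = some τ') : lapRank d τ' < lapRank d τ := by
  have hle : ∀ B : Set (P × Bool), B.ncard ≤ Nat.card (P × Bool) := fun B => by
    rw [← Set.ncard_univ]
    exact Set.ncard_le_ncard (Set.subset_univ B)
  unfold Walker.lap at h
  split_ifs at h with h1 h2
  · obtain rfl := Option.some.inj h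
    have := hle ({w} : Set (P × Bool))ᶜ
    simp only [lapRank, h2]
    simp only [if_true, if_false, Bool.false_eq_true]
    omega
  · obtain rfl := Option.some.inj h
    have h3 : (insert w τ.1)ᶜ.ncard < τ.1ᶜ.ncard := by
      refine Set.ncard_lt_ncard ?_
      refine ⟨Set.compl_subset_compl.2 (Set.subset_insert _ _), fun h4 => ?_⟩
      exact h4 h1 (Set.mem_insert _ _)
    simp only [lapRank]
    omega

/-- With nonzero counter, the machine always stops. -/
theorem exists_iterate_lapMachine_eq_none (K : PartialMachine α P) (halt : Set P) (e : P → ℤ)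
    (x : List α) (y : (Bool × (P × Bool) × (Set (P × Bool) × Bool)) × ZMod (x.length + 2)) :
    ∃ k, (fun o => o.bind ((K.lapMachine halt e).nodeMap x))^[k] (some y) = none := by
  obtain ⟨⟨d, w, τ⟩, b⟩ := y
  generalize hn : lapRank d τ = n
  induction n using Nat.strong_induction_on generalizing d w τ b with
  | _ n ih =>
  -- At a peak the machine stops or `lapRank` decreases; elsewhere the induction is on the time
  -- until the next peak.
  have hpeak : ∀ w b, (K.walker e d).Peak x (w, b) → lapRank d τ = n →
      ∃ k, (fun o => o.bind ((K.lapMachine halt e).nodeMap x))^[k] (some ((d, w, τ), b)) = none := by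
    intro w b hp hn
    by_cases hw : w.1 ∈ halt
    · exact ⟨1, by simp [LookbehindMachine.nodeMap, lapMachine, hw]⟩
    have h1 := lapMachine_next_true (K := K) (e := e) (d, w, τ) hw b
    simp only [hp, Walker.tick, if_true] at h1
    rcases h2 : Walker.lap τ w with _ | τ'
    · rw [h2] at h1
      cases d
      · exact ⟨1, by simp [LookbehindMachine.nodeMap, h1]⟩
      · obtain ⟨k, h3⟩ := ih _ (hn ▸ lapRank_flip τ)
          (b + ((K.dartHead (swap w) : ℤ) : ZMod _)) false (swap w) (∅, false) rfl
        refine ⟨k + 1, ?_⟩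
        rw [Function.iterate_succ_apply, Option.bind_some, LookbehindMachine.nodeMap, h1]
        exact h3
    · rw [h2] at h1
      obtain ⟨k, h3⟩ := ih _ (hn ▸ lapRank_lap h2)
        (b + ((K.dartHead (K.restrict.turn (rank e d) (tapeSymbol x b.val) true w) : ℤ) : ZMod _))
        d (K.restrict.turn (rank e d) (tapeSymbol x b.val) true w) τ' rfl
      refine ⟨k + 1, ?_⟩
      rw [Function.iterate_succ_apply, Option.bind_some, LookbehindMachine.nodeMap, h1]
      exact h3
  obtain ⟨k, hk⟩ := Walker.exists_peak (A := K.walker e d) (x := x) (w, b)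
  induction k generalizing w b with
  | zero => exact hpeak w b hk hn
  | succ k ihk =>
    by_cases hw : w.1 ∈ halt
    · exact ⟨1, by simp [LookbehindMachine.nodeMap, lapMachine, hw]⟩
    by_cases hp : (K.walker e d).Peak x (w, b)
    · exact hpeak w b hp hn
    have h1 := lapMachine_next_true (K := K) (e := e) (d, w, τ) hw b
    simp only [hp, Walker.tick, if_false] at h1
    rw [Function.iterate_succ_apply] at hk
    obtain ⟨k', h3⟩ := ihk _ _ hk
    refine ⟨k' + 1, ?_⟩
    rw [Function.iterate_succ_apply, Option.bind_some, LookbehindMachine.nodeMap, h1]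
    exact h3

end

/-- Every partial machine that halts on every input can be made reversible. -/
theorem exists_reversible_of_halts {α : Type*} {P : Type} [Finite P] (K : PartialMachine α P)
    (start : P) (acc rej : Set P) (hdis : Disjoint acc rej)
    (hhalt : ∀ p ∈ acc ∪ rej, ∀ σ s, K.next σ s p = none) (L : Language α)
    (hL : ∀ x ∈ L, ∃ v, v.1 ∈ acc ∧ K.Reaches x (start, 0, 0) v)
    (hL' : ∀ x ∉ L, ∃ v, v.1 ∈ rej ∧ K.Reaches x (start, 0, 0) v) :
    ∃ (Q' : Type) (_ : Fintype Q') (M' : TwoWayQuantum1CA α Q'),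
      M'.IsReversible ∧ M'.IsSimple ∧ M'.RecognizesWithProb L 1 := by
  have := Fintype.ofFinite P
  obtain ⟨e, he⟩ : ∃ e : P → ℤ, e.Injective :=
    ⟨fun p => (Fintype.equivFin P p : ℕ), fun p q h => (Fintype.equivFin P).injective
      (Fin.ext (Int.ofNat_inj.1 h))⟩
  have hlift : ∀ (x : List α) (F : Set P), F ⊆ acc ∪ rej →
      (∃ v, v.1 ∈ F ∧ K.Reaches x (start, 0, 0) v) →
      ∃ v, v.1 ∈ {q : Bool × (P × Bool) × (Set (P × Bool) × Bool) | q.2.1.1 ∈ F} ∧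
        (K.lapMachine (acc ∪ rej) e).Reaches x ((true, (start, true), (∅, true)), 0, 0) v := by
    rintro x F hF ⟨v, hv, h⟩
    obtain ⟨d, τ, h1⟩ := lapMachine_reaches_of_reaches hhalt he rfl h (hF hv)
    exact ⟨lapConfig d (up v) τ, hv, h1⟩
  refine (K.lapMachine (acc ∪ rej) e).exists_reversible (true, (start, true), (∅, true))
    {q | q.2.1.1 ∈ acc} {q | q.2.1.1 ∈ rej} (hdis.preimage _) ?_ L
    (fun x hx => hlift x acc Set.subset_union_left (hL x hx))
    (fun x hx => hlift x rej Set.subset_union_right (hL' x hx))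
    (exists_iterate_lapMachine_eq_none K _ e)
  intro q hq s σ sg
  have hq : q.2.1.1 ∈ acc ∪ rej := hq
  simp only [lapMachine]
  rw [if_pos hq]

end PartialMachine

/-! ### From two-way deterministic automata to partial machines -/

namespace TwoWayDet1CA

variable {α Q P : Type*} (M : TwoWayDet1CA α Q) (f : Q → P) (g : P → Q)

open scoped Classical in
/-- The partial machine that stops in the halting states and whose states record the last change of
the counter and the last move of the head, with states renamed along `f`. -/
noncomputable def toPartial : PartialMachine α (P × SignType × SignType) where
  next σ s p :=
    if g p.1 ∈ M.acc ∪ M.rej then none else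
      some (f (M.δ (g p.1) σ s).1, (M.δ (g p.1) σ s).2)
  counter p := p.2.1
  head p := p.2.2

variable {M f g}

theorem toPartial_reaches (hfg : Function.LeftInverse g f) {x : List α} {t : ℕ}
    (h : ∀ i < t, (M.run x i).1 ∉ M.acc ∪ M.rej) :
    ∃ v : CounterConfig (P × SignType × SignType) x.length, g v.1.1 = (M.run x t).1 ∧
      v.2 = (M.run x t).2 ∧ (M.toPartial f g).Reaches x ((f M.start, 0, 0), 0, 0) v := by
  induction t with
  | zero => exact ⟨_, hfg _, rfl, .refl⟩
  | succ t ih =>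
    obtain ⟨v, h1, h2, h3⟩ := ih fun i hi => h i (by omega)
    have h4 := h t (by omega)
    have h5 : M.run x (t + 1) = M.step x (M.run x t) := Function.iterate_succ_apply' _ _ _
    rw [h5]
    refine ⟨_, ?_, ?_, h3.tail (Option.map_eq_some_iff.2 ⟨_, if_neg (h1 ▸ h4), rfl⟩)⟩
    · simp only [moveTo, hfg _, h1, h2, step]
    · simp only [moveTo, h1, h2, step, toPartial]

end TwoWayDet1CA

theorem theorem12 {α : Type*} [Finite α] {Q : Type*} [Finite Q] (L : Language α)
    (M : TwoWayDet1CA α Q) (hM : M.Recognizes L) :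
    ∃ (Q' : Type) (_ : Fintype Q') (M' : TwoWayQuantum1CA α Q'),
      M'.IsReversible ∧ M'.IsSimple ∧ M'.RecognizesWithProb L 1 := by
  have := Fintype.ofFinite Q
  -- The states may live in any universe; renaming them by `Fin` gives a state set in `Type`.
  let φ := Fintype.equivFin Q
  have hfg : Function.LeftInverse φ.symm φ := φ.symm_apply_apply
  refine (M.toPartial φ φ.symm).exists_reversible_of_halts (φ M.start, 0, 0)
    {p | φ.symm p.1 ∈ M.acc} {p | φ.symm p.1 ∈ M.rej} (M.disjoint.preimage _) ?_ L ?_ ?_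
  · intro p hp σ s
    exact if_pos hp
  · intro x hx
    obtain ⟨t, h1, h2⟩ := hM.1 x hx
    obtain ⟨v, h3, -, h4⟩ := TwoWayDet1CA.toPartial_reaches hfg h2
    exact ⟨v, by rwa [← h3] at h1, h4⟩
  · intro x hx
    obtain ⟨t, h1, h2⟩ := hM.2 x hx
    obtain ⟨v, h3, -, h4⟩ := TwoWayDet1CA.toPartial_reaches hfg h2
    exact ⟨v, by rwa [← h3] at h1, h4⟩
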